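/- Let $\Omega,\Omega'\subset\mathbb R^3$ be smooth bounded domains, let $g:\overline\Omega\to\overline{\Omega'}$ be a $C^1$-diffeomorphism, let $M>0$, and let $H:(0,\infty)\to[0,\infty)$ be convex with $\lim_{t\to\infty}H(t)/t=\lim_{s\to0^+}H(s)=+\infty$. Let $\mathcal A$ be the set of all $u\in W^{1,2}(\Omega,\mathbb R^3)$ such that $u|_{\partial\Omega}=g|_{\partial\Omega}$ (in the sense of traces), $\|u\|_{L^\infty}\le M$, $\det Du>0$ a.e., and $u$ is one-to-one outside a null set. For $u\in\mathcal A$ put $$E(u)=\int_\Omega |Du|^2+H(\det Du)\,dx,$$ $$\mathcal E(u)=\sup\Big\{\int_\Omega\langle\operatorname{cof}Du(x),D_xf(x,u(x))\rangle+\det Du(x)\,\operatorname{div}_yf(x,u(x))\,dx\;:\;f\in C_c^\infty(\Omega\times\mathbb R^3,\mathbb R^3),\ \|f\|_\infty\le1\Big\},$$ and let $\mathcal A_{nc}=\{u\in\mathcal A:\mathcal E(u)=0\}$. For $w\in W^{1,2}(\Omega,\mathbb R^3)$ with $\det Dw\in L^1(\Omega)$ let $G_w$ be the current of integration over the graph of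 $w$, $$\langle G_w,\omega\rangle=\int_\Omega\big\langle\omega(x,w(x)),(e_1,Dw\,e_1)\wedge(e_2,Dw\,e_2)\wedge(e_3,Dw\,e_3)\big\rangle\,dx$$ for smooth $3$-forms $\omega$ with compact support in $\Omega\times\mathbb R^3$. Let $(u_n)$ be a minimizing sequence for $E$ in $\mathcal A_{nc}$, or a minimizing sequence for $E$ in $\mathcal A$ with $\sup_n\mathcal E(u_n)<\infty$; in either case the infimum of $E$ over the class is assumed finite. Suppose that $u_n\rightharpoonup u$ weakly in $W^{1,2}(\Omega,\mathbb R^3)$ and that $\operatorname{cof}Du_n\rightharpoonup\operatorname{cof}Du$ weakly in $L^1(\Omega)$. Then $\det Du\in L^1(\Omega)$, $\det Du_n\in L^1(\Omega)$ for all large $n$, and $G_{u_n}\rightharpoonup G_u$ in the sense of currents, that is, $\langle G_{u_n},\omega\rangle\to\langle G_u,\omega\rangle$ for every smooth $3$-form $\omega$ with compact support in $\Omega\times\mathbb R^3$. -/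

import Mathlib

open MeasureTheory Filter Topology TopologicalSpace
open scoped ENNReal Distributions

noncomputable section

namespace NeoHookean

/-- Three-dimensional Euclidean space. -/
abbrev E3 : Type := EuclideanSpace ℝ (Fin 3)

/-- The canonical basis vectors of `ℝ³`. -/
def e (j : Fin 3) : E3 := EuclideanSpace.single j 1

/-- A smooth bounded domain: open, connected (hence non-empty), bounded, and near every boundary
point equal to the sublevel set of a smooth function with non-vanishing differential. -/
structure IsSmoothBoundedDomain (Ω : Set E3) : Prop where
  isOpen : IsOpen Ω
  isConnected : IsConnected Ω
  isBounded : Bornology.IsBounded Ω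
  smooth_boundary : ∀ p ∈ frontier Ω, ∃ U : Set E3, IsOpen U ∧ p ∈ U ∧
    ∃ ρ : E3 → ℝ, ContDiff ℝ ((⊤ : ℕ∞) : WithTop ℕ∞) ρ ∧ fderiv ℝ ρ p ≠ 0 ∧ Ω ∩ U = {x | ρ x < 0} ∩ U

/-- `g` restricts to a `C¹`-diffeomorphism from `K` onto `K'` (used for closures of smooth
domains). -/
def IsC1Diffeo (g : E3 → E3) (K K' : Set E3) : Prop :=
  ContDiffOn ℝ 1 g K ∧ Set.MapsTo g K K' ∧
    ∃ h : E3 → E3, ContDiffOn ℝ 1 h K' ∧ Set.MapsTo h K' K ∧ Set.InvOn h g K K'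

/-- The assumptions on the volumetric energy `H`, a function on `(0, ∞)` (its values elsewhere
play no role). -/
structure IsVolumetricEnergy (H : ℝ → ℝ) : Prop where
  nonneg : ∀ t, 0 < t → 0 ≤ H t
  convexOn : ConvexOn ℝ (Set.Ioi 0) H
  superlinear : Tendsto (fun t => H t / t) atTop atTop
  blowup : Tendsto H (𝓝[>] 0) atTop

/-- An element of `W^{1,2}(Ω, ℝ³)`: a representative `val` together with (a representative of)
its weak gradient, `grad x i j = ∂_j u^i (x)`. Only the values a.e. in `Ω` matter. -/
structure W12 (Ω : Opens E3) where
  val : E3 → E3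
  grad : E3 → Matrix (Fin 3) (Fin 3) ℝ
  memLp_val : MemLp val 2 (volume.restrict (Ω : Set E3))
  memLp_grad : ∀ i j, MemLp (fun x => grad x i j) 2 (volume.restrict (Ω : Set E3))
  weak_grad : ∀ (φ : 𝓓(Ω, ℝ)) (i j : Fin 3),
    ∫ x in (Ω : Set E3), val x i * fderiv ℝ φ x (e j)
      = - ∫ x in (Ω : Set E3), grad x i j * φ x

/-- The cofactor matrix, characterised by `Aᵀ * cof A = det A • 1`. -/
def cof (A : Matrix (Fin 3) (Fin 3) ℝ) : Matrix (Fin 3) (Fin 3) ℝ := A.adjugate.transpose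

variable {Ω : Opens E3}

/-- The traces of `w` and of `g ∈ C¹(Ω̄)` on `∂Ω` coincide: `w - g` lies in `W^{1,2}_0(Ω, ℝ³)`,
the `W^{1,2}`-closure of the test functions. -/
def W12.HasTrace (w : W12 Ω) (g : E3 → E3) : Prop :=
  ∃ φ : ℕ → 𝓓(Ω, E3),
    Tendsto (fun k => eLpNorm (fun x => w.val x - g x - φ k x) 2
      (volume.restrict (Ω : Set E3))) atTop (𝓝 0) ∧
    ∀ i j, Tendsto (fun k => eLpNorm
      (fun x => w.grad x i j - (fderiv ℝ g x (e j)) i - (fderiv ℝ (φ k) x (e j)) i) 2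
      (volume.restrict (Ω : Set E3))) atTop (𝓝 0)

/-- The class `𝒜` of admissible deformations. -/
def admissible (Ω : Opens E3) (g : E3 → E3) (M : ℝ) : Set (W12 Ω) :=
  {w | w.HasTrace g ∧
    (∀ᵐ x ∂(volume.restrict (Ω : Set E3)), ‖w.val x‖ ≤ M) ∧
    (∀ᵐ x ∂(volume.restrict (Ω : Set E3)), 0 < (w.grad x).det) ∧
    ∃ N : Set E3, volume N = 0 ∧ Set.InjOn w.val ((Ω : Set E3) \ N)}

/-- The neo-Hookean energy `∫_Ω |Dw|² + H(det Dw)`, with values in `[0, ∞]`. -/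
def energy (H : ℝ → ℝ) (w : W12 Ω) : ℝ≥0∞ :=
  ∫⁻ x in (Ω : Set E3),
    ENNReal.ofReal ((∑ i, ∑ j, (w.grad x i j) ^ 2) + H (w.grad x).det)

/-- The open set `Ω × ℝ³`. -/
def cyl (Ω : Opens E3) : Opens (E3 × E3) :=
  ⟨(Ω : Set E3) ×ˢ Set.univ, Ω.isOpen.prod isOpen_univ⟩

/-- `∫_Ω ⟨cof Dw(x), D_x f(x, w(x))⟩ + det Dw(x) div_y f(x, w(x)) dx`. -/
def surfacePairing (w : W12 Ω) (f : 𝓓(cyl Ω, E3)) : ℝ :=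
  ∫ x in (Ω : Set E3),
    ((∑ i, ∑ j, cof (w.grad x) i j * (fderiv ℝ f (x, w.val x) (e j, 0)) i)
      + (w.grad x).det * ∑ i, (fderiv ℝ f (x, w.val x) (0, e i)) i)

/-- The surface energy: the supremum of `surfacePairing w f` over test fields with `‖f‖_∞ ≤ 1`.
The supremum is non-negative (take `f = 0`), so it is taken in `[0, ∞]`. -/
def surfaceEnergy (w : W12 Ω) : ℝ≥0∞ :=
  ⨆ (f : 𝓓(cyl Ω, E3)) (_ : ∀ z, ‖f z‖ ≤ 1), ENNReal.ofReal (surfacePairing w f)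

/-- The class `𝒜_nc` of admissible deformations without surface energy (no cavitation). -/
def admissibleNC (Ω : Opens E3) (g : E3 → E3) (M : ℝ) : Set (W12 Ω) :=
  {w | w ∈ admissible Ω g M ∧ surfaceEnergy w = 0}

/-- `u` is a minimizing sequence of `F` in the class `C` (with finite infimum). -/
def IsMinimizingSeq {X : Type*} (F : X → ℝ≥0∞) (C : Set X) (u : ℕ → X) : Prop :=
  (∀ n, u n ∈ C) ∧ (⨅ w ∈ C, F w) < ⊤ ∧ Tendsto (fun n => F (u n)) atTop (𝓝 (⨅ w ∈ C, F w))

/-- Weak convergence of scalar functions on `Ω` tested with `L^q(Ω)`; with `q` the exponent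
conjugate to `p < ∞`, weak convergence in `L^p(Ω)`. -/
def WeakConv (Ω : Opens E3) (q : ℝ≥0∞) (f : ℕ → E3 → ℝ) (f₀ : E3 → ℝ) : Prop :=
  ∀ ψ : E3 → ℝ, MemLp ψ q (volume.restrict (Ω : Set E3)) →
    Tendsto (fun n => ∫ x in (Ω : Set E3), f n x * ψ x) atTop
      (𝓝 (∫ x in (Ω : Set E3), f₀ x * ψ x))

/-- Weak convergence in `W^{1,2}(Ω, ℝ³)`: the components of the maps and of their gradients
converge weakly in `L²(Ω)`. -/
def WeakConvW12 (u : ℕ → W12 Ω) (u₀ : W12 Ω) : Prop :=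
  (∀ i, WeakConv Ω 2 (fun n x => (u n).val x i) (fun x => u₀.val x i)) ∧
    ∀ i j, WeakConv Ω 2 (fun n x => (u n).grad x i j) (fun x => u₀.grad x i j)

/-- Weak convergence `cof Du_n ⇀ cof Du₀` in `L¹(Ω)`. -/
def WeakConvCofL1 (u : ℕ → W12 Ω) (u₀ : W12 Ω) : Prop :=
  ∀ i j, WeakConv Ω ⊤ (fun n x => cof ((u n).grad x) i j) (fun x => cof (u₀.grad x) i j)

/-- The space of smooth `3`-forms with compact support in `Ω × ℝ³`. -/
abbrev TestForm (Ω : Opens E3) : Type := 𝓓(cyl Ω, (E3 × E3) [⋀^Fin 3]→L[ℝ] ℝ)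

/-- All minors of `Dw` are integrable on `Ω`, so that the graph of `w` carries a current. On a
bounded domain the minors of order at most two of a `W^{1,2}` map are always integrable, so only
the determinant is mentioned. -/
def W12.HasGraphCurrent (w : W12 Ω) : Prop :=
  IntegrableOn (fun x => (w.grad x).det) (Ω : Set E3)

/-- The current `G_w` of integration over the graph of `w`:
`⟨G_w, ω⟩ = ∫_Ω ⟨ω(x, w(x)), (e₁, Dw e₁) ∧ (e₂, Dw e₂) ∧ (e₃, Dw e₃)⟩ dx`. -/
def graphCurrent (w : W12 Ω) (ω : TestForm Ω) : ℝ :=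
  ∫ x in (Ω : Set E3),
    ω (x, w.val x) (fun k => (e k, WithLp.toLp 2 (fun i => w.grad x i k)))

end NeoHookean

end

/-!
By superlinearity of `H` the determinants are uniformly integrable, so along a subsequence they
converge weakly in `L¹` to some `θ` (Dunford–Pettis), while the maps converge almost everywhere
(Rellich). A weakly `L¹`-convergent sequence can be multiplied by a bounded sequence converging
almost everywhere (Egorov), so the surface pairing passes to the limit with `θ` in the place
of the determinant, and the bound on the surface energies shows that this limit functional is
bounded by a multiple of `‖f‖_∞`. Testing it with fields concentrated near a point of the graph of
`u₀` and blowing up there leaves `(θ - det Du₀)` times a nonzero constant, hence `θ = det Du₀`. Now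
all minors of `Du_n` converge weakly in `L¹`, and the graph current, a sum of minors times bounded
continuous functions of `(x, u_n)`, converges as well. Its limit does not depend on the
subsequence.
-/

namespace NeoHookean

section WeakConvergence

variable {α : Type*} [MeasurableSpace α] {μ : Measure α} {f : ℕ → α → ℝ} {f₀ : α → ℝ}

/-- Convergence of the integrals against every function in `L^q(μ)`. For `q` conjugate to `p < ∞`
this is weak convergence in `L^p(μ)`; `WeakConv Ω q` is the case of Lebesgue measure on `Ω`. -/
def TendstoWeakly (μ : Measure α) (q : ℝ≥0∞) (f : ℕ → α → ℝ) (f₀ : α → ℝ) : Prop :=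
  ∀ ψ : α → ℝ, MemLp ψ q μ →
    Tendsto (fun n => ∫ x, f n x * ψ x ∂μ) atTop (𝓝 (∫ x, f₀ x * ψ x ∂μ))

theorem TendstoWeakly.comp_tendsto {q : ℝ≥0∞} (h : TendstoWeakly μ q f f₀) {φ : ℕ → ℕ}
    (hφ : Tendsto φ atTop atTop) : TendstoWeakly μ q (fun n => f (φ n)) f₀ :=
  fun ψ hψ => (h ψ hψ).comp hφ

theorem TendstoWeakly.mono_exponent [IsFiniteMeasure μ] {p q : ℝ≥0∞} (h : TendstoWeakly μ p f f₀)
    (hpq : p ≤ q) : TendstoWeakly μ q f f₀ :=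
  fun ψ hψ => h ψ (hψ.mono_exponent hpq)

theorem TendstoWeakly.congr_limit {q : ℝ≥0∞} {f₁ : α → ℝ} (h : TendstoWeakly μ q f f₀)
    (h₀₁ : f₀ =ᵐ[μ] f₁) : TendstoWeakly μ q f f₁ := fun ψ hψ => by
  have hcongr : ∫ x, f₁ x * ψ x ∂μ = ∫ x, f₀ x * ψ x ∂μ :=
    integral_congr_ae (h₀₁.symm.mul .rfl)
  exact hcongr ▸ h ψ hψ

theorem integrable_mul_of_memLp_top {f ψ : α → ℝ} (hf : Integrable f μ) (hψ : MemLp ψ ∞ μ) :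
    Integrable (fun x => f x * ψ x) μ :=
  hf.mul_of_top_left hψ

theorem integral_sub_mul_of_memLp_top {f g ψ : α → ℝ} (hf : Integrable f μ)
    (hg : Integrable g μ) (hψ : MemLp ψ ∞ μ) :
    ∫ x, (f x - g x) * ψ x ∂μ = ∫ x, f x * ψ x ∂μ - ∫ x, g x * ψ x ∂μ := by
  rw [← integral_sub (integrable_mul_of_memLp_top hf hψ) (integrable_mul_of_memLp_top hg hψ)]
  simp only [sub_mul]

theorem TendstoWeakly.sub {g : ℕ → α → ℝ} {g₀ : α → ℝ}
    (hf : ∀ n, Integrable (f n) μ) (hf₀ : Integrable f₀ μ)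
    (hg : ∀ n, Integrable (g n) μ) (hg₀ : Integrable g₀ μ)
    (hff₀ : TendstoWeakly μ ∞ f f₀) (hgg₀ : TendstoWeakly μ ∞ g g₀) :
    TendstoWeakly μ ∞ (fun n => f n - g n) (f₀ - g₀) := fun ψ hψ => by
  simp only [Pi.sub_apply, integral_sub_mul_of_memLp_top (hf _) (hg _) hψ,
    integral_sub_mul_of_memLp_top hf₀ hg₀ hψ]
  exact (hff₀ ψ hψ).sub (hgg₀ ψ hψ)

theorem abs_integral_mul_le {f ψ : α → ℝ} (hf : Integrable f μ) {B : ℝ}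
    (hψ : ∀ᵐ x ∂μ, |ψ x| ≤ B) : |∫ x, f x * ψ x ∂μ| ≤ B * ∫ x, |f x| ∂μ := by
  rw [← integral_const_mul]
  refine norm_integral_le_of_norm_le (f := fun x => f x * ψ x) (hf.abs.const_mul B) ?_
  filter_upwards [hψ] with x hx
  rw [norm_mul, Real.norm_eq_abs, Real.norm_eq_abs, mul_comm]
  gcongr

theorem exists_ae_abs_le_of_memLp_top {ψ : α → ℝ} (hψ : MemLp ψ ∞ μ) :
    ∃ B : ℝ, ∀ᵐ x ∂μ, |ψ x| ≤ B := by
  refine ⟨(eLpNorm ψ ∞ μ).toReal, ?_⟩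
  rw [eLpNorm_exponent_top]
  filter_upwards [ae_le_eLpNormEssSup (f := ψ) (μ := μ)] with x hx
  rw [← Real.norm_eq_abs, ← toReal_enorm]
  exact ENNReal.toReal_mono (eLpNorm_exponent_top (f := ψ) (μ := μ) ▸ hψ.eLpNorm_ne_top) hx

theorem exists_memLp_top_abs_eq_mul {f : α → ℝ} (hf : AEStronglyMeasurable f μ) :
    ∃ s : α → ℝ, MemLp s ∞ μ ∧ (∀ x, |s x| ≤ 1) ∧ ∀ᵐ x ∂μ, |f x| = f x * s x := by
  let s : α → ℝ := fun x => if 0 ≤ hf.mk f x then 1 else -1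
  have hs : Measurable s := Measurable.ite
    (measurableSet_le measurable_const hf.stronglyMeasurable_mk.measurable)
    measurable_const measurable_const
  have hs1 : ∀ x, |s x| ≤ 1 := fun x => by
    simp only [s]
    split_ifs <;> simp
  refine ⟨s, memLp_top_of_bound hs.aestronglyMeasurable 1 (ae_of_all _ hs1), hs1, ?_⟩
  filter_upwards [hf.ae_eq_mk] with x hx
  simp only [s, ← hx]
  split_ifs with hnonneg
  · rw [abs_of_nonneg hnonneg, mul_one]
  · rw [abs_of_neg (not_le.1 hnonneg), mul_neg_one]

theorem TendstoWeakly.integral_abs_le {δ : ℝ} (hf : ∀ n, Integrable (f n) μ)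
    (hf₀ : Integrable f₀ μ) (h : TendstoWeakly μ ∞ f f₀) (hδ : ∀ n, ∫ x, |f n x| ∂μ ≤ δ) :
    ∫ x, |f₀ x| ∂μ ≤ δ := by
  obtain ⟨s, hs, hs1, hf₀s⟩ := exists_memLp_top_abs_eq_mul hf₀.aestronglyMeasurable
  rw [integral_congr_ae hf₀s]
  refine le_of_tendsto (h s hs) (Eventually.of_forall fun n => ?_)
  calc ∫ x, f n x * s x ∂μ ≤ |∫ x, f n x * s x ∂μ| := le_abs_self _
    _ ≤ 1 * ∫ x, |f n x| ∂μ := abs_integral_mul_le (hf n) (ae_of_all _ hs1)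
    _ ≤ δ := (one_mul _).trans_le (hδ n)

end WeakConvergence

section VitaliHahnSaks

variable {α : Type*} [MeasurableSpace α] {μ : Measure α}

/-- The functions with values in `[-1, 1]`, as a subset of `L¹(μ)`: it is complete for the `L¹`
distance, which makes Baire's theorem available. -/
def unitBallLp (μ : Measure α) : Set (Lp ℝ 1 μ) :=
  {ψ | ∀ᵐ x ∂μ, |ψ x| ≤ 1}

instance : Nonempty (unitBallLp μ) :=
  ⟨0, by
    filter_upwards [Lp.coeFn_zero ℝ 1 μ] with x hx
    exact hx.symm ▸ by simp⟩

theorem continuous_integral_mul_unitBallLp {h : α → ℝ} (hh : Integrable h μ) :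
    Continuous fun ψ : unitBallLp μ => ∫ x, h x * (ψ : Lp ℝ 1 μ) x ∂μ := by
  refine continuous_iff_seqContinuous.2 fun ψ ψ₀ hψ => tendsto_of_subseq_tendsto fun ns hns => ?_
  have hLp : Tendsto (fun n => ((ψ (ns n) : unitBallLp μ) : Lp ℝ 1 μ)) atTop (𝓝 ψ₀) :=
    (continuous_subtype_val.tendsto _).comp (hψ.comp hns)
  obtain ⟨ms, -, hms⟩ := (tendstoInMeasure_of_tendsto_Lp hLp).exists_seq_tendsto_ae
  refine ⟨ms, tendsto_integral_of_dominated_convergence (fun x => |h x|)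
    (fun n => hh.aestronglyMeasurable.mul (Lp.aestronglyMeasurable _)) hh.abs (fun n => ?_) ?_⟩
  · filter_upwards [(ψ (ns (ms n))).2] with x hx
    rw [norm_mul, Real.norm_eq_abs, Real.norm_eq_abs]
    exact mul_le_of_le_one_right (abs_nonneg _) hx
  · filter_upwards [hms] with x hx
    exact hx.const_mul _

variable [IsFiniteMeasure μ]

theorem unitBallLp_eq_Icc :
    unitBallLp μ = Set.Icc (-(Lp.const 1 μ (1 : ℝ))) (Lp.const 1 μ (1 : ℝ)) := by
  ext ψ
  have hconst := Lp.coeFn_const (p := 1) (μ := μ) (1 : ℝ)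
  rw [Set.mem_Icc, ← Lp.coeFn_le, ← Lp.coeFn_le]
  constructor
  · intro h
    constructor
    · filter_upwards [hconst, Lp.coeFn_neg (Lp.const 1 μ (1 : ℝ)), h] with x hc hn hx
      rw [hn, Pi.neg_apply, hc]
      exact (abs_le.1 hx).1
    · filter_upwards [hconst, h] with x hc hx
      rw [hc]
      exact (abs_le.1 hx).2
  · rintro ⟨hl, hu⟩
    filter_upwards [hconst, Lp.coeFn_neg (Lp.const 1 μ (1 : ℝ)), hl, hu] with x hc hn hlx hux
    rw [hn, Pi.neg_apply, hc] at hlx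
    rw [hc] at hux
    exact abs_le.2 ⟨hlx, hux⟩

instance : CompleteSpace (unitBallLp μ) := by
  rw [unitBallLp_eq_Icc]
  exact isClosed_Icc.completeSpace_coe

theorem exists_ball_abs_integral_mul_le {h : ℕ → α → ℝ} (hh : ∀ n, Integrable (h n) μ)
    (hw : TendstoWeakly μ ∞ h 0) {ε : ℝ} (hε : 0 < ε) :
    ∃ ψ ∈ unitBallLp μ, ∃ ρ > 0, ∃ N, ∀ f : α → ℝ, AEStronglyMeasurable f μ →
      (∀ᵐ x ∂μ, |f x| ≤ 1) → ∫ x, |f x - ψ x| ∂μ < ρ → ∀ n ≥ N, |∫ x, h n x * f x ∂μ| ≤ ε := by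
  let F : ℕ → Set (unitBallLp μ) := fun N =>
    ⋂ n ≥ N, {ψ | |∫ x, h n x * (ψ : Lp ℝ 1 μ) x ∂μ| ≤ ε}
  have hF : ∀ N, IsClosed (F N) := fun N => isClosed_biInter fun n _ =>
    isClosed_le (continuous_integral_mul_unitBallLp (hh n)).abs continuous_const
  have hU : ⋃ N, F N = Set.univ := by
    refine Set.eq_univ_of_forall fun ψ => ?_
    have hψ := hw ψ (memLp_top_of_bound (Lp.aestronglyMeasurable _) 1 ψ.2)
    simp only [Pi.zero_apply, zero_mul, integral_zero] at hψ
    obtain ⟨N, hN⟩ := eventually_atTop.1 (hψ.abs.eventually_le_const (by simpa using hε))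
    exact Set.mem_iUnion.2 ⟨N, Set.mem_iInter₂.2 hN⟩
  obtain ⟨N, ψ, hψ⟩ := nonempty_interior_of_iUnion_of_closed hF hU
  obtain ⟨ρ, hρ, hball⟩ := Metric.isOpen_iff.1 isOpen_interior ψ hψ
  refine ⟨ψ, ψ.2, ρ, hρ, N, fun f hf hf1 hfρ n hn => ?_⟩
  have hfL : MemLp f 1 μ := (memLp_top_of_bound hf 1 hf1).mono_exponent le_top
  have hmem : hfL.toLp f ∈ unitBallLp μ := by
    filter_upwards [hfL.coeFn_toLp, hf1] with x hx hx1
    rwa [hx]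
  have hdist : (⟨hfL.toLp f, hmem⟩ : unitBallLp μ) ∈ Metric.ball ψ ρ := by
    rw [Metric.mem_ball, Subtype.dist_eq, dist_eq_norm, L1.norm_eq_integral_norm]
    refine lt_of_eq_of_lt (integral_congr_ae ?_) hfρ
    filter_upwards [hfL.coeFn_toLp, Lp.coeFn_sub (hfL.toLp f) (ψ : Lp ℝ 1 μ)] with x hx hsub
    rw [hsub, Pi.sub_apply, hx, Real.norm_eq_abs]
  have hle := Set.mem_iInter₂.1 (interior_subset (hball hdist)) n hn
  refine le_of_eq_of_le (congrArg _ (integral_congr_ae ?_)) hle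
  filter_upwards [hfL.coeFn_toLp] with x hx
  rw [hx]

theorem exists_abs_integral_mul_le_of_integral_abs_lt {h : ℕ → α → ℝ}
    (hh : ∀ n, Integrable (h n) μ) (hw : TendstoWeakly μ ∞ h 0) {ε : ℝ} (hε : 0 < ε) :
    ∃ ρ > 0, ∃ N, ∀ c : α → ℝ, AEStronglyMeasurable c μ → (∀ᵐ x ∂μ, |c x| ≤ 1) →
      ∫ x, |c x| ∂μ < ρ → ∀ n ≥ N, |∫ x, h n x * c x ∂μ| ≤ ε := by
  obtain ⟨ψ, hψ1, ρ, hρ, N, hN⟩ := exists_ball_abs_integral_mul_le hh hw (half_pos hε)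
  refine ⟨ρ / 2, half_pos hρ, N, fun c hc hc1 hcρ n hn => ?_⟩
  have hψ : AEStronglyMeasurable ψ μ := Lp.aestronglyMeasurable ψ
  -- `c` is the difference of two functions in the unit ball which are `L¹`-close to `ψ`.
  let q : α → ℝ := fun x => ψ x * (1 - |c x|)
  have hq : AEStronglyMeasurable q μ := hψ.mul (aestronglyMeasurable_const.sub hc.norm)
  have hclose : ∀ f : α → ℝ, (∀ᵐ x ∂μ, |f x - ψ x| ≤ 2 * |c x|) → ∫ x, |f x - ψ x| ∂μ < ρ := by
    intro f hf
    have hci : Integrable (fun x => 2 * |c x|) μ := (Integrable.of_bound hc 1 hc1).abs.const_mul 2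
    refine (integral_mono_of_nonneg (ae_of_all _ fun x => abs_nonneg _) hci hf).trans_lt ?_
    rw [integral_const_mul]
    linarith
  have hq_abs : ∀ᵐ x ∂μ, |q x| ≤ 1 - |c x| := by
    filter_upwards [hψ1, hc1] with x hx hcx
    rw [abs_mul, abs_of_nonneg (sub_nonneg.2 hcx)]
    exact mul_le_of_le_one_left (sub_nonneg.2 hcx) hx
  have hqc_abs : ∀ᵐ x ∂μ, |q x + c x| ≤ 1 := by
    filter_upwards [hq_abs] with x hx
    linarith [abs_add_le (q x) (c x)]
  have hq_abs' : ∀ᵐ x ∂μ, |q x| ≤ 1 := by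
    filter_upwards [hq_abs] with x hx
    linarith [abs_nonneg (c x)]
  have hq_sub : ∀ᵐ x ∂μ, |q x - ψ x| ≤ |c x| := by
    filter_upwards [hψ1] with x hx
    rw [show q x - ψ x = -(ψ x * |c x|) by ring, abs_neg, abs_mul, abs_abs]
    exact mul_le_of_le_one_left (abs_nonneg _) hx
  have hq_le := hN q hq hq_abs' (hclose _ (hq_sub.mono fun x hx => by
    linarith [abs_nonneg (c x)])) n hn
  have hqc_le := hN _ (hq.add hc) hqc_abs (hclose _ (hq_sub.mono fun x hx => by
    rw [Pi.add_apply, add_sub_right_comm]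
    linarith [abs_add_le (q x - ψ x) (c x)])) n hn
  have hsplit : ∫ x, h n x * c x ∂μ
      = ∫ x, h n x * (q + c) x ∂μ - ∫ x, h n x * q x ∂μ := by
    rw [← integral_sub
      (integrable_mul_of_memLp_top (hh n) (memLp_top_of_bound (hq.add hc) 1 hqc_abs))
      (integrable_mul_of_memLp_top (hh n) (memLp_top_of_bound hq 1 hq_abs'))]
    simp only [Pi.add_apply, mul_add, add_sub_cancel_left]
  rw [hsplit]
  linarith [abs_sub (∫ x, h n x * (q + c) x ∂μ) (∫ x, h n x * q x ∂μ)]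

theorem tendsto_integral_mul_zero_of_tendstoWeakly {h : ℕ → α → ℝ}
    (hh : ∀ n, Integrable (h n) μ) (hw : TendstoWeakly μ ∞ h 0)
    {c : ℕ → α → ℝ} (hcm : ∀ n, AEStronglyMeasurable (c n) μ) {B : ℝ}
    (hcB : ∀ n, ∀ᵐ x ∂μ, |c n x| ≤ B) (hc0 : ∀ᵐ x ∂μ, Tendsto (fun n => c n x) atTop (𝓝 0)) :
    Tendsto (fun n => ∫ x, h n x * c n x ∂μ) atTop (𝓝 0) := by
  -- Dividing by `max B 1` reduces to functions with values in `[-1, 1]`.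
  have hB : 0 < max B 1 := lt_max_of_lt_right one_pos
  let d : ℕ → α → ℝ := fun n x => c n x / max B 1
  have hdm : ∀ n, AEStronglyMeasurable (d n) μ := fun n => by
    simpa only [d, div_eq_mul_inv] using (hcm n).mul_const _
  have hd1 : ∀ n, ∀ᵐ x ∂μ, |d n x| ≤ 1 := fun n => by
    filter_upwards [hcB n] with x hx
    rw [abs_div, abs_of_pos hB, div_le_one hB]
    exact hx.trans (le_max_left _ _)
  have hdL : Tendsto (fun n => ∫ x, |d n x| ∂μ) atTop (𝓝 0) := by
    rw [← integral_zero α ℝ (μ := μ)]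
    refine tendsto_integral_of_dominated_convergence (fun _ => 1) (fun n => (hdm n).norm)
      (integrable_const _) (fun n => by simpa using hd1 n) ?_
    filter_upwards [hc0] with x hx
    simpa [d] using (hx.div_const (max B 1)).abs
  have hzero : Tendsto (fun n => ∫ x, h n x * d n x ∂μ) atTop (𝓝 0) := by
    refine Metric.tendsto_atTop'.2 fun ε hε => ?_
    obtain ⟨ρ, hρ, N, hN⟩ := exists_abs_integral_mul_le_of_integral_abs_lt hh hw (half_pos hε)
    obtain ⟨N', hN'⟩ := eventually_atTop.1 (hdL.eventually_lt_const hρ)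
    refine ⟨max N N', fun n hn => ?_⟩
    rw [Real.dist_eq, sub_zero]
    have hle := hN (d n) (hdm n) (hd1 n) (hN' n ((le_max_right _ _).trans hn.le)) n
      ((le_max_left _ _).trans hn.le)
    linarith
  simpa [d, ← integral_mul_const, mul_assoc, div_mul_cancel₀ _ hB.ne']
    using hzero.mul_const (max B 1)

theorem TendstoWeakly.tendsto_integral_mul {f : ℕ → α → ℝ} {f₀ : α → ℝ}
    (hw : TendstoWeakly μ ∞ f f₀) (hf : ∀ n, Integrable (f n) μ) (hf₀ : Integrable f₀ μ)
    {b : ℕ → α → ℝ} {b₀ : α → ℝ} (hbm : ∀ n, AEStronglyMeasurable (b n) μ) {B : ℝ}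
    (hbB : ∀ n, ∀ᵐ x ∂μ, |b n x| ≤ B) (hb : ∀ᵐ x ∂μ, Tendsto (fun n => b n x) atTop (𝓝 (b₀ x))) :
    Tendsto (fun n => ∫ x, f n x * b n x ∂μ) atTop (𝓝 (∫ x, f₀ x * b₀ x ∂μ)) := by
  have hb₀m : AEStronglyMeasurable b₀ μ := aestronglyMeasurable_of_tendsto_ae atTop hbm hb
  have hb₀B : ∀ᵐ x ∂μ, |b₀ x| ≤ B := by
    filter_upwards [hb, ae_all_iff.2 hbB] with x hx hBx
    exact le_of_tendsto hx.abs (Eventually.of_forall hBx)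
  have hbL : ∀ n, MemLp (b n) ∞ μ := fun n => memLp_top_of_bound (hbm n) B (hbB n)
  have hb₀L : MemLp b₀ ∞ μ := memLp_top_of_bound hb₀m B hb₀B
  have hdiff_w : TendstoWeakly μ ∞ (fun n => f n - f₀) 0 := by
    simpa using hw.sub hf hf₀ (fun _ => hf₀) hf₀ fun ψ _ => tendsto_const_nhds
  have hdiff : Tendsto (fun n => ∫ x, (f n x - f₀ x) * (b n x - b₀ x) ∂μ) atTop (𝓝 0) := by
    refine tendsto_integral_mul_zero_of_tendstoWeakly (fun n => (hf n).sub hf₀) hdiff_w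
      (fun n => (hbm n).sub hb₀m) (B := B + B) (fun n => ?_) ?_
    · filter_upwards [hbB n, hb₀B] with x hx hx₀
      exact (abs_sub _ _).trans (add_le_add hx hx₀)
    · filter_upwards [hb] with x hx
      simpa using hx.sub_const (b₀ x)
  have hfixed : Tendsto (fun n => ∫ x, f₀ x * b n x ∂μ) atTop (𝓝 (∫ x, f₀ x * b₀ x ∂μ)) := by
    refine tendsto_integral_of_dominated_convergence (fun x => |f₀ x| * B)
      (fun n => hf₀.aestronglyMeasurable.mul (hbm n)) (hf₀.abs.mul_const _) (fun n => ?_) ?_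
    · filter_upwards [hbB n] with x hx
      rw [norm_mul, Real.norm_eq_abs, Real.norm_eq_abs]
      gcongr
    · filter_upwards [hb] with x hx
      exact hx.const_mul _
  have hsum := (hdiff.add ((hw b₀ hb₀L).sub_const (∫ x, f₀ x * b₀ x ∂μ))).add hfixed
  rw [sub_self, zero_add, zero_add] at hsum
  refine hsum.congr fun n => ?_
  have hfb := integrable_mul_of_memLp_top (hf n) (hbL n)
  have hfb₀ := integrable_mul_of_memLp_top (hf n) hb₀L
  have hf₀b := integrable_mul_of_memLp_top hf₀ (hbL n)
  have hf₀b₀ := integrable_mul_of_memLp_top hf₀ hb₀L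
  have hexpand : ∫ x, (f n x - f₀ x) * (b n x - b₀ x) ∂μ
      = (∫ x, f n x * b n x ∂μ - ∫ x, f n x * b₀ x ∂μ)
        - (∫ x, f₀ x * b n x ∂μ - ∫ x, f₀ x * b₀ x ∂μ) := by
    rw [← integral_sub hfb hfb₀, ← integral_sub hf₀b hf₀b₀]
    simpa only [Pi.sub_apply, mul_sub]
      using integral_sub_mul_of_memLp_top (hf n) hf₀ ((hbL n).sub hb₀L)
  rw [hexpand]
  ring

end VitaliHahnSaks

section DunfordPettis

variable {α : Type*} [MeasurableSpace α] {μ : Measure α}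

theorem exists_subseq_tendsto_inner {E : Type*} [NormedAddCommGroup E] [InnerProductSpace ℝ E]
    [CompleteSpace E] [SeparableSpace E] (t : ℕ → ℕ → E) (R : ℕ → ℝ) (ht : ∀ n k, ‖t n k‖ ≤ R k) :
    ∃ φ : ℕ → ℕ, StrictMono φ ∧ ∃ τ : ℕ → E, ∀ k v,
      Tendsto (fun n => inner ℝ (t (φ n) k) v) atTop (𝓝 (inner ℝ (τ k) v)) := by
  let s : ℕ → Set (WeakDual ℝ E) := fun k =>
    WeakDual.toStrongDual ⁻¹' Metric.closedBall 0 (R k)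
  have hs : ∀ k, IsCompact (s k) := fun k => WeakDual.isCompact_closedBall 0 (R k)
  have : ∀ k, CompactSpace (s k) := fun k => isCompact_iff_compactSpace.1 (hs k)
  have : ∀ k, MetrizableSpace (s k) := fun k => WeakDual.metrizable_of_isCompact ℝ _ _ (hs k)
  let x : ℕ → ∀ k, s k := fun n k => ⟨StrongDual.toWeakDual (innerSL ℝ (t n k)),
    mem_closedBall_zero_iff.2 ((innerSL_apply_norm ℝ (t n k)).trans_le (ht n k))⟩
  obtain ⟨a, φ, hφ, ha⟩ := CompactSpace.tendsto_subseq x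
  refine ⟨φ, hφ, fun k => (InnerProductSpace.toDual ℝ E).symm
    (WeakDual.toStrongDual (a k : WeakDual ℝ E)), fun k v => ?_⟩
  rw [InnerProductSpace.toDual_symm_apply]
  exact ((WeakDual.eval_continuous v).comp continuous_subtype_val).tendsto _ |>.comp
    (tendsto_pi_nhds.1 ha k)

theorem exists_subseq_tendstoWeakly_two [IsSeparable μ] {g : ℕ → ℕ → α → ℝ}
    (hg : ∀ n k, MemLp (g n k) 2 μ) {R : ℕ → ℝ≥0∞} (hR : ∀ k, R k ≠ ⊤)
    (hgR : ∀ n k, eLpNorm (g n k) 2 μ ≤ R k) :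
    ∃ φ : ℕ → ℕ, StrictMono φ ∧ ∃ τ : ℕ → α → ℝ, ∀ k, MemLp (τ k) 2 μ ∧
      TendstoWeakly μ 2 (fun n => g (φ n) k) (τ k) := by
  have : Fact ((2 : ℝ≥0∞) ≠ ⊤) := ⟨ENNReal.ofNat_ne_top⟩
  obtain ⟨φ, hφ, τ, hτ⟩ := exists_subseq_tendsto_inner (fun n k => (hg n k).toLp)
    (fun k => (R k).toReal) fun n k => by
      rw [Lp.norm_toLp]
      exact ENNReal.toReal_mono (hR k) (hgR n k)
  refine ⟨φ, hφ, fun k => τ k, fun k => ⟨Lp.memLp (τ k), fun ψ hψ => ?_⟩⟩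
  have hinner : ∀ {a : α → ℝ} {b : Lp ℝ 2 μ}, b =ᵐ[μ] a →
      inner ℝ b hψ.toLp = ∫ x, a x * ψ x ∂μ := fun hab => by
    rw [L2.inner_def]
    refine integral_congr_ae ?_
    filter_upwards [hab, hψ.coeFn_toLp] with x hx hψx
    rw [hx, hψx]
    exact mul_comm _ _
  simpa only [hinner (hg _ k).coeFn_toLp, hinner (ae_eq_refl (τ k))] using hτ k (hψ.toLp ψ)

theorem cauchySeq_toLp_of_tendstoWeakly {f : ℕ → α → ℝ} {g : ℕ → ℕ → α → ℝ} {τ : ℕ → α → ℝ}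
    {δ : ℕ → ℝ} (hf : ∀ n, Integrable (f n) μ) (hg : ∀ n k, Integrable (g n k) μ)
    (hτ : ∀ k, Integrable (τ k) μ) (hfg : ∀ n k, ∫ x, |f n x - g n k x| ∂μ ≤ δ k)
    (hδ : Tendsto δ atTop (𝓝 0)) (hw : ∀ k, TendstoWeakly μ ∞ (fun n => g n k) (τ k)) :
    CauchySeq fun k => (memLp_one_iff_integrable.2 (hτ k)).toLp (τ k) := by
  have hdist : ∀ k l, ∫ x, |τ k x - τ l x| ∂μ ≤ δ k + δ l := fun k l =>
    ((hw k).sub (fun n => hg n k) (hτ k) (fun n => hg n l) (hτ l) (hw l)).integral_abs_le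
      (fun n => (hg n k).sub (hg n l)) ((hτ k).sub (hτ l)) fun n => by
        have hk : Integrable (fun x => |f n x - g n k x|) μ := ((hf n).sub (hg n k)).abs
        have hl : Integrable (fun x => |f n x - g n l x|) μ := ((hf n).sub (hg n l)).abs
        refine le_trans ?_ (add_le_add (hfg n k) (hfg n l))
        rw [← integral_add hk hl]
        refine integral_mono ((hg n k).sub (hg n l)).abs (hk.add hl) fun x => ?_
        simpa [abs_sub_comm (f n x)] using abs_sub_le (g n k x) (f n x) (g n l x)
  refine Metric.cauchySeq_iff.2 fun ε hε => ?_
  obtain ⟨N, hN⟩ := eventually_atTop.1 (hδ.eventually_lt_const (half_pos hε))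
  refine ⟨N, fun k hk l hl => ?_⟩
  rw [dist_eq_norm, ← MemLp.toLp_sub, L1.norm_eq_integral_norm]
  calc _ = ∫ x, |τ k x - τ l x| ∂μ :=
        integral_congr_ae <| by
          filter_upwards [((memLp_one_iff_integrable.2 (hτ k)).sub
            (memLp_one_iff_integrable.2 (hτ l))).coeFn_toLp] with x hx
          rw [hx, Pi.sub_apply, Real.norm_eq_abs]
    _ ≤ δ k + δ l := hdist k l
    _ < ε := by linarith [hN k hk, hN l hl]

theorem exists_tendstoWeakly_of_uniform_approx {f : ℕ → α → ℝ} {g : ℕ → ℕ → α → ℝ}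
    {τ : ℕ → α → ℝ} {δ : ℕ → ℝ} (hf : ∀ n, Integrable (f n) μ) (hg : ∀ n k, Integrable (g n k) μ)
    (hτ : ∀ k, Integrable (τ k) μ) (hfg : ∀ n k, ∫ x, |f n x - g n k x| ∂μ ≤ δ k)
    (hδ : Tendsto δ atTop (𝓝 0)) (hw : ∀ k, TendstoWeakly μ ∞ (fun n => g n k) (τ k)) :
    ∃ θ, Integrable θ μ ∧ TendstoWeakly μ ∞ f θ := by
  obtain ⟨θ, hθ⟩ := cauchySeq_tendsto_of_complete
    (cauchySeq_toLp_of_tendstoWeakly hf hg hτ hfg hδ hw)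
  have hθi : Integrable θ μ := L1.integrable_coeFn θ
  have hτθ : Tendsto (fun k => ∫ x, |τ k x - θ x| ∂μ) atTop (𝓝 0) := by
    refine (tendsto_iff_dist_tendsto_zero.1 hθ).congr fun k => ?_
    rw [dist_eq_norm, L1.norm_eq_integral_norm]
    refine integral_congr_ae ?_
    filter_upwards [Lp.coeFn_sub ((memLp_one_iff_integrable.2 (hτ k)).toLp (τ k)) θ,
      (memLp_one_iff_integrable.2 (hτ k)).coeFn_toLp] with x hsub hx
    rw [hsub, Pi.sub_apply, hx, Real.norm_eq_abs]
  refine ⟨θ, hθi, fun ψ hψ => ?_⟩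
  obtain ⟨B, hB⟩ := exists_ae_abs_le_of_memLp_top hψ
  have hdist : ∀ {a b : α → ℝ}, Integrable a μ → Integrable b μ →
      dist (∫ x, a x * ψ x ∂μ) (∫ x, b x * ψ x ∂μ) ≤ B * ∫ x, |a x - b x| ∂μ := fun ha hb => by
    rw [Real.dist_eq, ← integral_sub_mul_of_memLp_top ha hb hψ]
    exact abs_integral_mul_le (ha.sub hb) hB
  have hunif : TendstoUniformly (fun k n => ∫ x, g n k x * ψ x ∂μ)
      (fun n => ∫ x, f n x * ψ x ∂μ) atTop := by
    have hBδ : Tendsto (fun k => |B| * δ k) atTop (𝓝 0) := by simpa using hδ.const_mul |B|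
    refine Metric.tendstoUniformly_iff.2 fun ε hε => ?_
    filter_upwards [hBδ.eventually_lt_const hε] with k hk n
    calc _ ≤ B * ∫ x, |f n x - g n k x| ∂μ := hdist (hf n) (hg n k)
      _ ≤ |B| * δ k := mul_le_mul (le_abs_self B) (hfg n k)
          (integral_nonneg fun x => abs_nonneg _) (abs_nonneg B)
      _ < ε := hk
  refine hunif.tendsto_of_eventually_tendsto (Eventually.of_forall fun k => hw k ψ hψ) ?_
  refine tendsto_iff_dist_tendsto_zero.2 (squeeze_zero (fun _ => dist_nonneg)
    (fun k => hdist (hτ k) hθi) ?_)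
  simpa using hτθ.const_mul B

variable [IsFiniteMeasure μ]

theorem exists_subseq_tendstoWeakly_of_uniformIntegrable [IsSeparable μ] {f : ℕ → α → ℝ}
    (hf : UniformIntegrable f 1 μ) :
    ∃ φ : ℕ → ℕ, StrictMono φ ∧ ∃ θ, Integrable θ μ ∧
      TendstoWeakly μ ∞ (fun n => f (φ n)) θ := by
  have hfi : ∀ n, Integrable (f n) μ := fun n => memLp_one_iff_integrable.1 (hf.memLp n)
  let δ : ℕ → ℝ := fun k => 1 / (k + 1)
  have hδ : ∀ k, 0 < δ k := fun k => Nat.one_div_pos_of_nat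
  choose C hC using fun k => hf.spec one_ne_zero ENNReal.one_ne_top (hδ k)
  let g : ℕ → ℕ → α → ℝ := fun n k => {x | C k ≤ ‖f n x‖₊}ᶜ.indicator (f n)
  have hgm : ∀ n k, AEStronglyMeasurable (g n k) μ := fun n k =>
    (hf.1 n).indicator₀ (nullMeasurableSet_le aemeasurable_const (hf.1 n).nnnorm.aemeasurable).compl
  have hgC : ∀ n k x, ‖g n k x‖ ≤ C k := fun n k x => by
    simp only [g, Set.indicator_apply]
    split_ifs with hx
    · exact (not_le.1 (show ¬C k ≤ ‖f n x‖₊ from hx)).le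
    · simp
  have hg : ∀ n k, MemLp (g n k) ∞ μ := fun n k =>
    memLp_top_of_bound (hgm n k) (C k) (ae_of_all _ (hgC n k))
  have hgi : ∀ n k, Integrable (g n k) μ := fun n k => (hg n k).integrable le_top
  have hfg : ∀ n k, ∫ x, |f n x - g n k x| ∂μ ≤ δ k := fun n k => by
    have hsub : f n - g n k = {x | C k ≤ ‖f n x‖₊}.indicator (f n) := by
      rw [sub_eq_iff_eq_add, Set.indicator_self_add_compl]
    have hnorm := hsub ▸ hC k n
    rw [eLpNorm_one_eq_lintegral_enorm] at hnorm
    calc ∫ x, |f n x - g n k x| ∂μ = (∫⁻ x, ‖(f n - g n k) x‖ₑ ∂μ).toReal :=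
          integral_norm_eq_lintegral_enorm ((hf.1 n).sub (hgm n k))
      _ ≤ δ k := ENNReal.toReal_le_of_le_ofReal (hδ k).le hnorm
  obtain ⟨φ, hφ, τ, hτ⟩ := exists_subseq_tendstoWeakly_two (μ := μ)
    (fun n k => (hg n k).mono_exponent le_top)
    (R := fun k => μ Set.univ ^ (2 : ℝ≥0∞).toReal⁻¹ * ENNReal.ofReal (C k))
    (fun k => ENNReal.mul_ne_top (by simp) ENNReal.ofReal_ne_top)
    fun n k => eLpNorm_le_of_ae_bound (ae_of_all _ (hgC n k))
  exact ⟨φ, hφ, exists_tendstoWeakly_of_uniform_approx (fun n => hfi (φ n))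
    (fun n k => hgi (φ n) k) (fun k => (hτ k).1.integrable one_le_two) (fun n k => hfg (φ n) k)
    tendsto_one_div_add_atTop_nhds_zero_nat fun k => (hτ k).2.mono_exponent le_top⟩

/-- The constant `K` is chosen with `B / K ≤ ε`; where `Φ t ≥ K t`, the bound on `∫ Φ |f|` then
makes the tails of `f` smaller than `ε`. -/
theorem uniformIntegrable_of_superlinear {ι : Type*} {Φ : ℝ → ℝ}
    (hΦ : Tendsto (fun t => Φ t / t) atTop atTop) {f : ι → α → ℝ}
    (hf : ∀ i, AEStronglyMeasurable (f i) μ) {B : ℝ≥0∞} (hB : B ≠ ⊤)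
    (hfB : ∀ i, ∫⁻ x, ENNReal.ofReal (Φ |f i x|) ∂μ ≤ B) : UniformIntegrable f 1 μ := by
  refine uniformIntegrable_of le_rfl ENNReal.one_ne_top hf fun ε hε => ?_
  have hK : 0 < (B.toReal + 1) / ε := by positivity
  obtain ⟨T, hT1, hT⟩ : ∃ T : ℝ, 1 ≤ T ∧ ∀ t ≥ T, (B.toReal + 1) / ε ≤ Φ t / t :=
    ((eventually_ge_atTop 1).and
      (eventually_forall_ge_atTop.2 (tendsto_atTop.1 hΦ _))).exists
  have hT0 : 0 < T := one_pos.trans_le hT1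
  refine ⟨T.toNNReal, fun i => ?_⟩
  have htail : ∀ x, ‖{x | T.toNNReal ≤ ‖f i x‖₊}.indicator (f i) x‖ₑ
      ≤ ENNReal.ofReal ((B.toReal + 1) / ε)⁻¹ * ENNReal.ofReal (Φ |f i x|) := fun x => by
    by_cases hx : T.toNNReal ≤ ‖f i x‖₊
    · have hTx : T ≤ |f i x| := by
        simpa [← NNReal.coe_le_coe, Real.coe_toNNReal T hT0.le] using hx
      rw [Set.indicator_of_mem (by exact hx), Real.enorm_eq_ofReal_abs,
        ← ENNReal.ofReal_mul (inv_pos.2 hK).le]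
      refine ENNReal.ofReal_le_ofReal ((le_inv_mul_iff₀ hK).2 ?_)
      exact (le_div_iff₀ (hT0.trans_le hTx)).1 (hT _ hTx)
    · simp [Set.indicator_of_notMem (show x ∉ {x | T.toNNReal ≤ ‖f i x‖₊} from hx)]
  rw [eLpNorm_one_eq_lintegral_enorm]
  calc _ ≤ ENNReal.ofReal ((B.toReal + 1) / ε)⁻¹ * B := by
        refine (lintegral_mono htail).trans ?_
        rw [lintegral_const_mul' _ _ ENNReal.ofReal_ne_top]
        gcongr
        exact hfB i
    _ ≤ ENNReal.ofReal ε := by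
        nth_rewrite 2 [← ENNReal.ofReal_toReal hB]
        rw [← ENNReal.ofReal_mul (inv_pos.2 hK).le, inv_div, div_mul_eq_mul_div]
        refine ENNReal.ofReal_le_ofReal ((div_le_iff₀ (by positivity)).2 ?_)
        linarith

end DunfordPettis

section WeakDerivative

variable {E : Type*} [NormedAddCommGroup E] [NormedSpace ℝ E] [MeasurableSpace E]
  {μ : Measure E} {w d : E → ℝ}

/-- `d` is a weak derivative of `w` in the direction `h`, on the whole space. -/
def HasWeakDeriv (μ : Measure E) (w d : E → ℝ) (h : E) : Prop :=
  ∀ φ : E → ℝ, ContDiff ℝ (⊤ : ℕ∞) φ → HasCompactSupport φ →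
    ∫ x, w x * fderiv ℝ φ x h ∂μ = - ∫ x, d x * φ x ∂μ

theorem HasWeakDeriv.smul {z : E} (hwd : HasWeakDeriv μ w d z) (r : ℝ) :
    HasWeakDeriv μ w (fun x => r * d x) (r • z) := fun φ hφ hφc => by
  simp only [map_smul, smul_eq_mul, mul_left_comm _ r, mul_assoc r, integral_const_mul,
    hwd φ hφ hφc, mul_neg]

end WeakDerivative

section CauchySchwarz

variable {α : Type*} [MeasurableSpace α] {μ : Measure α} {f g : α → ℝ}

theorem eLpNorm_const_mul (c : ℝ) (f : α → ℝ) (p : ℝ≥0∞) :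
    eLpNorm (fun x => c * f x) p μ = ‖c‖ₑ * eLpNorm f p μ :=
  eLpNorm_const_smul c f p μ

theorem inner_toLp_eq_integral_mul (hf : MemLp f 2 μ) (hg : MemLp g 2 μ) :
    inner ℝ (hf.toLp f) (hg.toLp g) = ∫ x, f x * g x ∂μ := by
  rw [L2.inner_def]
  refine integral_congr_ae ?_
  filter_upwards [hf.coeFn_toLp, hg.coeFn_toLp] with x hfx hgx
  rw [hfx, hgx]
  exact mul_comm _ _

theorem abs_integral_mul_le_eLpNorm_two (hf : MemLp f 2 μ) (hg : MemLp g 2 μ) :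
    |∫ x, f x * g x ∂μ| ≤ (eLpNorm f 2 μ).toReal * (eLpNorm g 2 μ).toReal := by
  simpa only [inner_toLp_eq_integral_mul, Lp.norm_toLp]
    using abs_real_inner_le_norm (hf.toLp f) (hg.toLp g)

end CauchySchwarz

section TranslationInvariance

variable {G : Type*} [AddGroup G] [MeasurableSpace G] [MeasurableAdd G] {μ : Measure G}
  [μ.IsAddRightInvariant] {w : G → ℝ} {p : ℝ≥0∞}

theorem memLp_comp_sub_right (hw : MemLp w p μ) (h : G) : MemLp (fun x => w (x - h)) p μ :=
  hw.comp_measurePreserving (measurePreserving_sub_right μ h)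

theorem eLpNorm_comp_sub_right (hw : AEStronglyMeasurable w μ) (h : G) :
    eLpNorm (fun x => w (x - h)) p μ = eLpNorm w p μ :=
  eLpNorm_comp_measurePreserving hw (measurePreserving_sub_right μ h)

theorem integral_mul_comp_add_right (w φ : G → ℝ) (a : G) :
    ∫ x, w x * φ (x + a) ∂μ = ∫ x, w (x - a) * φ x ∂μ := by
  rw [← integral_add_right_eq_self (fun x => w (x - a) * φ x) a]
  simp only [add_sub_cancel_right]

end TranslationInvariance

section Translation

variable {E : Type*} [NormedAddCommGroup E] [NormedSpace ℝ E] [MeasurableSpace E] [BorelSpace E]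
  {μ : Measure E} {w d : E → ℝ}

theorem abs_integral_mul_fderiv_translate_add_le [IsFiniteMeasureOnCompacts μ]
    [μ.IsAddRightInvariant] {h : E} (hd : MemLp d 2 μ)
    (hwd : HasWeakDeriv μ w d h) {κ : ℝ} (hκ : 0 ≤ κ) {t : ℝ}
    (ht : eLpNorm (fun x => d (x - t • h) - d x) 2 μ ≤ ENNReal.ofReal κ)
    {φ : E → ℝ} (hφ : ContDiff ℝ (⊤ : ℕ∞) φ) (hφc : HasCompactSupport φ) :
    |∫ x, w x * fderiv ℝ φ (x + t • h) h ∂μ + ∫ x, d x * φ x ∂μ|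
      ≤ κ * (eLpNorm φ 2 μ).toReal := by
  have hφ2 : MemLp φ 2 μ := hφ.continuous.memLp_of_hasCompactSupport hφc
  have hdt := memLp_comp_sub_right hd (t • h)
  have hweak := hwd (fun x => φ (x + t • h)) (hφ.comp (contDiff_id.add contDiff_const))
    (hφc.comp_homeomorph (Homeomorph.addRight (t • h)))
  simp only [fderiv_comp_add_right] at hweak
  have hsplit : ∫ x, (d (x - t • h) - d x) * φ x ∂μ
      = ∫ x, d (x - t • h) * φ x ∂μ - ∫ x, d x * φ x ∂μ := by
    simp only [sub_mul]
    exact integral_sub (hdt.integrable_mul hφ2) (hd.integrable_mul hφ2)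
  rw [hweak, integral_mul_comp_add_right, neg_add_eq_sub, ← neg_sub, ← hsplit, abs_neg]
  refine (abs_integral_mul_le_eLpNorm_two (hdt.sub hd) hφ2).trans ?_
  gcongr
  exact ENNReal.toReal_le_of_le_ofReal hκ ht

variable [FiniteDimensional ℝ E]

theorem eLpNorm_two_le_of_forall_smooth [IsFiniteMeasureOnCompacts μ] {R : E → ℝ}
    (hR : MemLp R 2 μ) {κ : ℝ} (hκ : 0 ≤ κ)
    (h : ∀ φ : E → ℝ, ContDiff ℝ (⊤ : ℕ∞) φ → HasCompactSupport φ →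
      |∫ x, R x * φ x ∂μ| ≤ κ * (eLpNorm φ 2 μ).toReal) :
    eLpNorm R 2 μ ≤ ENNReal.ofReal κ := by
  have happrox : ∀ n : ℕ, ∃ φ : E → ℝ, HasCompactSupport φ ∧ ContDiff ℝ (⊤ : ℕ∞) φ ∧
      eLpNorm (R - φ) 2 μ ≤ ENNReal.ofReal (1 / (n + 1)) := fun n =>
    hR.exist_eLpNorm_sub_le ENNReal.ofNat_ne_top one_le_two Nat.one_div_pos_of_nat
  choose φ hφc hφ hRφ using happrox
  have hφ2 : ∀ n, MemLp (φ n) 2 μ := fun n =>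
    (hφ n).continuous.memLp_of_hasCompactSupport (hφc n)
  have hlim : Tendsto (fun n => (hφ2 n).toLp) atTop (𝓝 (hR.toLp R)) := by
    refine tendsto_iff_norm_sub_tendsto_zero.2 (squeeze_zero (fun _ => norm_nonneg _) (fun n => ?_)
      tendsto_one_div_add_atTop_nhds_zero_nat)
    rw [norm_sub_rev, ← MemLp.toLp_sub, Lp.norm_toLp]
    exact ENNReal.toReal_le_of_le_ofReal Nat.one_div_pos_of_nat.le (hRφ n)
  have hsq : ‖hR.toLp R‖ * ‖hR.toLp R‖ ≤ κ * ‖hR.toLp R‖ := by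
    rw [← real_inner_self_eq_norm_mul_norm]
    refine le_of_tendsto_of_tendsto' (tendsto_const_nhds.inner hlim) (hlim.norm.const_mul κ)
      fun n => ?_
    rw [inner_toLp_eq_integral_mul, Lp.norm_toLp]
    exact (le_abs_self _).trans (h (φ n) (hφ n) (hφc n))
  rw [← ENNReal.ofReal_toReal hR.eLpNorm_ne_top, ← Lp.norm_toLp R hR]
  refine ENNReal.ofReal_le_ofReal ?_
  rcases (norm_nonneg (hR.toLp R)).eq_or_lt with h0 | hpos
  · rwa [← h0]
  · exact le_of_mul_le_mul_right hsq hpos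

variable [μ.IsAddHaarMeasure]

theorem hasDerivAt_integral_mul_translate {φ : E → ℝ} (hw : LocallyIntegrable w μ)
    (hφ : ContDiff ℝ 1 φ) (hφc : HasCompactSupport φ) (h : E) (t : ℝ) :
    HasDerivAt (fun t : ℝ => ∫ x, w x * φ (x + t • h) ∂μ)
      (∫ x, w x * fderiv ℝ φ (x + t • h) h ∂μ) t := by
  -- The integral is the convolution of `w` with `y ↦ φ (-y)`, evaluated at `-t • h`.
  let ψ : E → ℝ := fun y => φ (-y)
  have hψ : ContDiff ℝ 1 ψ := hφ.comp contDiff_neg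
  have hψc : HasCompactSupport ψ := hφc.comp_homeomorph (Homeomorph.neg E)
  have hψ' : ∀ y, fderiv ℝ ψ y (-h) = fderiv ℝ φ (-y) h := fun y => by
    have hφy : HasFDerivAt φ (fderiv ℝ φ (-y)) (-y) :=
      (hφ.differentiable one_ne_zero (-y)).hasFDerivAt
    have hψy : HasFDerivAt ψ _ y := hφy.comp y (hasFDerivAt_id y).neg
    rw [hψy.fderiv]
    simp
  have hconv := hψc.hasFDerivAt_convolution_right (ContinuousLinearMap.mul ℝ ℝ) hw hψ (-(t • h))
  have hline : HasDerivAt (fun t : ℝ => -(t • h)) (-h) t := by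
    simpa using ((hasDerivAt_id t).smul_const h).fun_neg
  have hderiv := hconv.comp_hasDerivAt t hline
  rw [convolution_precompR_apply _ hw (hψc.fderiv ℝ) (hψ.continuous_fderiv one_ne_zero)] at hderiv
  simp only [convolution_def, ContinuousLinearMap.mul_apply', hψ'] at hderiv
  simpa [Function.comp_def, convolution_def, ψ, add_comm] using hderiv

/-- By duality it suffices to test with smooth `φ`: then `t ↦ ∫ w φ(· + t h) + t ∫ d φ` has a
derivative on `[0, 1]` which the hypothesis bounds. -/
theorem eLpNorm_sub_translate_sub_le {h : E} (hw : MemLp w 2 μ) (hd : MemLp d 2 μ)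
    (hwd : HasWeakDeriv μ w d h) {κ : ℝ} (hκ : 0 ≤ κ)
    (ht : ∀ t ∈ Set.Icc (0 : ℝ) 1,
      eLpNorm (fun x => d (x - t • h) - d x) 2 μ ≤ ENNReal.ofReal κ) :
    eLpNorm (fun x => w x - w (x - h) - d x) 2 μ ≤ ENNReal.ofReal κ := by
  have hwh := memLp_comp_sub_right hw h
  refine eLpNorm_two_le_of_forall_smooth ((hw.sub hwh).sub hd) hκ fun φ hφ hφc => ?_
  have hφ2 : MemLp φ 2 μ := hφ.continuous.memLp_of_hasCompactSupport hφc
  let Φ : ℝ → ℝ := fun t => ∫ x, w x * φ (x + t • h) ∂μ + t * ∫ x, d x * φ x ∂μ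
  have hΦ : ∀ t ∈ Set.Icc (0 : ℝ) 1, HasDerivWithinAt Φ
      (∫ x, w x * fderiv ℝ φ (x + t • h) h ∂μ + ∫ x, d x * φ x ∂μ) (Set.Icc 0 1) t := fun t _ => by
    have hlin := (hasDerivAt_id t).mul_const (∫ x, d x * φ x ∂μ)
    rw [one_mul] at hlin
    exact ((hasDerivAt_integral_mul_translate (hw.locallyIntegrable one_le_two)
      (hφ.of_le (by exact_mod_cast le_top)) hφc h t).add hlin).hasDerivWithinAt
  have hbound := norm_image_sub_le_of_norm_deriv_le_segment_01' hΦ fun t hmem =>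
    abs_integral_mul_fderiv_translate_add_le hd hwd hκ (ht t ⟨hmem.1, hmem.2.le⟩) hφ hφc
  have hw_int : Integrable (fun x => w x * φ x) μ := hw.integrable_mul hφ2
  have hwh_int : Integrable (fun x => w (x - h) * φ x) μ := hwh.integrable_mul hφ2
  have hd_int : Integrable (fun x => d x * φ x) μ := hd.integrable_mul hφ2
  have hincrement : ∫ x, (w x - w (x - h) - d x) * φ x ∂μ = -(Φ 1 - Φ 0) := by
    simp only [sub_mul, Φ, one_smul, zero_smul, integral_mul_comp_add_right, sub_zero]
    rw [integral_sub (f := fun x => w x * φ x - w (x - h) * φ x) (hw_int.sub hwh_int) hd_int,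
      integral_sub hw_int hwh_int]
    ring
  simp only [Pi.sub_apply]
  rwa [hincrement, abs_neg]

theorem tendsto_eLpNorm_translate_sub (hd : MemLp d 2 μ) :
    Tendsto (fun h : E => eLpNorm (fun x => d (x - h) - d x) 2 μ) (𝓝 0) (𝓝 0) := by
  have : Fact ((2 : ℝ≥0∞) ≠ ⊤) := ⟨ENNReal.ofNat_ne_top⟩
  have hcont : Continuous fun h : E => DomAddAct.mk (-h) +ᵥ hd.toLp d := by fun_prop
  refine (tendsto_iff_edist_tendsto_0.1 (hcont.tendsto 0)).congr fun h => ?_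
  rw [neg_zero, DomAddAct.mk_zero, zero_vadd, DomAddAct.mk_vadd_toLp, Lp.edist_toLp_toLp]
  simp only [vadd_eq_add, neg_add_eq_sub]
  rfl

theorem tendsto_eLpNorm_difference_quotient {z : E} (hw : MemLp w 2 μ) (hd : MemLp d 2 μ)
    (hwd : HasWeakDeriv μ w d z) :
    Tendsto (fun r : ℝ => eLpNorm (fun x => r⁻¹ * (w x - w (x - r • z)) - d x) 2 μ)
      (𝓝[≠] 0) (𝓝 0) := by
  refine ENNReal.tendsto_nhds_zero.2 fun ε hε => ?_
  rcases eq_or_ne ε ⊤ with rfl | hε_top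
  · exact Eventually.of_forall fun _ => le_top
  obtain ⟨δ, hδ, hball⟩ := Metric.eventually_nhds_iff_ball.1
    ((ENNReal.tendsto_nhds_zero.1 (tendsto_eLpNorm_translate_sub hd)) ε hε)
  have hsmul : Tendsto (fun r : ℝ => r • z) (𝓝 0) (𝓝 0) := by
    simpa using (by fun_prop : Continuous fun r : ℝ => r • z).tendsto 0
  filter_upwards [(hsmul.eventually (Metric.ball_mem_nhds 0 hδ)).filter_mono nhdsWithin_le_nhds,
    self_mem_nhdsWithin] with r hr hr0
  have htranslate : ∀ t ∈ Set.Icc (0 : ℝ) 1,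
      eLpNorm (fun x => r * d (x - t • r • z) - r * d x) 2 μ
        ≤ ENNReal.ofReal (|r| * ε.toReal) := fun t ht => by
    simp only [← mul_sub]
    rw [eLpNorm_const_mul, ENNReal.ofReal_mul (abs_nonneg r), ENNReal.ofReal_toReal hε_top,
      Real.enorm_eq_ofReal_abs]
    gcongr
    refine hball _ (mem_ball_zero_iff.2 ?_)
    rw [norm_smul, Real.norm_eq_abs, abs_of_nonneg ht.1]
    exact (mul_le_of_le_one_left (norm_nonneg _) ht.2).trans_lt (mem_ball_zero_iff.1 hr)
  have hexpansion := eLpNorm_sub_translate_sub_le hw (hd.const_mul r) (hwd.smul r)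
    (by positivity) htranslate
  have hscale : (fun x => r⁻¹ * (w x - w (x - r • z)) - d x)
      = fun x => r⁻¹ * (w x - w (x - r • z) - r * d x) := by
    funext x
    rw [mul_sub r⁻¹ _ (r * d x), inv_mul_cancel_left₀ hr0]
  rw [hscale, eLpNorm_const_mul]
  calc _ ≤ ‖r⁻¹‖ₑ * ENNReal.ofReal (|r| * ε.toReal) := by gcongr
    _ = ε := by
      rw [Real.enorm_eq_ofReal_abs, ← ENNReal.ofReal_mul (abs_nonneg _), abs_inv,
        inv_mul_cancel_left₀ (abs_ne_zero.2 hr0), ENNReal.ofReal_toReal hε_top]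

theorem eLpNorm_sub_translate_le {h : E} (hw : MemLp w 2 μ) (hd : MemLp d 2 μ)
    (hwd : HasWeakDeriv μ w d h) :
    eLpNorm (fun x => w x - w (x - h)) 2 μ ≤ 3 * eLpNorm d 2 μ := by
  have htwo : ENNReal.ofReal (2 * eLpNorm d 2 μ).toReal = 2 * eLpNorm d 2 μ :=
    ENNReal.ofReal_toReal (ENNReal.mul_ne_top ENNReal.ofNat_ne_top hd.eLpNorm_ne_top)
  have hexpansion := eLpNorm_sub_translate_sub_le hw hd hwd ENNReal.toReal_nonneg fun t _ =>
    calc eLpNorm (fun x => d (x - t • h) - d x) 2 μ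
        ≤ eLpNorm (fun x => d (x - t • h)) 2 μ + eLpNorm d 2 μ :=
          eLpNorm_sub_le (memLp_comp_sub_right hd (t • h)).1 hd.1 one_le_two
      _ = ENNReal.ofReal (2 * eLpNorm d 2 μ).toReal := by
          rw [eLpNorm_comp_sub_right hd.1, htwo, two_mul]
  calc eLpNorm (fun x => w x - w (x - h)) 2 μ
      = eLpNorm ((fun x => w x - w (x - h) - d x) + d) 2 μ := by
        congr 1
        funext x
        simp
    _ ≤ eLpNorm (fun x => w x - w (x - h) - d x) 2 μ + eLpNorm d 2 μ :=
        eLpNorm_add_le ((hw.sub (memLp_comp_sub_right hw h)).sub hd).1 hd.1 one_le_two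
    _ ≤ 2 * eLpNorm d 2 μ + eLpNorm d 2 μ := by
        gcongr
        exact htwo ▸ hexpansion
    _ = 3 * eLpNorm d 2 μ := by ring

end Translation

section Cutoff

theorem exists_testFunction_eq_one {E : Type*} [NormedAddCommGroup E] [NormedSpace ℝ E]
    [FiniteDimensional ℝ E] {K : Set E} {U : Opens E} (hK : IsCompact K) (hKU : K ⊆ U) :
    ∃ ζ : 𝓓(U, ℝ), (∀ x ∈ K, ζ x = 1) ∧ ∀ x, ζ x ∈ Set.Icc (0 : ℝ) 1 := by
  obtain ⟨L, hL, hKL, hLU⟩ := exists_compact_between hK U.isOpen hKU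
  obtain ⟨f, hf1, hf0, hf01⟩ := exists_contMDiffMap_one_nhds_of_subset_interior (n := ⊤)
    (modelWithCornersSelf ℝ E) hK.isClosed hKL
  have hsupp : Function.support f ⊆ L := fun x hx => by_contra fun hxL => hx (hf0 x hxL)
  exact ⟨⟨f, f.contMDiff.contDiff, .of_support_subset_isCompact hL hsupp,
    (closure_minimal hsupp hL.isClosed).trans hLU⟩, fun x hx => hf1.self_of_nhdsSet x hx, hf01⟩

end Cutoff

section Mollification

open scoped Convolution

variable {E : Type*} [NormedAddCommGroup E] [NormedSpace ℝ E] [FiniteDimensional ℝ E]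
  [MeasurableSpace E] [BorelSpace E] {μ : Measure E}

theorem sub_convolution_normed_eq_integral [μ.IsAddHaarMeasure] {d : E → ℝ}
    (hd : LocallyIntegrable d μ) (ρ : ContDiffBump (0 : E)) (x : E) :
    d x - (d ⋆[.mul ℝ ℝ, μ] ρ.normed μ) x = ∫ h, ρ.normed μ h * (d x - d (x - h)) ∂μ := by
  have hconv : Integrable (fun h => ρ.normed μ h * d (x - h)) μ := by
    simpa only [ContinuousLinearMap.mul_apply', mul_comm] using
      (ρ.hasCompactSupport_normed.convolutionExists_right (.mul ℝ ℝ) hd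
        ρ.continuous_normed x).integrable_swap
  simp only [convolution_eq_swap, ContinuousLinearMap.mul_apply', mul_sub]
  rw [integral_sub (ρ.integrable_normed.mul_const _) hconv, integral_mul_const,
    ρ.integral_normed, one_mul]
  simp only [mul_comm]

theorem eLpNorm_one_sub_convolution_normed_le [μ.IsAddHaarMeasure] {d : E → ℝ}
    (hd : LocallyIntegrable d μ) {B : Set E} (ρ : ContDiffBump (0 : E)) {C : ℝ≥0∞}
    (hC : ∀ h : E, ‖h‖ ≤ ρ.rOut → eLpNorm (fun x => d x - d (x - h)) 1 (μ.restrict B) ≤ C) :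
    eLpNorm (fun x => d x - (d ⋆[.mul ℝ ℝ, μ] ρ.normed μ) x) 1 (μ.restrict B) ≤ C := by
  have hρ : Integrable (ρ.normed μ) μ := ρ.integrable_normed
  have hρ_mass : ∫⁻ h, ‖ρ.normed μ h‖ₑ ∂μ = 1 := by
    simp [← ofReal_integral_norm_eq_lintegral_enorm hρ, Real.norm_of_nonneg (ρ.nonneg_normed _),
      ρ.integral_normed]
  have hdiff : AEStronglyMeasurable (fun p : E × E => d p.1 - d (p.1 - p.2))
      ((μ.restrict B).prod μ) :=
    (hd.aestronglyMeasurable.comp_fst.sub (hd.aestronglyMeasurable.comp_quasiMeasurePreserving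
      (quasiMeasurePreserving_sub μ μ))).mono_ac (Measure.AbsolutelyContinuous.prod
        Measure.restrict_le_self.absolutelyContinuous .rfl)
  simp only [eLpNorm_one_eq_lintegral_enorm] at hC ⊢
  calc ∫⁻ x in B, ‖d x - (d ⋆[.mul ℝ ℝ, μ] ρ.normed μ) x‖ₑ ∂μ
      ≤ ∫⁻ x in B, ∫⁻ h, ‖ρ.normed μ h‖ₑ * ‖d x - d (x - h)‖ₑ ∂μ ∂μ := by
        refine lintegral_mono fun x => ?_
        simp only [sub_convolution_normed_eq_integral hd, ← enorm_mul]
        exact enorm_integral_le_lintegral_enorm _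
    _ = ∫⁻ h, ∫⁻ x in B, ‖ρ.normed μ h‖ₑ * ‖d x - d (x - h)‖ₑ ∂μ ∂μ :=
        lintegral_lintegral_swap (hρ.1.comp_snd.enorm.mul hdiff.enorm)
    _ ≤ ∫⁻ h, ‖ρ.normed μ h‖ₑ * C ∂μ := by
        refine lintegral_mono fun h => ?_
        rw [lintegral_const_mul' _ _ enorm_ne_top]
        by_cases hh : ‖h‖ ≤ ρ.rOut
        · gcongr
          exact hC h hh
        · have hzero : ρ.normed μ h = 0 := by
            rw [← Function.notMem_support, ρ.support_normed_eq, mem_ball_zero_iff]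
            exact fun hlt => hh hlt.le
          simp [hzero]
    _ = C := by rw [lintegral_mul_const'' _ hρ.1.enorm, hρ_mass, one_mul]

theorem tendsto_eLpNorm_one_convolution_of_tendstoWeakly [μ.IsAddHaarMeasure] {d : ℕ → E → ℝ}
    (hd : ∀ n, MemLp (d n) 2 μ) {A : ℝ≥0∞} (hA : A ≠ ⊤) (hdA : ∀ n, eLpNorm (d n) 2 μ ≤ A)
    (hw : TendstoWeakly μ 2 d 0) {k : E → ℝ} (hk : Continuous k) (hkc : HasCompactSupport k)
    (ν : Measure E) [IsFiniteMeasure ν] :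
    Tendsto (fun n => eLpNorm (d n ⋆[.mul ℝ ℝ, μ] k) 1 ν) atTop (𝓝 0) := by
  have hk2 : MemLp k 2 μ := hk.memLp_of_hasCompactSupport hkc
  have hreflect : ∀ x, MeasurePreserving (fun t => x - t) μ μ :=
    Measure.measurePreserving_sub_left μ
  have hkx : ∀ x, MemLp (fun t => k (x - t)) 2 μ := fun x =>
    hk2.comp_measurePreserving (hreflect x)
  have hkx_norm : ∀ x, eLpNorm (fun t => k (x - t)) 2 μ = eLpNorm k 2 μ := fun x =>
    eLpNorm_comp_measurePreserving hk2.1 (hreflect x)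
  have hbound : ∀ n x, ‖(d n ⋆[.mul ℝ ℝ, μ] k) x‖ₑ ≤ A * eLpNorm k 2 μ := fun n x => by
    rw [Real.enorm_eq_ofReal_abs]
    refine ENNReal.ofReal_le_of_le_toReal
      ((abs_integral_mul_le_eLpNorm_two (hd n) (hkx x)).trans ?_)
    rw [hkx_norm, ENNReal.toReal_mul]
    gcongr
    exact hdA n
  have hcont : ∀ n, Continuous (d n ⋆[.mul ℝ ℝ, μ] k) := fun n =>
    hkc.continuous_convolution_right _ ((hd n).locallyIntegrable one_le_two) hk
  simp only [eLpNorm_one_eq_lintegral_enorm]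
  rw [← lintegral_zero (μ := ν)]
  refine tendsto_lintegral_of_dominated_convergence (fun _ => A * eLpNorm k 2 μ)
    (fun n => (hcont n).measurable.enorm) (fun n => ae_of_all _ (hbound n)) ?_
    (ae_of_all _ fun x => ?_)
  · rw [lintegral_const]
    exact ENNReal.mul_ne_top (ENNReal.mul_ne_top hA hk2.eLpNorm_ne_top) (measure_ne_top _ _)
  · simpa [convolution_def] using (hw _ (hkx x)).enorm

theorem eLpNorm_one_restrict_sub_convolution_normed_le [μ.IsAddHaarMeasure] {d : E → ℝ}
    (hd : MemLp d 2 μ) {A : ℝ≥0∞}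
    (hT : ∀ h, eLpNorm (fun x => d x - d (x - h)) 2 μ ≤ ‖h‖ₑ * A)
    (ρ : ContDiffBump (0 : E)) (B : Set E) :
    eLpNorm (fun x => d x - (d ⋆[.mul ℝ ℝ, μ] ρ.normed μ) x) 1 (μ.restrict B)
      ≤ ENNReal.ofReal ρ.rOut * (A * (μ.restrict B) Set.univ
        ^ (1 / (1 : ℝ≥0∞).toReal - 1 / (2 : ℝ≥0∞).toReal)) := by
  refine eLpNorm_one_sub_convolution_normed_le (hd.locallyIntegrable one_le_two) ρ fun h hh => ?_
  have htranslate : eLpNorm (fun x => d x - d (x - h)) 2 (μ.restrict B)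
      ≤ ENNReal.ofReal ρ.rOut * A := by
    refine (eLpNorm_restrict_le _ _ _ _).trans ((hT h).trans ?_)
    gcongr
    exact ofReal_norm h ▸ ENNReal.ofReal_le_ofReal hh
  rw [← mul_assoc]
  refine (eLpNorm_le_eLpNorm_mul_rpow_measure_univ one_le_two
    (hd.sub (memLp_comp_sub_right hd h)).1.restrict).trans (mul_le_mul' htranslate le_rfl)

/-- The mollifications converge to zero by weak convergence, and the equi-Lipschitz translations
make the mollification error uniformly small. -/
theorem tendsto_eLpNorm_one_of_tendstoWeakly_of_translate [μ.IsAddHaarMeasure] {d : ℕ → E → ℝ}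
    (hd : ∀ n, MemLp (d n) 2 μ) {A : ℝ≥0∞} (hA : A ≠ ⊤) (hdA : ∀ n, eLpNorm (d n) 2 μ ≤ A)
    (hT : ∀ n h, eLpNorm (fun x => d n x - d n (x - h)) 2 μ ≤ ‖h‖ₑ * A)
    (hw : TendstoWeakly μ 2 d 0) {B : Set E} (hB : μ B ≠ ⊤) :
    Tendsto (fun n => eLpNorm (d n) 1 (μ.restrict B)) atTop (𝓝 0) := by
  have : IsFiniteMeasure (μ.restrict B) := ⟨by simpa using hB.lt_top⟩
  let D : ℝ≥0∞ := A * (μ.restrict B) Set.univ ^ (1 / (1 : ℝ≥0∞).toReal - 1 / (2 : ℝ≥0∞).toReal)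
  have hD : D ≠ ⊤ := ENNReal.mul_ne_top hA
    (ENNReal.rpow_ne_top_of_nonneg (by norm_num) (measure_ne_top _ _))
  refine ENNReal.tendsto_nhds_zero.2 fun ε hε => ?_
  obtain ⟨r, hrε, hr⟩ : ∃ r : ℝ, ENNReal.ofReal r * D ≤ ε / 2 ∧ 0 < r := by
    have hlim : Tendsto (fun r : ℝ => ENNReal.ofReal r * D) (𝓝[>] 0) (𝓝 0) := by
      simpa using (ENNReal.Tendsto.mul_const (ENNReal.continuous_ofReal.tendsto 0)
        (Or.inr hD)).mono_left nhdsWithin_le_nhds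
    exact ((ENNReal.tendsto_nhds_zero.1 hlim _ (ENNReal.half_pos hε.ne')).and
      self_mem_nhdsWithin).exists
  let ρ : ContDiffBump (0 : E) := ⟨r / 2, r, half_pos hr, half_lt_self hr⟩
  have herror : ∀ n, eLpNorm (fun x => d n x - (d n ⋆[.mul ℝ ℝ, μ] ρ.normed μ) x) 1
      (μ.restrict B) ≤ ε / 2 := fun n =>
    (eLpNorm_one_restrict_sub_convolution_normed_le (hd n) (hT n) ρ B).trans hrε
  have hmollified := tendsto_eLpNorm_one_convolution_of_tendstoWeakly hd hA hdA hw
    (k := ρ.normed μ) ρ.continuous_normed ρ.hasCompactSupport_normed (μ.restrict B)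
  filter_upwards [ENNReal.tendsto_nhds_zero.1 hmollified (ε / 2) (ENNReal.half_pos hε.ne')]
    with n hn
  have hconv : AEStronglyMeasurable (d n ⋆[.mul ℝ ℝ, μ] ρ.normed μ) (μ.restrict B) :=
    ((ρ.hasCompactSupport_normed (μ := μ)).continuous_convolution_right _
      ((hd n).locallyIntegrable one_le_two) ρ.continuous_normed).aestronglyMeasurable
  calc eLpNorm (d n) 1 (μ.restrict B) = eLpNorm ((fun x => d n x
          - (d n ⋆[.mul ℝ ℝ, μ] ρ.normed μ) x) + d n ⋆[.mul ℝ ℝ, μ] ρ.normed μ) 1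
          (μ.restrict B) := by
        congr 1
        funext x
        simp
    _ ≤ ε / 2 + ε / 2 := (eLpNorm_add_le ((hd n).1.restrict.sub hconv) hconv le_rfl).trans
        (add_le_add (herror n) hn)
    _ = ε := ENNReal.add_halves ε

end Mollification

section Support

variable {α : Type*} {S : Set α} {ζ f : α → ℝ} {b : NNReal}

theorem nnnorm_mul_le_of_support_subset (hζS : Function.support ζ ⊆ S) (hb : ∀ x, ‖ζ x‖ ≤ b)
    (x : α) : ‖ζ x * f x‖₊ ≤ b * ‖S.indicator f x‖₊ := by
  by_cases hx : x ∈ S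
  · rw [Set.indicator_of_mem hx, nnnorm_mul]
    gcongr
    exact hb x
  · simp [Function.notMem_support.1 fun h => hx (hζS h)]

variable [MeasurableSpace α] {μ : Measure α} {p : ℝ≥0∞}

theorem eLpNorm_mul_le_of_support_subset (hS : MeasurableSet S) (hζS : Function.support ζ ⊆ S)
    (hb : ∀ x, ‖ζ x‖ ≤ b) :
    eLpNorm (fun x => ζ x * f x) p μ ≤ b * eLpNorm f p (μ.restrict S) := by
  rw [← eLpNorm_indicator_eq_eLpNorm_restrict hS]
  exact eLpNorm_le_nnreal_smul_eLpNorm_of_ae_le_mul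
    (ae_of_all _ (nnnorm_mul_le_of_support_subset hζS hb)) p

theorem memLp_mul_of_support_subset (hS : MeasurableSet S) (hζS : Function.support ζ ⊆ S)
    (hb : ∀ x, ‖ζ x‖ ≤ b) (hζ : AEStronglyMeasurable ζ μ) (hf : MemLp f p (μ.restrict S)) :
    MemLp (fun x => ζ x * f x) p μ := by
  have hf' : MemLp (S.indicator f) p μ := (memLp_indicator_iff_restrict hS).2 hf
  have heq : (fun x => ζ x * f x) = fun x => ζ x * S.indicator f x := by
    funext x
    by_cases hx : x ∈ S
    · rw [Set.indicator_of_mem hx]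
    · simp [Function.notMem_support.1 fun h => hx (hζS h)]
  exact hf'.of_le_mul (heq ▸ hζ.mul hf'.1)
    (ae_of_all _ fun x => by exact_mod_cast nnnorm_mul_le_of_support_subset hζS hb x)

theorem setIntegral_mul_eq_integral_mul_of_support_subset (hζS : Function.support ζ ⊆ S)
    (f : α → ℝ) : ∫ x in S, ζ x * f x ∂μ = ∫ x, ζ x * f x ∂μ :=
  setIntegral_eq_integral_of_forall_compl_eq_zero fun x hx => by
    rw [Function.notMem_support.1 fun h => hx (hζS h), zero_mul]

end Support

section WeakDerivativeSum

theorem integrable_mul_of_hasCompactSupport {X : Type*} [TopologicalSpace X] [T2Space X]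
    [MeasurableSpace X] [OpensMeasurableSpace X] {μ : Measure X} {f g : X → ℝ}
    (hf : LocallyIntegrable f μ) (hg : Continuous g) (hgc : HasCompactSupport g) :
    Integrable (fun x => f x * g x) μ := by
  simpa only [smul_eq_mul, mul_comm] using
    hf.integrable_smul_left_of_hasCompactSupport hg hgc

theorem HasWeakDeriv.sum_smul {E : Type*} [NormedAddCommGroup E] [NormedSpace ℝ E]
    [MeasurableSpace E] [OpensMeasurableSpace E] {μ : Measure E} {w : E → ℝ} {ι : Type*}
    {s : Finset ι} {d : ι → E → ℝ} {v : ι → E} (hw : LocallyIntegrable w μ)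
    (hd : ∀ j ∈ s, LocallyIntegrable (d j) μ) (hwd : ∀ j ∈ s, HasWeakDeriv μ w (d j) (v j))
    (c : ι → ℝ) :
    HasWeakDeriv μ w (fun x => ∑ j ∈ s, c j * d j x) (∑ j ∈ s, c j • v j) := fun φ hφ hφc => by
  have hφd : ∀ j ∈ s, Integrable (fun x => w x * fderiv ℝ φ x (v j)) μ := fun j _ =>
    integrable_mul_of_hasCompactSupport hw
      ((hφ.continuous_fderiv (by simp)).clm_apply continuous_const) (hφc.fderiv_apply ℝ (v j))
  have hdφ : ∀ j ∈ s, Integrable (fun x => d j x * φ x) μ := fun j hj =>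
    integrable_mul_of_hasCompactSupport (hd j hj) hφ.continuous hφc
  simp only [map_sum, map_smul, smul_eq_mul, Finset.mul_sum, Finset.sum_mul,
    mul_left_comm _ (c _), mul_assoc (c _)]
  rw [integral_finsetSum _ fun j hj => (hφd j hj).const_mul _,
    integral_finsetSum _ fun j hj => (hdφ j hj).const_mul _, ← Finset.sum_neg_distrib]
  refine Finset.sum_congr rfl fun j hj => ?_
  rw [integral_const_mul, integral_const_mul, hwd j hj φ hφ hφc, mul_neg]

end WeakDerivativeSum

section Sobolev

theorem sum_smul_e (z : E3) : ∑ j, z j • e j = z := by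
  simpa only [EuclideanSpace.basisFun_repr, EuclideanSpace.basisFun_apply, e] using
    (EuclideanSpace.basisFun (Fin 3) ℝ).sum_repr z

variable {Ω : Opens E3}

theorem W12.memLp_val_apply (u : W12 Ω) (i : Fin 3) :
    MemLp (fun x => u.val x i) 2 (volume.restrict (Ω : Set E3)) :=
  u.memLp_val.eval_piLp i

theorem W12.locallyIntegrable_val_apply (u : W12 Ω) (i : Fin 3) :
    LocallyIntegrable (fun x => u.val x i) (volume.restrict (Ω : Set E3)) :=
  (u.memLp_val_apply i).locallyIntegrable one_le_two

theorem W12.locallyIntegrable_grad (u : W12 Ω) (i j : Fin 3) :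
    LocallyIntegrable (fun x => u.grad x i j) (volume.restrict (Ω : Set E3)) :=
  (u.memLp_grad i j).locallyIntegrable one_le_two

theorem continuous_fderiv_testFunction (φ : 𝓓(Ω, ℝ)) : Continuous (fderiv ℝ φ) :=
  φ.contDiff.continuous_fderiv (by simp)

theorem W12.integrable_val_mul_fderiv (u : W12 Ω) (φ : 𝓓(Ω, ℝ)) (i j : Fin 3) :
    Integrable (fun x => u.val x i * fderiv ℝ φ x (e j)) (volume.restrict (Ω : Set E3)) :=
  integrable_mul_of_hasCompactSupport (u.locallyIntegrable_val_apply i)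
    ((continuous_fderiv_testFunction φ).clm_apply continuous_const)
    (φ.hasCompactSupport.fderiv_apply ℝ (e j))

theorem W12.integrable_grad_mul (u : W12 Ω) (φ : 𝓓(Ω, ℝ)) (i j : Fin 3) :
    Integrable (fun x => u.grad x i j * φ x) (volume.restrict (Ω : Set E3)) :=
  integrable_mul_of_hasCompactSupport (u.locallyIntegrable_grad i j) φ.continuous
    φ.hasCompactSupport

instance : Sub (W12 Ω) where
  sub u v :=
    { val := fun x => u.val x - v.val x
      grad := fun x => u.grad x - v.grad x
      memLp_val := u.memLp_val.sub v.memLp_val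
      memLp_grad := fun i j => (u.memLp_grad i j).sub (v.memLp_grad i j)
      weak_grad := fun φ i j => by
        simp only [PiLp.sub_apply, Matrix.sub_apply, sub_mul]
        rw [integral_sub (u.integrable_val_mul_fderiv φ i j) (v.integrable_val_mul_fderiv φ i j),
          integral_sub (u.integrable_grad_mul φ i j) (v.integrable_grad_mul φ i j), u.weak_grad,
          v.weak_grad]
        ring }

theorem W12.sub_val (u v : W12 Ω) (x : E3) : (u - v).val x = u.val x - v.val x := rfl

/-- The `i`-th component of `u` multiplied by a cutoff function; it extends by zero to an element
of the Sobolev space of the whole space. -/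
noncomputable def W12.cut (u : W12 Ω) (ζ : 𝓓(Ω, ℝ)) (i : Fin 3) (x : E3) : ℝ := ζ x * u.val x i

/-- The weak partial derivative `∂_j (u.cut ζ i)`. -/
noncomputable def W12.cutPartial (u : W12 Ω) (ζ : 𝓓(Ω, ℝ)) (i j : Fin 3) (x : E3) : ℝ :=
  ζ x * u.grad x i j + fderiv ℝ ζ x (e j) * u.val x i

/-- The weak derivative of `u.cut ζ i` in the direction `z`. -/
noncomputable def W12.cutDeriv (u : W12 Ω) (ζ : 𝓓(Ω, ℝ)) (i : Fin 3) (z x : E3) : ℝ :=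
  ∑ j, z j * u.cutPartial ζ i j x

variable {ζ : 𝓓(Ω, ℝ)}

theorem support_testFunction_subset (ζ : 𝓓(Ω, ℝ)) : Function.support ζ ⊆ Ω :=
  (subset_tsupport ζ).trans ζ.tsupport_subset

theorem support_fderiv_testFunction_subset (ζ : 𝓓(Ω, ℝ)) (z : E3) :
    (Function.support fun x => fderiv ℝ ζ x z) ⊆ Ω :=
  (subset_tsupport _).trans ((tsupport_fderiv_apply_subset ℝ z).trans ζ.tsupport_subset)

theorem exists_norm_testFunction_le (ζ : 𝓓(Ω, ℝ)) :
    ∃ b : NNReal, (∀ x, ‖ζ x‖ ≤ b) ∧ ∀ j x, ‖fderiv ℝ ζ x (e j)‖ ≤ b := by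
  obtain ⟨C, hC⟩ := ζ.hasCompactSupport.exists_bound_of_continuous ζ.continuous
  obtain ⟨C', hC'⟩ := (ζ.hasCompactSupport.fderiv ℝ).exists_bound_of_continuous
    (continuous_fderiv_testFunction ζ)
  refine ⟨(max C C').toNNReal, fun x => ?_, fun j x => ?_⟩
  · exact ((hC x).trans (le_max_left _ _)).trans (Real.le_coe_toNNReal _)
  · have hej : ‖fderiv ℝ ζ x (e j)‖ ≤ ‖fderiv ℝ ζ x‖ := by
      simpa [e] using (fderiv ℝ ζ x).le_opNorm (e j)
    exact ((hej.trans (hC' x)).trans (le_max_right _ _)).trans (Real.le_coe_toNNReal _)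

theorem W12.memLp_cut (u : W12 Ω) (ζ : 𝓓(Ω, ℝ)) (i : Fin 3) : MemLp (u.cut ζ i) 2 := by
  obtain ⟨b, hb, -⟩ := exists_norm_testFunction_le ζ
  exact memLp_mul_of_support_subset Ω.isOpen.measurableSet (support_testFunction_subset ζ) hb
    ζ.continuous.aestronglyMeasurable (u.memLp_val_apply i)

theorem W12.eLpNorm_cut_le {b : NNReal} (hb : ∀ x, ‖ζ x‖ ≤ b) (u : W12 Ω) (i : Fin 3) :
    eLpNorm (u.cut ζ i) 2
      ≤ b * eLpNorm (fun x => u.val x i) 2 (volume.restrict (Ω : Set E3)) :=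
  eLpNorm_mul_le_of_support_subset Ω.isOpen.measurableSet (support_testFunction_subset ζ) hb

theorem W12.memLp_mul_grad (u : W12 Ω) (ζ : 𝓓(Ω, ℝ)) (i j : Fin 3) :
    MemLp (fun x => ζ x * u.grad x i j) 2 := by
  obtain ⟨b, hb, -⟩ := exists_norm_testFunction_le ζ
  exact memLp_mul_of_support_subset Ω.isOpen.measurableSet (support_testFunction_subset ζ) hb
    ζ.continuous.aestronglyMeasurable (u.memLp_grad i j)

theorem W12.memLp_fderiv_mul_val (u : W12 Ω) (ζ : 𝓓(Ω, ℝ)) (i j : Fin 3) :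
    MemLp (fun x => fderiv ℝ ζ x (e j) * u.val x i) 2 := by
  obtain ⟨b, -, hb⟩ := exists_norm_testFunction_le ζ
  exact memLp_mul_of_support_subset Ω.isOpen.measurableSet
    (support_fderiv_testFunction_subset ζ (e j)) (hb j)
    ((continuous_fderiv_testFunction ζ).clm_apply continuous_const).aestronglyMeasurable
    (u.memLp_val_apply i)

theorem W12.memLp_cutPartial (u : W12 Ω) (ζ : 𝓓(Ω, ℝ)) (i j : Fin 3) :
    MemLp (u.cutPartial ζ i j) 2 :=
  (u.memLp_mul_grad ζ i j).add (u.memLp_fderiv_mul_val ζ i j)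

theorem W12.memLp_cutDeriv (u : W12 Ω) (ζ : 𝓓(Ω, ℝ)) (i : Fin 3) (z : E3) :
    MemLp (u.cutDeriv ζ i z) 2 :=
  memLp_finsetSum _ fun j _ => (u.memLp_cutPartial ζ i j).const_mul (z j)

theorem W12.eLpNorm_cutPartial_le {b : NNReal} (hb : ∀ x, ‖ζ x‖ ≤ b)
    (hb' : ∀ j x, ‖fderiv ℝ ζ x (e j)‖ ≤ b) (u : W12 Ω) (i j : Fin 3) :
    eLpNorm (u.cutPartial ζ i j) 2
      ≤ b * (eLpNorm (fun x => u.grad x i j) 2 (volume.restrict (Ω : Set E3))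
        + eLpNorm (fun x => u.val x i) 2 (volume.restrict (Ω : Set E3))) := by
  have hΩ : MeasurableSet (Ω : Set E3) := Ω.isOpen.measurableSet
  rw [mul_add]
  exact (eLpNorm_add_le (u.memLp_mul_grad ζ i j).1 (u.memLp_fderiv_mul_val ζ i j).1
    one_le_two).trans (add_le_add
      (eLpNorm_mul_le_of_support_subset hΩ (support_testFunction_subset ζ) hb)
      (eLpNorm_mul_le_of_support_subset hΩ (support_fderiv_testFunction_subset ζ (e j)) (hb' j)))

theorem W12.eLpNorm_cutDeriv_le (u : W12 Ω) (ζ : 𝓓(Ω, ℝ)) (i : Fin 3) (z : E3) :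
    eLpNorm (u.cutDeriv ζ i z) 2 ≤ ‖z‖ₑ * ∑ j, eLpNorm (u.cutPartial ζ i j) 2 := by
  have hsum : u.cutDeriv ζ i z = ∑ j, fun x => z j * u.cutPartial ζ i j x := by
    funext x
    simp [W12.cutDeriv]
  rw [hsum, Finset.mul_sum]
  refine (eLpNorm_sum_le (fun j _ => ((u.memLp_cutPartial ζ i j).const_mul (z j)).1)
    one_le_two).trans (Finset.sum_le_sum fun j _ => ?_)
  rw [eLpNorm_const_mul]
  gcongr
  exact PiLp.enorm_apply_le z j

theorem W12.hasWeakDeriv_cut_e (u : W12 Ω) (ζ : 𝓓(Ω, ℝ)) (i j : Fin 3) :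
    HasWeakDeriv volume (u.cut ζ i) (u.cutPartial ζ i j) (e j) := fun φ hφ hφc => by
  let ψ : 𝓓(Ω, ℝ) := ⟨fun x => ζ x * φ x, ζ.contDiff.mul hφ, ζ.hasCompactSupport.mul_right,
    tsupport_mul_subset_left.trans ζ.tsupport_subset⟩
  have hψ : ∀ x, fderiv ℝ ψ x (e j) = ζ x * fderiv ℝ φ x (e j) + fderiv ℝ ζ x (e j) * φ x :=
    fun x => by
      have hprod := fderiv_fun_mul (ζ.contDiff.differentiable (by simp) x)
        (hφ.differentiable (by simp) x)
      change fderiv ℝ (fun x => ζ x * φ x) x (e j) = _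
      rw [hprod]
      simp [mul_comm]
  have hcut : Integrable fun x => u.cut ζ i x * fderiv ℝ φ x (e j) :=
    integrable_mul_of_hasCompactSupport ((u.memLp_cut ζ i).locallyIntegrable one_le_two)
      ((hφ.continuous_fderiv (by simp)).clm_apply continuous_const) (hφc.fderiv_apply ℝ (e j))
  have hgrad : Integrable fun x => ζ x * u.grad x i j * φ x :=
    integrable_mul_of_hasCompactSupport ((u.memLp_mul_grad ζ i j).locallyIntegrable one_le_two)
      hφ.continuous hφc
  have hval : Integrable fun x => fderiv ℝ ζ x (e j) * u.val x i * φ x :=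
    integrable_mul_of_hasCompactSupport
      ((u.memLp_fderiv_mul_val ζ i j).locallyIntegrable one_le_two) hφ.continuous hφc
  have hweak : ∫ x, fderiv ℝ ψ x (e j) * u.val x i = -∫ x, ψ x * u.grad x i j := by
    rw [← setIntegral_mul_eq_integral_mul_of_support_subset
        (support_fderiv_testFunction_subset ψ (e j)),
      ← setIntegral_mul_eq_integral_mul_of_support_subset (support_testFunction_subset ψ)]
    simpa only [mul_comm] using u.weak_grad ψ i j
  have hψ_val : ∫ x, fderiv ℝ ψ x (e j) * u.val x i = (∫ x, u.cut ζ i x * fderiv ℝ φ x (e j))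
      + ∫ x, fderiv ℝ ζ x (e j) * u.val x i * φ x := by
    rw [← integral_add hcut hval]
    simp only [hψ, W12.cut]
    congr! 2
    ring
  have hψ_grad : ∫ x, ψ x * u.grad x i j = ∫ x, ζ x * u.grad x i j * φ x :=
    integral_congr_ae (ae_of_all _ fun x => mul_right_comm _ _ _)
  simp only [W12.cutPartial, add_mul]
  rw [integral_add hgrad hval]
  linarith

theorem W12.hasWeakDeriv_cut (u : W12 Ω) (ζ : 𝓓(Ω, ℝ)) (i : Fin 3) (z : E3) :
    HasWeakDeriv volume (u.cut ζ i) (u.cutDeriv ζ i z) z := by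
  have hsum := HasWeakDeriv.sum_smul (s := Finset.univ)
    ((u.memLp_cut ζ i).locallyIntegrable one_le_two)
    (fun j _ => (u.memLp_cutPartial ζ i j).locallyIntegrable one_le_two)
    (fun j _ => u.hasWeakDeriv_cut_e ζ i j) (fun j => z j)
  rwa [sum_smul_e] at hsum

theorem W12.eLpNorm_cut_sub_translate_le {b : NNReal} (hb : ∀ x, ‖ζ x‖ ≤ b)
    (hb' : ∀ j x, ‖fderiv ℝ ζ x (e j)‖ ≤ b) {u : W12 Ω} {i : Fin 3} {A : ℝ≥0∞}
    (hval : eLpNorm (fun x => u.val x i) 2 (volume.restrict (Ω : Set E3)) ≤ A)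
    (hgrad : ∀ j, eLpNorm (fun x => u.grad x i j) 2 (volume.restrict (Ω : Set E3)) ≤ A) (h : E3) :
    eLpNorm (fun x => u.cut ζ i x - u.cut ζ i (x - h)) 2 ≤ ‖h‖ₑ * (18 * (b * A)) := by
  have hDeriv : eLpNorm (u.cutDeriv ζ i h) 2 ≤ ‖h‖ₑ * (3 * (b * (A + A))) := by
    refine (u.eLpNorm_cutDeriv_le ζ i h).trans (mul_le_mul_right ?_ _)
    have hsum := Finset.sum_le_card_nsmul Finset.univ
      (fun j => eLpNorm (u.cutPartial ζ i j) 2 volume) (b * (A + A)) fun j _ =>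
        (u.eLpNorm_cutPartial_le hb hb' i j).trans
          (mul_le_mul_right (add_le_add (hgrad j) hval) _)
    simpa using hsum
  refine (eLpNorm_sub_translate_le (u.memLp_cut ζ i) (u.memLp_cutDeriv ζ i h)
    (u.hasWeakDeriv_cut ζ i h)).trans ((mul_le_mul_right hDeriv 3).trans_eq ?_)
  ring

end Sobolev

section Rellich

variable {Ω : Opens E3} {v : ℕ → W12 Ω} {i : Fin 3}

theorem tendstoWeakly_cut (hw : WeakConv Ω 2 (fun n x => (v n).val x i) 0) (ζ : 𝓓(Ω, ℝ)) :
    TendstoWeakly volume 2 (fun n => (v n).cut ζ i) 0 := fun ψ hψ => by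
  obtain ⟨b, hb, -⟩ := exists_norm_testFunction_le ζ
  have hζψ : MemLp (fun x => ζ x * ψ x) 2 (volume.restrict (Ω : Set E3)) :=
    memLp_mul_of_support_subset MeasurableSet.univ (Set.subset_univ _) hb
      ζ.continuous.aestronglyMeasurable (by simpa using hψ.restrict _)
  have hcut : ∀ n, ∫ x, (v n).cut ζ i x * ψ x
      = ∫ x in (Ω : Set E3), (v n).val x i * (ζ x * ψ x) := fun n => by
    simp only [W12.cut, mul_assoc]
    rw [← setIntegral_mul_eq_integral_mul_of_support_subset (support_testFunction_subset ζ)]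
    simp only [mul_left_comm]
  simpa [hcut] using hw _ hζψ

theorem tendsto_eLpNorm_one_cut (hw : WeakConv Ω 2 (fun n x => (v n).val x i) 0)
    {A : ℝ≥0∞} (hA : A ≠ ⊤)
    (hval : ∀ n, eLpNorm (fun x => (v n).val x i) 2 (volume.restrict (Ω : Set E3)) ≤ A)
    (hgrad : ∀ n j, eLpNorm (fun x => (v n).grad x i j) 2 (volume.restrict (Ω : Set E3)) ≤ A)
    (hΩ : volume (Ω : Set E3) ≠ ⊤) (ζ : 𝓓(Ω, ℝ)) :
    Tendsto (fun n => eLpNorm ((v n).cut ζ i) 1 (volume.restrict (Ω : Set E3))) atTop (𝓝 0) := by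
  obtain ⟨b, hb, hb'⟩ := exists_norm_testFunction_le ζ
  refine tendsto_eLpNorm_one_of_tendstoWeakly_of_translate (A := 18 * (b * A))
    (fun n => (v n).memLp_cut ζ i) (by finiteness) (fun n => ?_)
    (fun n => W12.eLpNorm_cut_sub_translate_le hb hb' (hval n) (hgrad n)) (tendstoWeakly_cut hw ζ)
    hΩ
  have hbA : (b : ℝ≥0∞) * A ≤ 18 * (b * A) := le_mul_of_one_le_left' (by norm_num)
  exact ((W12.eLpNorm_cut_le hb (v n) i).trans (mul_le_mul_right (hval n) _)).trans hbA

theorem exists_testFunction_eLpNorm_one_mul_le {f : E3 → ℝ}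
    (hf : MemLp f 1 (volume.restrict (Ω : Set E3))) {ε : ℝ≥0∞} (hε : ε ≠ 0) :
    ∃ ζ : 𝓓(Ω, ℝ), eLpNorm (fun x => (1 - ζ x) * f x) 1 (volume.restrict (Ω : Set E3)) ≤ ε := by
  have hΩ : MeasurableSet (Ω : Set E3) := Ω.isOpen.measurableSet
  have : IsFiniteMeasure ((volume.restrict (Ω : Set E3)).withDensity fun x => ‖f x‖ₑ) :=
    isFiniteMeasure_withDensity (by rw [← eLpNorm_one_eq_lintegral_enorm]; exact hf.2.ne)
  obtain ⟨K, hKΩ, hK, hKε⟩ := hΩ.exists_isCompact_sdiff_lt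
    (μ := (volume.restrict (Ω : Set E3)).withDensity fun x => ‖f x‖ₑ) (measure_ne_top _ _) hε
  obtain ⟨ζ, hζ_one, hζ_mem⟩ := exists_testFunction_eq_one hK hKΩ
  have hΩK : MeasurableSet ((Ω : Set E3) \ K) := hΩ.diff hK.measurableSet
  refine ⟨ζ, le_trans ?_ hKε.le⟩
  rw [eLpNorm_one_eq_lintegral_enorm, withDensity_apply _ hΩK, ← lintegral_indicator hΩK]
  refine lintegral_mono_ae ?_
  filter_upwards [ae_restrict_mem hΩ] with x hxΩ
  by_cases hxK : x ∈ K
  · simp [hζ_one x hxK]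
  · rw [Set.indicator_of_mem (Set.mem_sdiff_of_mem hxΩ hxK), enorm_mul]
    refine mul_le_of_le_one_left' ?_
    rw [← ofReal_norm, Real.norm_eq_abs, abs_of_nonneg (by linarith [(hζ_mem x).2])]
    exact ENNReal.ofReal_le_one.2 (by linarith [(hζ_mem x).1])

theorem tendsto_eLpNorm_one_of_weakConv (hw : WeakConv Ω 2 (fun n x => (v n).val x i) 0)
    {f : E3 → ℝ} (hf : MemLp f 1 (volume.restrict (Ω : Set E3)))
    (hvf : ∀ n, ∀ᵐ x ∂volume.restrict (Ω : Set E3), |(v n).val x i| ≤ f x)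
    {A : ℝ≥0∞} (hA : A ≠ ⊤)
    (hval : ∀ n, eLpNorm (fun x => (v n).val x i) 2 (volume.restrict (Ω : Set E3)) ≤ A)
    (hgrad : ∀ n j, eLpNorm (fun x => (v n).grad x i j) 2 (volume.restrict (Ω : Set E3)) ≤ A)
    (hΩ : volume (Ω : Set E3) ≠ ⊤) :
    Tendsto (fun n => eLpNorm (fun x => (v n).val x i) 1 (volume.restrict (Ω : Set E3)))
      atTop (𝓝 0) := by
  rw [ENNReal.tendsto_nhds_zero]
  intro ε hε
  obtain ⟨ζ, hζ⟩ := exists_testFunction_eLpNorm_one_mul_le hf (ENNReal.half_pos hε.ne').ne'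
  have hcut := tendsto_eLpNorm_one_cut hw hA hval hgrad hΩ ζ
  filter_upwards [(ENNReal.tendsto_nhds_zero.1 hcut) (ε / 2) (ENNReal.half_pos hε.ne')] with n hn
  have hrest : eLpNorm (fun x => (1 - ζ x) * (v n).val x i) 1 (volume.restrict (Ω : Set E3))
      ≤ ε / 2 := by
    refine (eLpNorm_mono_ae ?_).trans hζ
    filter_upwards [hvf n] with x hx
    rw [norm_mul, norm_mul]
    exact mul_le_mul_of_nonneg_left (hx.trans (le_abs_self _)) (norm_nonneg _)
  have hsplit : (fun x => (v n).val x i)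
      = (v n).cut ζ i + fun x => (1 - ζ x) * (v n).val x i := by
    funext x
    simp only [W12.cut, Pi.add_apply]
    ring
  have hv := ((v n).memLp_val_apply i).1
  rw [hsplit, ← ENNReal.add_halves ε]
  exact (eLpNorm_add_le ((v n).memLp_cut ζ i).1.restrict
    ((aestronglyMeasurable_const.sub ζ.continuous.aestronglyMeasurable).mul hv) le_rfl).trans
    (add_le_add hn hrest)

theorem tendsto_eLpNorm_one_sub_of_weakConv {u : ℕ → W12 Ω} {u₀ : W12 Ω}
    (hw : WeakConv Ω 2 (fun n x => (u n).val x i) (fun x => u₀.val x i))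
    {M : ℝ} (hM : ∀ n, ∀ᵐ x ∂volume.restrict (Ω : Set E3), |(u n).val x i| ≤ M)
    {A : ℝ≥0∞} (hA : A ≠ ⊤)
    (hgrad : ∀ n j, eLpNorm (fun x => (u n).grad x i j) 2 (volume.restrict (Ω : Set E3)) ≤ A)
    (hΩ : volume (Ω : Set E3) ≠ ⊤) :
    Tendsto (fun n => eLpNorm (fun x => (u n).val x i - u₀.val x i) 1
      (volume.restrict (Ω : Set E3))) atTop (𝓝 0) := by
  have : IsFiniteMeasure (volume.restrict (Ω : Set E3)) := isFiniteMeasure_restrict.2 hΩ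
  have hu₀ := u₀.memLp_val_apply i
  set A₁ := volume.restrict (Ω : Set E3) Set.univ ^ (2 : ℝ≥0∞).toReal⁻¹ * ENNReal.ofReal M
  set A₂ := eLpNorm (fun x => u₀.val x i) 2 (volume.restrict (Ω : Set E3))
  set A₃ := ∑ j, eLpNorm (fun x => u₀.grad x i j) 2 (volume.restrict (Ω : Set E3))
  have hA₁_top : A₁ ≠ ⊤ := ENNReal.mul_ne_top
    (ENNReal.rpow_ne_top_of_nonneg (by norm_num) (measure_ne_top _ _)) ENNReal.ofReal_ne_top
  have hA₂_top : A₂ ≠ ⊤ := hu₀.2.ne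
  have hA₃_top : A₃ ≠ ⊤ := ENNReal.sum_ne_top.2 fun j _ => (u₀.memLp_grad i j).2.ne
  refine tendsto_eLpNorm_one_of_weakConv (v := fun n => u n - u₀)
    (f := fun x => M + ‖u₀.val x i‖) (A := A₁ + A₂ + (A + A₃)) (fun ψ hψ => ?_)
    ((memLp_const M).add (hu₀.mono_exponent one_le_two).norm) (fun n => ?_) (by finiteness)
    (fun n => ?_) (fun n j => ?_) hΩ
  · have hu_int : ∀ n, Integrable (fun x => (u n).val x i * ψ x) (volume.restrict (Ω : Set E3)) :=
      fun n => ((u n).memLp_val_apply i).integrable_mul hψ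
    have hu₀_int : Integrable (fun x => u₀.val x i * ψ x) (volume.restrict (Ω : Set E3)) :=
      hu₀.integrable_mul hψ
    have hdiff := (hw ψ hψ).sub_const (∫ x in (Ω : Set E3), u₀.val x i * ψ x)
    simpa [W12.sub_val, sub_mul, integral_sub, hu_int, hu₀_int] using hdiff
  · filter_upwards [hM n] with x hx
    exact (abs_sub _ _).trans (add_le_add_left hx _)
  · exact (eLpNorm_sub_le ((u n).memLp_val_apply i).1 hu₀.1 one_le_two).trans
      ((add_le_add_left (eLpNorm_le_of_ae_bound (hM n)) _).trans le_self_add)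
  · refine (eLpNorm_sub_le ((u n).memLp_grad i j).1 (u₀.memLp_grad i j).1 one_le_two).trans
      ((add_le_add (hgrad n j) ?_).trans le_add_self)
    exact Finset.single_le_sum (f := fun j => eLpNorm (fun x => u₀.grad x i j) 2
      (volume.restrict (Ω : Set E3))) (fun _ _ => zero_le) (Finset.mem_univ j)

theorem exists_subseq_tendsto_ae_of_components {α : Type*} [MeasurableSpace α] {μ : Measure α}
    {p : ℝ≥0∞} (hp : 1 ≤ p) {v : ℕ → α → E3} {v₀ : α → E3}
    (hv : ∀ n i, AEStronglyMeasurable (fun x => v n x i - v₀ x i) μ)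
    (h : ∀ i, Tendsto (fun n => eLpNorm (fun x => v n x i - v₀ x i) p μ) atTop (𝓝 0)) :
    ∃ φ : ℕ → ℕ, StrictMono φ ∧
      ∀ᵐ x ∂μ, Tendsto (fun n => v (φ n) x) atTop (𝓝 (v₀ x)) := by
  have hsum : Tendsto (fun n => eLpNorm ((∑ i, fun x => ‖v n x i - v₀ x i‖) - 0) p μ)
      atTop (𝓝 0) := by
    have hsum_norms : Tendsto (fun n => ∑ i, eLpNorm (fun x => v n x i - v₀ x i) p μ)
        atTop (𝓝 0) := by
      simpa using tendsto_finsetSum Finset.univ fun i _ => h i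
    refine tendsto_of_tendsto_of_tendsto_of_le_of_le tendsto_const_nhds hsum_norms
      (fun _ => zero_le) fun n => ?_
    simp only [sub_zero]
    exact (eLpNorm_sum_le (fun i _ => (hv n i).norm) hp).trans
      (Finset.sum_le_sum fun i _ => (eLpNorm_norm _).le)
  obtain ⟨φ, hφ, hae⟩ := (tendstoInMeasure_of_tendsto_eLpNorm (zero_lt_one.trans_le hp).ne'
    (fun n => Finset.aestronglyMeasurable_sum _ fun i _ => (hv n i).norm)
    aestronglyMeasurable_zero hsum).exists_seq_tendsto_ae
  refine ⟨φ, hφ, ?_⟩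
  filter_upwards [hae] with x hx
  have hcomp : ∀ i, Tendsto (fun n => v (φ n) x i) atTop (𝓝 (v₀ x i)) := fun i => by
    rw [tendsto_iff_norm_sub_tendsto_zero]
    refine tendsto_of_tendsto_of_tendsto_of_le_of_le tendsto_const_nhds hx
      (fun _ => norm_nonneg _) fun n => ?_
    rw [Finset.sum_apply]
    exact Finset.single_le_sum (f := fun i => ‖v (φ n) x i - v₀ x i‖) (fun _ _ => norm_nonneg _)
      (Finset.mem_univ i)
  exact ((PiLp.continuous_toLp 2 (fun _ : Fin 3 => ℝ)).tendsto _).comp (tendsto_pi_nhds.2 hcomp)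

end Rellich

section GraphMollify

variable {F : Type*} [NormedAddCommGroup F] [NormedSpace ℝ F] {η : E3 → ℝ} {w : E3 → E3}
  {k : E3 × E3 → F}

/-- The mollification with kernel `k` of the graph of `w`, weighted by `η`: the convolution of `k`
with the push-forward of `η(a) da` under `a ↦ (a, w a)`. It produces smooth test fields on
`ℝ³ × ℝ³` concentrated near the graph, although `w` itself is only measurable. -/
noncomputable def graphMollify (η : E3 → ℝ) (w : E3 → E3) (k : E3 × E3 → F) (p : E3 × E3) : F :=
  ∫ a, η a • k (p - (a, w a))

theorem graphMollify_const_smul (c : ℝ) (p : E3 × E3) :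
    graphMollify η w (c • k) p = c • graphMollify η w k p := by
  simp only [graphMollify, Pi.smul_apply, smul_comm _ c, integral_smul]

theorem integrable_smul_comp_sub_graph (hη : Continuous η) (hηc : HasCompactSupport η)
    (hw : Measurable w) (hk : Continuous k) (hkc : HasCompactSupport k) (p : E3 × E3) :
    Integrable fun a => η a • k (p - (a, w a)) := by
  obtain ⟨C, hC⟩ := hk.bounded_above_of_compact_support hkc
  exact (hη.integrable_of_hasCompactSupport hηc).smul_of_top_left <| memLp_top_of_bound
    (hk.comp_aestronglyMeasurable
      (measurable_const.sub (measurable_id.prodMk hw)).aestronglyMeasurable) C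
    (ae_of_all _ fun a => hC _)

theorem convolution_map_graph_eq_graphMollify (hη : Continuous η) (hw : Measurable w)
    (hk : Continuous k) :
    convolution (fun p : E3 × E3 => η p.1) k (ContinuousLinearMap.lsmul ℝ ℝ)
      (Measure.map (fun a : E3 => (a, w a)) volume) = graphMollify η w k := by
  have hgraph : Measurable fun a : E3 => (a, w a) := measurable_id.prodMk hw
  funext p
  rw [convolution_def, integral_map hgraph.aemeasurable]
  · rfl
  · have hcont : Continuous fun q : E3 × E3 => η q.1 • k (p - q) :=
      (hη.comp continuous_fst).smul (hk.comp (continuous_const.sub continuous_id))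
    exact hcont.aestronglyMeasurable

theorem contDiff_graphMollify (hη : Continuous η) (hηc : HasCompactSupport η) (hw : Measurable w)
    (hk : ContDiff ℝ (⊤ : ℕ∞) k) (hkc : HasCompactSupport k) :
    ContDiff ℝ (⊤ : ℕ∞) (graphMollify η w k) := by
  have hgraph : Measurable fun a : E3 => (a, w a) := measurable_id.prodMk hw
  have hη_loc : LocallyIntegrable (fun p : E3 × E3 => η p.1)
      (Measure.map (fun a : E3 => (a, w a)) volume) := by
    refine Integrable.locallyIntegrable ?_
    rw [integrable_map_measure (by fun_prop) hgraph.aemeasurable]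
    exact hη.integrable_of_hasCompactSupport hηc
  rw [← convolution_map_graph_eq_graphMollify hη hw hk.continuous]
  exact hkc.contDiff_convolution_right (n := ⊤) _ hη_loc hk

theorem fderiv_graphMollify (hη : Continuous η) (hηc : HasCompactSupport η) (hw : Measurable w)
    (hk : ContDiff ℝ (⊤ : ℕ∞) k) (hkc : HasCompactSupport k) :
    fderiv ℝ (graphMollify η w k) = graphMollify η w (fderiv ℝ k) := by
  have hk' : Continuous (fderiv ℝ k) := hk.continuous_fderiv (by simp)
  obtain ⟨C, hC⟩ := hk'.bounded_above_of_compact_support (hkc.fderiv ℝ)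
  funext p
  refine (hasFDerivAt_integral_of_dominated_of_fderiv_le (bound := fun a => |η a| * C)
    (F' := fun q a => η a • fderiv ℝ k (q - (a, w a))) univ_mem
    (Eventually.of_forall fun q =>
      (integrable_smul_comp_sub_graph hη hηc hw hk.continuous hkc q).1)
    (integrable_smul_comp_sub_graph hη hηc hw hk.continuous hkc p)
    (integrable_smul_comp_sub_graph hη hηc hw hk' (hkc.fderiv ℝ) p).1
    (ae_of_all _ fun a q _ => ?_)
    ((hη.integrable_of_hasCompactSupport hηc).abs.mul_const C)
    (ae_of_all _ fun a q _ => ?_)).fderiv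
  · rw [norm_smul]
    exact mul_le_mul_of_nonneg_left (hC _) (abs_nonneg _)
  · exact ((hk.differentiable (by simp) _).hasFDerivAt.comp q
      ((hasFDerivAt_id q).sub_const (a, w a))).const_smul (η a)

theorem graphMollify_eq_zero_of_notMem {p : E3 × E3} {δ B : ℝ} (hwB : ∀ a, ‖w a‖ ≤ B)
    (hkδ : ∀ q, k q ≠ 0 → ‖q‖ ≤ δ)
    (hp : p ∉ Metric.cthickening δ (tsupport η) ×ˢ Metric.closedBall (0 : E3) (B + δ)) :
    graphMollify η w k p = 0 := by
  refine integral_eq_zero_of_ae (ae_of_all _ fun a => ?_)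
  by_contra hne
  obtain ⟨hηa, hka⟩ := smul_ne_zero_iff.1 hne
  obtain ⟨hfst, hsnd⟩ := max_le_iff.1 (Prod.norm_def (p - (a, w a)) ▸ hkδ _ hka)
  refine hp ⟨?_, ?_⟩
  · exact Metric.mem_cthickening_of_dist_le p.1 a δ _ (subset_tsupport _ hηa)
      ((dist_eq_norm _ _).trans_le hfst)
  · rw [mem_closedBall_zero_iff, ← add_sub_cancel (w a) p.2]
    exact (norm_add_le _ _).trans (add_le_add (hwB a) hsnd)

/-- The kernel `k` at scale `r`. It is normalised so that the derivatives of its graph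
mollification stay bounded as `r → 0`, while the mollification itself is of order `r`. -/
noncomputable def scaleKernel (r : ℝ) (k : E3 × E3 → F) (p : E3 × E3) : F :=
  (r⁻¹ * r⁻¹) • k (r⁻¹ • p)

variable {r : ℝ}

theorem contDiff_scaleKernel (hk : ContDiff ℝ (⊤ : ℕ∞) k) :
    ContDiff ℝ (⊤ : ℕ∞) (scaleKernel r k) :=
  (hk.comp (contDiff_id.const_smul r⁻¹)).const_smul (r⁻¹ * r⁻¹)

theorem hasCompactSupport_scaleKernel (hr : 0 < r) (hkc : HasCompactSupport k) :
    HasCompactSupport (scaleKernel r k) :=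
  (hkc.comp_homeomorph (Homeomorph.smulOfNeZero r⁻¹ (inv_ne_zero hr.ne'))).smul_left
    (f := fun _ => r⁻¹ * r⁻¹)

theorem fderiv_scaleKernel (hk : ContDiff ℝ (⊤ : ℕ∞) k) :
    fderiv ℝ (scaleKernel r k) = r⁻¹ • scaleKernel r (fderiv ℝ k) := by
  funext p
  have hderiv : HasFDerivAt (scaleKernel r k) _ p :=
    (((hk.differentiable (by simp) _).hasFDerivAt.comp p
      ((hasFDerivAt_id p).const_smul r⁻¹)).const_smul (r⁻¹ * r⁻¹))
  rw [hderiv.fderiv]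
  refine ContinuousLinearMap.ext fun v => ?_
  simp [scaleKernel, smul_smul, mul_comm]

theorem integral_eq_smul_integral_comp_sub_smul (hr : 0 < r) (x : E3) (G : E3 → F) :
    ∫ a, G a = r ^ 3 • ∫ z, G (x - r • z) := by
  have hfinrank : Module.finrank ℝ E3 = 3 := by simp
  rw [Measure.integral_comp_smul volume (fun y => G (x - y)) r,
    integral_sub_left_eq_self (fun y => G y) volume x, smul_smul, hfinrank,
    abs_of_pos (by positivity), mul_inv_cancel₀ (by positivity), one_smul]

theorem graphMollify_scaleKernel (hr : 0 < r) (x y : E3) :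
    graphMollify η w (scaleKernel r k) (x, y)
      = r • ∫ z, η (x - r • z) • k (z, r⁻¹ • (y - w (x - r • z))) := by
  rw [graphMollify, integral_eq_smul_integral_comp_sub_smul hr x]
  simp only [scaleKernel, Prod.mk_sub_mk, Prod.smul_mk, sub_sub_cancel,
    inv_smul_smul₀ hr.ne', smul_comm _ (r⁻¹ * r⁻¹), integral_smul]
  rw [smul_smul]
  congr 1
  field_simp

theorem fderiv_graphMollify_scaleKernel (hη : Continuous η) (hηc : HasCompactSupport η)
    (hw : Measurable w) (hk : ContDiff ℝ (⊤ : ℕ∞) k) (hkc : HasCompactSupport k) (hr : 0 < r)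
    (x y : E3) :
    fderiv ℝ (graphMollify η w (scaleKernel r k)) (x, y)
      = ∫ z, η (x - r • z) • fderiv ℝ k (z, r⁻¹ • (y - w (x - r • z))) := by
  rw [fderiv_graphMollify hη hηc hw (contDiff_scaleKernel hk)
    (hasCompactSupport_scaleKernel hr hkc), fderiv_scaleKernel hk, graphMollify_const_smul,
    graphMollify_scaleKernel hr, inv_smul_smul₀ hr.ne']

theorem exists_norm_graphMollify_scaleKernel_le (hη : Continuous η) (hηc : HasCompactSupport η)
    (w : E3 → E3) (hk : Continuous k) (hkc : HasCompactSupport k) :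
    ∃ C : ℝ, 0 ≤ C ∧ ∀ r : ℝ, 0 < r → ∀ p,
      ‖graphMollify η w (scaleKernel r k) p‖ ≤ C * r := by
  obtain ⟨A, hA⟩ := hη.bounded_above_of_compact_support hηc
  obtain ⟨B, hB⟩ := hk.bounded_above_of_compact_support hkc
  have hA_nonneg : 0 ≤ A := (norm_nonneg _).trans (hA 0)
  have hB_nonneg : 0 ≤ B := (norm_nonneg _).trans (hB 0)
  obtain ⟨R, hR⟩ := hkc.isCompact.isBounded.subset_closedBall 0
  refine ⟨A * B * volume.real (Metric.closedBall (0 : E3) R), by positivity,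
    fun r hr ⟨x, y⟩ => ?_⟩
  rw [graphMollify_scaleKernel hr, norm_smul, Real.norm_of_nonneg hr.le, mul_comm]
  refine mul_le_mul_of_nonneg_right ?_ hr.le
  rw [← setIntegral_eq_integral_of_forall_compl_eq_zero (s := Metric.closedBall (0 : E3) R)]
  · refine norm_setIntegral_le_of_norm_le_const measure_closedBall_lt_top fun z _ => ?_
    rw [norm_smul]
    exact mul_le_mul (hA _) (hB _) (norm_nonneg _) hA_nonneg
  · intro z hz
    rw [image_eq_zero_of_notMem_tsupport (f := k) fun hmem => hz ?_, smul_zero]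
    exact mem_closedBall_zero_iff.2
      ((norm_fst_le _).trans (mem_closedBall_zero_iff.1 (hR hmem)))

end GraphMollify

section Pairing

/-- The integrand of the surface energy, as a functional of the derivative `L` of the test field,
with `c` in place of the cofactor matrix and `t` in place of the determinant. -/
noncomputable def pairing (c : Matrix (Fin 3) (Fin 3) ℝ) (t : ℝ) :
    ((E3 × E3) →L[ℝ] E3) →L[ℝ] ℝ :=
  (∑ i, ∑ j, c i j • (EuclideanSpace.proj i : E3 →L[ℝ] ℝ).comp
    (ContinuousLinearMap.apply ℝ E3 ((e j, 0) : E3 × E3))) +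
  t • ∑ i, (EuclideanSpace.proj i : E3 →L[ℝ] ℝ).comp
    (ContinuousLinearMap.apply ℝ E3 ((0, e i) : E3 × E3))

theorem pairing_apply (c : Matrix (Fin 3) (Fin 3) ℝ) (t : ℝ) (L : (E3 × E3) →L[ℝ] E3) :
    pairing c t L = (∑ i, ∑ j, c i j * (L (e j, 0)) i) + t * ∑ i, (L (0, e i)) i := by
  simp [pairing]

theorem surfacePairing_eq_integral_pairing {Ω : Opens E3} (w : W12 Ω) (f : 𝓓(cyl Ω, E3)) :
    surfacePairing w f = ∫ x in (Ω : Set E3),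
      pairing (cof (w.grad x)) (w.grad x).det (fderiv ℝ f (x, w.val x)) := by
  simp only [surfacePairing, pairing_apply]

set_option maxSynthPendingDepth 3 in
theorem integrable_pairing {α : Type*} [MeasurableSpace α] {μ : Measure α}
    {c : α → Matrix (Fin 3) (Fin 3) ℝ} {t : α → ℝ}
    (hc : ∀ i j, Integrable (fun x => c x i j) μ) (ht : Integrable t μ) :
    Integrable (fun x => pairing (c x) (t x)) μ :=
  (integrable_finsetSum _ fun i _ => integrable_finsetSum _ fun j _ =>
    (hc i j).smul_const _).add (ht.smul_const _)

end Pairing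

section LinearGraph

theorem cof_apply (A : Matrix (Fin 3) (Fin 3) ℝ) (i j : Fin 3) :
    cof A i j = A (i + 1) (j + 1) * A (i + 2) (j + 2) - A (i + 1) (j + 2) * A (i + 2) (j + 1) := by
  rw [cof, Matrix.transpose_apply, Matrix.adjugate_fin_three]
  fin_cases i <;> fin_cases j <;> simp <;> ring

theorem W12.integrable_cof {Ω : Opens E3} (u : W12 Ω) (i j : Fin 3) :
    Integrable (fun x => cof (u.grad x) i j) (volume.restrict (Ω : Set E3)) := by
  have hmul : ∀ a b c d : Fin 3, Integrable (fun x => u.grad x a b * u.grad x c d)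
      (volume.restrict (Ω : Set E3)) := fun a b c d =>
    (u.memLp_grad a b).integrable_mul (u.memLp_grad c d)
  simp only [cof_apply]
  exact (hmul _ _ _ _).sub (hmul _ _ _ _)

theorem sum_cof_mul (A : Matrix (Fin 3) (Fin 3) ℝ) (i l : Fin 3) :
    ∑ j, cof A i j * A l j = if i = l then A.det else 0 := by
  have hadj := congrFun (congrFun (Matrix.mul_adjugate A) l) i
  simp only [Matrix.mul_apply, Matrix.smul_apply, Matrix.one_apply, smul_eq_mul, mul_ite, mul_one,
    mul_zero] at hadj
  simp only [cof, Matrix.transpose_apply, mul_comm (A.adjugate _ _), hadj, eq_comm]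

/-- The endomorphism of `ℝ³` with matrix `A`. -/
noncomputable abbrev matCLM (A : Matrix (Fin 3) (Fin 3) ℝ) : E3 →L[ℝ] E3 :=
  Matrix.toEuclideanCLM (𝕜 := ℝ) A

theorem matCLM_apply (A : Matrix (Fin 3) (Fin 3) ℝ) (z : E3) (i : Fin 3) :
    matCLM A z i = ∑ j, A i j * z j := by
  rw [Matrix.ofLp_toEuclideanCLM]
  rfl

theorem matCLM_e (A : Matrix (Fin 3) (Fin 3) ℝ) (j : Fin 3) :
    matCLM A (e j) = ∑ l, A l j • e l := by
  rw [← sum_smul_e (matCLM A (e j))]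
  simp [matCLM_apply, e]

theorem pairing_cof_apply (A : Matrix (Fin 3) (Fin 3) ℝ) (t : ℝ) (L : (E3 × E3) →L[ℝ] E3) :
    pairing (cof A) t L
      = (∑ i, ∑ j, cof A i j * (L (e j, matCLM A (e j))) i)
        + (t - A.det) * ∑ i, (L (0, e i)) i := by
  have hsplit : ∀ j, L (e j, matCLM A (e j)) = L (e j, 0) + ∑ l, A l j • L (0, e l) := fun j => by
    have hprod : ((e j, matCLM A (e j)) : E3 × E3)
        = (e j, 0) + ∑ l, A l j • ((0, e l) : E3 × E3) := by
      ext1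
      · simp [Prod.fst_sum]
      · simp [Prod.snd_sum, matCLM_e]
    simp only [hprod, map_add, map_sum, map_smul]
  have hdet : ∑ i, ∑ j, cof A i j * ∑ l, A l j * (L (0, e l)) i
      = A.det * ∑ i, (L (0, e i)) i := by
    have hrow : ∀ i, ∑ j, cof A i j * ∑ l, A l j * (L (0, e l)) i
        = ∑ l, (∑ j, cof A i j * A l j) * (L (0, e l)) i := fun i => by
      simp only [Finset.mul_sum, Finset.sum_mul, mul_assoc]
      exact Finset.sum_comm
    rw [Finset.mul_sum]
    simp only [hrow, sum_cof_mul, ite_mul, zero_mul, Finset.sum_ite_eq, Finset.mem_univ, if_true]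
  simp only [pairing_apply, hsplit, PiLp.add_apply, WithLp.ofLp_sum, WithLp.ofLp_smul,
    Finset.sum_apply, Pi.smul_apply, smul_eq_mul, mul_add, Finset.sum_add_distrib]
  rw [hdet]
  ring

theorem integral_fderiv_eq_zero_of_hasCompactSupport {E F : Type*} [NormedAddCommGroup E]
    [NormedSpace ℝ E] [FiniteDimensional ℝ E] [MeasurableSpace E] [BorelSpace E]
    {μ : Measure E} [μ.IsAddHaarMeasure] [NormedAddCommGroup F] [NormedSpace ℝ F] {f : E → F}
    (hf : ContDiff ℝ 1 f) (hfc : HasCompactSupport f) : ∫ x, fderiv ℝ f x ∂μ = 0 := by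
  have hint : Integrable (fderiv ℝ f) μ :=
    (hf.continuous_fderiv one_ne_zero).integrable_of_hasCompactSupport (hfc.fderiv ℝ)
  refine ContinuousLinearMap.ext fun v => ?_
  rw [ContinuousLinearMap.integral_apply hint, zero_apply]
  have hparts := integral_smul_fderiv_eq_neg_fderiv_smul_of_integrable (μ := μ)
    (f := fun _ : E => (1 : ℝ)) (g := f) (v := v) (by simp)
    (by simpa only [one_smul] using hint.apply_continuousLinearMap v)
    (by simpa only [one_smul] using hf.continuous.integrable_of_hasCompactSupport hfc)
    (fun _ _ => differentiableAt_const _) fun x _ => hf.differentiable one_ne_zero x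
  simpa using hparts

/-- The cofactor matrix is divergence free: on linear graphs, the pairing with the cofactors and
the determinant integrates to zero, so only the excess `t - det A` contributes. -/
theorem integral_pairing_cof_fderiv_linear_graph {k : E3 × E3 → E3} (hk : ContDiff ℝ 1 k)
    (hkc : HasCompactSupport k) (A : Matrix (Fin 3) (Fin 3) ℝ) (t : ℝ) :
    ∫ z, pairing (cof A) t (fderiv ℝ k (z, matCLM A z))
      = (t - A.det) * ∫ z, ∑ i, (fderiv ℝ k (z, matCLM A z) (0, e i)) i := by
  set γ : E3 →L[ℝ] E3 × E3 := (ContinuousLinearMap.id ℝ E3).prod (matCLM A)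
  have hγ : ∀ {F : Type} [NormedAddCommGroup F] {f : E3 × E3 → F}, HasCompactSupport f →
      HasCompactSupport fun z => f (γ z) := fun {F} _ f hf =>
    .intro (hf.isCompact.image continuous_fst) fun z hz =>
      image_eq_zero_of_notMem_tsupport fun hmem => hz ⟨γ z, hmem, rfl⟩
  have hint : Integrable fun z => fderiv ℝ k (γ z) :=
    ((hk.continuous_fderiv one_ne_zero).comp γ.continuous).integrable_of_hasCompactSupport
      (hγ (hkc.fderiv ℝ))
  have hchain : ∀ z, fderiv ℝ (fun z => k (γ z)) z = (fderiv ℝ k (γ z)).comp γ := fun z =>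
    ((hk.differentiable one_ne_zero _).hasFDerivAt.comp z γ.hasFDerivAt).fderiv
  have hkγ : ContDiff ℝ 1 fun z => k (γ z) := hk.comp γ.contDiff
  have htangent : ∀ j, (∫ z, fderiv ℝ k (γ z)) (e j, matCLM A (e j)) = 0 := fun j => by
    have hzero := DFunLike.congr_fun
      (integral_fderiv_eq_zero_of_hasCompactSupport (μ := volume) hkγ (hγ hkc)) (e j)
    rw [ContinuousLinearMap.integral_apply ((hkγ.continuous_fderiv
      one_ne_zero).integrable_of_hasCompactSupport ((hγ hkc).fderiv ℝ))] at hzero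
    rw [ContinuousLinearMap.integral_apply hint]
    simp only [hchain] at hzero
    exact hzero
  have hdiv : ∫ z, ∑ i, (fderiv ℝ k (z, matCLM A z) (0, e i)) i
      = ∑ i, ((∫ z, fderiv ℝ k (γ z)) (0, e i)) i := by
    have hdiv := (pairing 0 1).integral_comp_comm hint
    simp only [pairing_apply, Matrix.zero_apply, zero_mul, Finset.sum_const_zero, zero_add,
      one_mul] at hdiv
    exact hdiv
  rw [hdiv]
  refine ((pairing (cof A) t).integral_comp_comm hint).trans ?_
  simp only [pairing_cof_apply, htangent, PiLp.zero_apply, mul_zero, Finset.sum_const_zero,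
    zero_add]

end LinearGraph

section ProductLimit

variable {α β V : Type*} [MeasurableSpace α] [MeasurableSpace β] {μ : Measure α} {ν : Measure β}
  [NormedAddCommGroup V] [NormedSpace ℝ V] {P : α → V →L[ℝ] ℝ} {χ : β → ℝ}

theorem integrable_apply_prod (hP : Integrable P μ) {L : α × β → V}
    (hL : AEStronglyMeasurable L (μ.prod ν)) (hχ : Integrable χ ν) (hLχ : ∀ p, ‖L p‖ ≤ χ p.2) :
    Integrable (fun p => P p.1 (L p)) (μ.prod ν) :=
  (hP.norm.mul_prod hχ).mono'
    (isBoundedBilinearMap_apply.continuous.comp_aestronglyMeasurable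
      (hP.1.comp_fst.prodMk hL)) (ae_of_all _ fun p =>
        (P p.1).le_of_opNorm_le_of_le le_rfl (hLχ p))

theorem tendsto_integral_integral_apply [SFinite μ] [SFinite ν] (hP : Integrable P μ)
    {L : ℕ → α → β → V} {L₀ : α → β → V}
    (hL : ∀ n, AEStronglyMeasurable (Function.uncurry (L n)) (μ.prod ν))
    (hL₀ : AEStronglyMeasurable (Function.uncurry L₀) (μ.prod ν)) (hχ : Integrable χ ν)
    (hLχ : ∀ n x z, ‖L n x z‖ ≤ χ z) (hL₀χ : ∀ x z, ‖L₀ x z‖ ≤ χ z)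
    (hlim : ∀ z, ∀ ns : ℕ → ℕ, Tendsto ns atTop atTop → ∃ ms : ℕ → ℕ,
      ∀ᵐ x ∂μ, Tendsto (fun n => L (ns (ms n)) x z) atTop (𝓝 (L₀ x z))) :
    Tendsto (fun n => ∫ x, ∫ z, P x (L n x z) ∂ν ∂μ) atTop
      (𝓝 (∫ x, ∫ z, P x (L₀ x z) ∂ν ∂μ)) := by
  have hint : ∀ n, Integrable (Function.uncurry fun x z => P x (L n x z)) (μ.prod ν) := fun n =>
    integrable_apply_prod hP (hL n) hχ fun p => hLχ n p.1 p.2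
  have hint₀ : Integrable (Function.uncurry fun x z => P x (L₀ x z)) (μ.prod ν) :=
    integrable_apply_prod hP hL₀ hχ fun p => hL₀χ p.1 p.2
  have hbound : ∀ n x z, ‖P x (L n x z)‖ ≤ ‖P x‖ * χ z := fun n x z =>
    (P x).le_of_opNorm_le_of_le le_rfl (hLχ n x z)
  rw [integral_integral_swap hint₀]
  simp only [fun n => integral_integral_swap (hint n)]
  refine tendsto_integral_of_dominated_convergence (fun z => (∫ x, ‖P x‖ ∂μ) * χ z)
    (fun n => (hint n).swap.integral_prod_left.aestronglyMeasurable) (hχ.const_mul _)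
    (fun n => ae_of_all _ fun z => ?_) ?_
  · rw [← integral_mul_const]
    exact norm_integral_le_of_norm_le (hP.norm.mul_const _) (ae_of_all _ fun x => hbound n x z)
  · have hslice : ∀ᵐ z ∂ν, ∀ n, AEStronglyMeasurable (fun x => P x (L n x z)) μ :=
      ae_all_iff.2 fun n => (hint n).swap.prod_right_ae.mono fun z hz => hz.aestronglyMeasurable
    filter_upwards [hslice] with z hz
    refine tendsto_of_subseq_tendsto fun ns hns => ?_
    obtain ⟨ms, hms⟩ := hlim z ns hns
    refine ⟨ms, tendsto_integral_of_dominated_convergence (fun x => ‖P x‖ * χ z) (fun n => hz _)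
      (hP.norm.mul_const _) (fun n => ae_of_all _ fun x => hbound _ x z) ?_⟩
    filter_upwards [hms] with x hx
    exact ((P x).continuous.tendsto _).comp hx

end ProductLimit

section BlowUp

variable {F : Type*} [NormedAddCommGroup F] [NormedSpace ℝ F] {Ω : Opens E3}
  {η : E3 → ℝ} {w : E3 → E3} {k : E3 × E3 → F}

/-- The integrand of the derivative of the graph mollification at scale `r`: the kernel sees the
graph through the difference quotients of `w`. -/
noncomputable def blowUpDeriv (η : E3 → ℝ) (w : E3 → E3) (k : E3 × E3 → F) (r : ℝ) (x z : E3) :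
    (E3 × E3) →L[ℝ] F :=
  η (x - r • z) • fderiv ℝ k (z, r⁻¹ • (w x - w (x - r • z)))

theorem fderiv_eq_zero_of_lt_norm_fst {R : ℝ} (hR : tsupport k ⊆ Metric.closedBall 0 R) {z : E3}
    (hz : R < ‖z‖) (y : E3) : fderiv ℝ k (z, y) = 0 :=
  image_eq_zero_of_notMem_tsupport fun hmem => hz.not_ge <|
    (norm_fst_le (z, y)).trans (mem_closedBall_zero_iff.1 (hR (tsupport_fderiv_subset ℝ hmem)))

theorem exists_integrable_norm_fderiv_le (hk : ContDiff ℝ (⊤ : ℕ∞) k)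
    (hkc : HasCompactSupport k) :
    ∃ χ : E3 → ℝ, Integrable χ ∧ ∀ z y, ‖fderiv ℝ k (z, y)‖ ≤ χ z := by
  obtain ⟨B, hB⟩ :=
    (hk.continuous_fderiv (by simp)).bounded_above_of_compact_support (hkc.fderiv ℝ)
  obtain ⟨R, hR⟩ := hkc.isCompact.isBounded.subset_closedBall 0
  refine ⟨(Metric.closedBall 0 R).indicator fun _ => B,
    (integrable_indicator_iff Metric.isClosed_closedBall.measurableSet).2
      (integrableOn_const measure_closedBall_lt_top.ne), fun z y => ?_⟩
  by_cases hz : ‖z‖ ≤ R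
  · rw [Set.indicator_of_mem (mem_closedBall_zero_iff.2 hz)]
    exact hB _
  · rw [fderiv_eq_zero_of_lt_norm_fst hR (not_le.1 hz), norm_zero,
      Set.indicator_of_notMem (mt mem_closedBall_zero_iff.1 hz)]

theorem exists_integrable_norm_smul_fderiv_le (hη : Continuous η) (hηc : HasCompactSupport η)
    (hk : ContDiff ℝ (⊤ : ℕ∞) k) (hkc : HasCompactSupport k) :
    ∃ χ : E3 → ℝ, Integrable χ ∧ ∀ a z y, ‖η a • fderiv ℝ k (z, y)‖ ≤ χ z := by
  obtain ⟨A, hA⟩ := hη.bounded_above_of_compact_support hηc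
  obtain ⟨χ, hχ, hχle⟩ := exists_integrable_norm_fderiv_le hk hkc
  refine ⟨fun z => A * χ z, hχ.const_mul A, fun a z y => ?_⟩
  rw [norm_smul]
  exact mul_le_mul (hA a) (hχle z y) (norm_nonneg _) ((norm_nonneg _).trans (hA a))

theorem stronglyMeasurable_blowUpDeriv (hη : Continuous η) (hw : Measurable w)
    (hk : ContDiff ℝ (⊤ : ℕ∞) k) (r : ℝ) :
    StronglyMeasurable (Function.uncurry (blowUpDeriv η w k r)) := by
  have hquot : Measurable fun p : E3 × E3 => (p.2, r⁻¹ • (w p.1 - w (p.1 - r • p.2))) := by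
    fun_prop
  have hηr : Continuous fun p : E3 × E3 => η (p.1 - r • p.2) := by fun_prop
  exact hηr.stronglyMeasurable.smul
    ((hk.continuous_fderiv (by simp)).comp_stronglyMeasurable hquot.stronglyMeasurable)

theorem tendsto_blowUpDeriv (hη : Continuous η) (hk : ContDiff ℝ (⊤ : ℕ∞) k) {ι : Type*}
    {l : Filter ι} {r : ι → ℝ} (hr : Tendsto r l (𝓝 0)) {x z y : E3}
    (hy : Tendsto (fun n => (r n)⁻¹ • (w x - w (x - r n • z))) l (𝓝 y)) :
    Tendsto (fun n => blowUpDeriv η w k (r n) x z) l (𝓝 (η x • fderiv ℝ k (z, y))) := by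
  have hηr : Tendsto (fun s : ℝ => η (x - s • z)) (𝓝 0) (𝓝 (η x)) :=
    (by fun_prop : Continuous fun s : ℝ => η (x - s • z)).tendsto' 0 _ (by simp)
  exact (hηr.comp hr).smul (((hk.continuous_fderiv (by simp)).tendsto _).comp
    (tendsto_const_nhds.prodMk_nhds hy))

theorem norm_le_of_scaleKernel_ne_zero {r R δ : ℝ} (hR : tsupport k ⊆ Metric.closedBall 0 R)
    (hr : 0 < r) (hrR : r * R ≤ δ) {q : E3 × E3} (hq : scaleKernel r k q ≠ 0) : ‖q‖ ≤ δ := by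
  have hkq : k (r⁻¹ • q) ≠ 0 := fun h => hq (by simp [scaleKernel, h])
  have hle := mem_closedBall_zero_iff.1 (hR (subset_tsupport _ hkq))
  rw [norm_smul, norm_inv, Real.norm_of_nonneg hr.le, inv_mul_le_iff₀ hr] at hle
  exact hle.trans hrR

theorem exists_testFunction_eq_graphMollify (hη : Continuous η) (hηc : HasCompactSupport η)
    {δ : ℝ} (hδΩ : Metric.cthickening δ (tsupport η) ⊆ Ω) (hw : Measurable w) {B : ℝ}
    (hwB : ∀ a, ‖w a‖ ≤ B) (hk : ContDiff ℝ (⊤ : ℕ∞) k) (hkc : HasCompactSupport k)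
    (hkδ : ∀ q, k q ≠ 0 → ‖q‖ ≤ δ) : ∃ f : 𝓓(cyl Ω, F), ⇑f = graphMollify η w k := by
  set S := Metric.cthickening δ (tsupport η) ×ˢ Metric.closedBall (0 : E3) (B + δ)
  have hS : IsCompact S := hηc.isCompact.cthickening.prod (isCompact_closedBall _ _)
  have hsupp : Function.support (graphMollify η w k) ⊆ S := fun p hp =>
    of_not_not fun hpS => hp (graphMollify_eq_zero_of_notMem hwB hkδ hpS)
  exact ⟨⟨graphMollify η w k, contDiff_graphMollify hη hηc hw hk hkc,
    .of_support_subset_isCompact hS hsupp,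
    (closure_minimal hsupp hS.isClosed).trans fun p hp => ⟨hδΩ hp.1, Set.mem_univ _⟩⟩, rfl⟩

theorem fderiv_graphMollify_eq_integral_blowUpDeriv (hη : Continuous η)
    (hηc : HasCompactSupport η) (hw : Measurable w) (hk : ContDiff ℝ (⊤ : ℕ∞) k)
    (hkc : HasCompactSupport k) {R r δ : ℝ} (hR : tsupport k ⊆ Metric.closedBall 0 R) (hr : 0 < r)
    (hrR : r * R ≤ δ) {x y : E3} (hxy : x ∈ Metric.cthickening δ (tsupport η) → w x = y) :
    fderiv ℝ (graphMollify η w (scaleKernel r k)) (x, y) = ∫ z, blowUpDeriv η w k r x z := by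
  rw [fderiv_graphMollify_scaleKernel hη hηc hw hk hkc hr]
  refine integral_congr_ae (ae_of_all _ fun z => ?_)
  change η (x - r • z) • fderiv ℝ k (z, r⁻¹ • (y - w (x - r • z))) = blowUpDeriv η w k r x z
  rcases lt_or_ge R ‖z‖ with hz | hz
  · simp only [blowUpDeriv, fderiv_eq_zero_of_lt_norm_fst hR hz]
  · by_cases hηz : η (x - r • z) = 0
    · simp only [blowUpDeriv, hηz, zero_smul]
    · rw [blowUpDeriv, hxy]
      refine Metric.mem_cthickening_of_dist_le x (x - r • z) δ _ (subset_tsupport _ hηz) ?_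
      rw [dist_eq_norm, sub_sub_cancel, norm_smul, Real.norm_of_nonneg hr.le]
      exact (mul_le_mul_of_nonneg_left hz hr.le).trans hrR

theorem W12.exists_measurable_cut {u : W12 Ω} {M : ℝ}
    (hM : ∀ᵐ x ∂(volume.restrict (Ω : Set E3)), ‖u.val x‖ ≤ M) {ζ : 𝓓(Ω, ℝ)}
    (hζ : ∀ x, ζ x ∈ Set.Icc (0 : ℝ) 1) :
    ∃ w : E3 → E3, Measurable w ∧ (∀ a, ‖w a‖ ≤ |M|) ∧ ∀ᵐ x, ∀ i, w x i = u.cut ζ i x := by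
  set c : E3 → E3 := fun x => WithLp.toLp 2 fun i => u.cut ζ i x
  have hc : AEMeasurable c :=
    (PiLp.continuous_toLp 2 fun _ : Fin 3 => ℝ).measurable.comp_aemeasurable
      (aemeasurable_pi_lambda _ fun i => (u.memLp_cut ζ i).1.aemeasurable)
  have hcM : ∀ᵐ x, c x ∈ Metric.closedBall 0 |M| := by
    rw [ae_restrict_iff' Ω.isOpen.measurableSet] at hM
    filter_upwards [hM] with x hx
    have hcx : c x = ζ x • u.val x := rfl
    rw [mem_closedBall_zero_iff, hcx, norm_smul, Real.norm_of_nonneg (hζ x).1]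
    by_cases hxΩ : x ∈ (Ω : Set E3)
    · exact (mul_le_of_le_one_left (norm_nonneg _) (hζ x).2).trans
        ((hx hxΩ).trans (le_abs_self M))
    · simp [Function.notMem_support.1 fun h => hxΩ (support_testFunction_subset ζ h)]
  obtain ⟨w, hw, hwM, hcw⟩ := hc.exists_ae_eq_range_subset hcM ⟨0, by simp⟩
  refine ⟨w, hw, fun a => mem_closedBall_zero_iff.1 (hwM ⟨a, rfl⟩), ?_⟩
  filter_upwards [hcw] with x hx i
  rw [← hx]

theorem W12.aestronglyMeasurable_matCLM_grad (u : W12 Ω) :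
    AEStronglyMeasurable (fun p : E3 × E3 => matCLM (u.grad p.1) p.2)
      ((volume.restrict (Ω : Set E3)).prod volume) := by
  have hmat : ∀ p : E3 × E3, matCLM (u.grad p.1) p.2
      = WithLp.toLp 2 fun i => ∑ j, u.grad p.1 i j * p.2 j := fun p => by
    ext i
    rw [matCLM_apply]
  simp only [hmat]
  refine (PiLp.continuous_toLp 2 fun _ : Fin 3 => ℝ).comp_aestronglyMeasurable
    (aemeasurable_pi_lambda _ fun i => ?_).aestronglyMeasurable
  exact Finset.aemeasurable_fun_sum _ fun j _ => (u.memLp_grad i j).1.comp_fst.aemeasurable.mul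
    (by fun_prop : Continuous fun p : E3 × E3 => p.2 j).aemeasurable

theorem W12.cutDeriv_of_eventuallyEq_one (u : W12 Ω) {ζ : 𝓓(Ω, ℝ)} {x : E3}
    (hζ : ζ =ᶠ[𝓝 x] fun _ => 1) (i : Fin 3) (z : E3) :
    u.cutDeriv ζ i z x = matCLM (u.grad x) z i := by
  simp [W12.cutDeriv, W12.cutPartial, hζ.fderiv_eq, hζ.eq_of_nhds, matCLM_apply, mul_comm]

theorem W12.exists_subseq_tendsto_difference_quotient (u : W12 Ω) (ζ : 𝓓(Ω, ℝ))
    (hw : Measurable w) (hwcut : ∀ᵐ x, ∀ i, w x i = u.cut ζ i x) {r : ℕ → ℝ}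
    (hr : Tendsto r atTop (𝓝[≠] 0)) (z : E3) :
    ∃ φ : ℕ → ℕ, StrictMono φ ∧ ∀ᵐ x,
      Tendsto (fun n => (r (φ n))⁻¹ • (w x - w (x - r (φ n) • z))) atTop
        (𝓝 (WithLp.toLp 2 fun i => u.cutDeriv ζ i z x)) := by
  have hwi : ∀ i, (fun x => w x i) =ᵐ[volume] u.cut ζ i := fun i => hwcut.mono fun x hx => hx i
  have hweak : ∀ i, HasWeakDeriv volume (fun x => w x i) (u.cutDeriv ζ i z) z :=
    fun i φ hφ hφc => by
      rw [← u.hasWeakDeriv_cut ζ i z φ hφ hφc]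
      exact integral_congr_ae ((hwi i).mono fun x hx => by simp only [hx])
  refine exists_subseq_tendsto_ae_of_components (p := 2) one_le_two
    (v := fun n x => (r n)⁻¹ • (w x - w (x - r n • z))) (fun n i => ?_) fun i =>
      (tendsto_eLpNorm_difference_quotient ((u.memLp_cut ζ i).ae_eq (hwi i).symm)
        (u.memLp_cutDeriv ζ i z) (hweak i)).comp hr
  have hquot : Measurable fun x => ((r n)⁻¹ • (w x - w (x - r n • z))) i := by fun_prop
  exact hquot.aestronglyMeasurable.sub (u.memLp_cutDeriv ζ i z).1

set_option maxSynthPendingDepth 3 in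
theorem W12.tendsto_integral_apply_blowUpDeriv (u : W12 Ω) {ζ : 𝓓(Ω, ℝ)} (hw : Measurable w)
    (hwcut : ∀ᵐ x, ∀ i, w x i = u.cut ζ i x) (hη : Continuous η) (hηc : HasCompactSupport η)
    (hζη : ∀ x ∈ tsupport η, ζ =ᶠ[𝓝 x] fun _ => 1) (hk : ContDiff ℝ (⊤ : ℕ∞) k)
    (hkc : HasCompactSupport k) {P : E3 → ((E3 × E3) →L[ℝ] F) →L[ℝ] ℝ}
    (hP : Integrable P (volume.restrict (Ω : Set E3))) {r : ℕ → ℝ}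
    (hr : Tendsto r atTop (𝓝[≠] 0)) :
    Tendsto (fun n => ∫ x in (Ω : Set E3), ∫ z, P x (blowUpDeriv η w k (r n) x z)) atTop
      (𝓝 (∫ x in (Ω : Set E3), ∫ z, P x (η x • fderiv ℝ k (z, matCLM (u.grad x) z)))) := by
  obtain ⟨χ, hχ, hχle⟩ := exists_integrable_norm_smul_fderiv_le hη hηc hk hkc
  refine tendsto_integral_integral_apply hP
    (fun n => (stronglyMeasurable_blowUpDeriv hη hw hk (r n)).aestronglyMeasurable)
    ((hη.comp continuous_fst).aestronglyMeasurable.smul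
      ((hk.continuous_fderiv (by simp)).comp_aestronglyMeasurable
        (continuous_snd.aestronglyMeasurable.prodMk u.aestronglyMeasurable_matCLM_grad)))
    hχ (fun n x z => hχle _ z _) (fun x z => hχle _ z _) fun z ns hns => ?_
  obtain ⟨φ, hφ, hlim⟩ :=
    u.exists_subseq_tendsto_difference_quotient ζ hw hwcut (hr.comp hns) z
  refine ⟨φ, (ae_restrict_of_ae hlim).mono fun x hx => ?_⟩
  have hlimx := tendsto_blowUpDeriv hη hk
    ((tendsto_nhdsWithin_iff.1 hr).1.comp (hns.comp hφ.tendsto_atTop)) hx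
  by_cases hηx : η x = 0
  · simp only [hηx, zero_smul] at hlimx ⊢
    exact hlimx
  · simp only [u.cutDeriv_of_eventuallyEq_one (hζη x (subset_tsupport η hηx))] at hlimx
    exact hlimx

set_option maxSynthPendingDepth 3 in
theorem W12.abs_integral_apply_blowUpDeriv_le [CompleteSpace F] (u : W12 Ω)
    {P : E3 → ((E3 × E3) →L[ℝ] F) →L[ℝ] ℝ} {D : ℝ} {f : 𝓓(cyl Ω, F)} {r R δ : ℝ}
    (hf : ⇑f = graphMollify η w (scaleKernel r k))
    (hD : |∫ x in (Ω : Set E3), P x (fderiv ℝ f (x, u.val x))| ≤ D)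
    (hη : Continuous η) (hηc : HasCompactSupport η) (hw : Measurable w)
    (hwu : ∀ᵐ x, x ∈ Metric.cthickening δ (tsupport η) → w x = u.val x)
    (hk : ContDiff ℝ (⊤ : ℕ∞) k) (hkc : HasCompactSupport k)
    (hR : tsupport k ⊆ Metric.closedBall 0 R) (hr : 0 < r) (hrR : r * R ≤ δ) :
    |∫ x in (Ω : Set E3), ∫ z, P x (blowUpDeriv η w k r x z)| ≤ D := by
  obtain ⟨χ, hχ, hχle⟩ := exists_integrable_norm_smul_fderiv_le hη hηc hk hkc
  have hint : ∀ x, Integrable (blowUpDeriv η w k r x) := fun x =>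
    hχ.mono' ((stronglyMeasurable_blowUpDeriv hη hw hk r).comp_measurable
      measurable_prodMk_left).aestronglyMeasurable (ae_of_all _ fun z => hχle _ z _)
  convert hD using 2
  refine integral_congr_ae ((ae_restrict_of_ae hwu).mono fun x hx => ?_)
  simp only [hf, fderiv_graphMollify_eq_integral_blowUpDeriv hη hηc hw hk hkc hR hr hrR hx]
  exact (P x).integral_comp_comm (hint x)

set_option maxSynthPendingDepth 3 in
/-- Test fields of size `O(r)` concentrated near the graph at scale `r` have derivatives of order
one there, so for a bounded functional the blow-up limit vanishes. -/
theorem W12.integral_integral_smul_fderiv_eq_zero [CompleteSpace F] (u : W12 Ω) {M : ℝ}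
    (hM : ∀ᵐ x ∂(volume.restrict (Ω : Set E3)), ‖u.val x‖ ≤ M)
    {P : E3 → ((E3 × E3) →L[ℝ] F) →L[ℝ] ℝ} (hP : Integrable P (volume.restrict (Ω : Set E3)))
    {C : ℝ} (hbound : ∀ (f : 𝓓(cyl Ω, F)) (B : ℝ), 0 < B → (∀ p, ‖f p‖ ≤ B) →
      |∫ x in (Ω : Set E3), P x (fderiv ℝ f (x, u.val x))| ≤ C * B)
    (hk : ContDiff ℝ (⊤ : ℕ∞) k) (hkc : HasCompactSupport k) (η : 𝓓(Ω, ℝ)) :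
    ∫ x in (Ω : Set E3), ∫ z, P x (η x • fderiv ℝ k (z, matCLM (u.grad x) z)) = 0 := by
  have hη := η.continuous
  have hηc := η.hasCompactSupport
  obtain ⟨δ, hδ, hδΩ⟩ := hηc.isCompact.exists_cthickening_subset_open Ω.isOpen η.tsupport_subset
  obtain ⟨ζ, hζ_one, hζ_mem⟩ := exists_testFunction_eq_one (hηc.isCompact.cthickening (r := δ)) hδΩ
  obtain ⟨w, hw, hwM, hwcut⟩ := u.exists_measurable_cut hM hζ_mem
  have hwu : ∀ᵐ x, x ∈ Metric.cthickening δ (tsupport η) → w x = u.val x :=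
    hwcut.mono fun x hx hmem => by
      ext i
      rw [hx i, W12.cut, hζ_one x hmem, one_mul]
  have hζη : ∀ x ∈ tsupport η, ζ =ᶠ[𝓝 x] fun _ => 1 := fun x hx =>
    mem_of_superset (mem_nhdsSet_iff_forall.1 (Metric.cthickening_mem_nhdsSet _ hδ) x hx) hζ_one
  obtain ⟨R, hR⟩ := hkc.isCompact.isBounded.subset_closedBall 0
  obtain ⟨K, hK, hKr⟩ := exists_norm_graphMollify_scaleKernel_le hη hηc w hk.continuous hkc
  set r : ℕ → ℝ := fun n => 1 / ((n : ℝ) + 1)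
  have hr_pos : ∀ n, 0 < r n := fun n => by positivity
  have hr : Tendsto r atTop (𝓝 0) := tendsto_one_div_add_atTop_nhds_zero_nat
  have hrR : ∀ᶠ n in atTop, r n * R ≤ δ :=
    (by simpa using hr.mul_const R : Tendsto (fun n => r n * R) atTop (𝓝 0)).eventually_le_const hδ
  refine tendsto_nhds_unique (u.tendsto_integral_apply_blowUpDeriv hw hwcut hη hηc hζη hk hkc hP
    (tendsto_nhdsWithin_iff.2 ⟨hr, .of_forall fun n => (hr_pos n).ne'⟩)) ?_
  refine squeeze_zero_norm' (hrR.mono fun n hn => ?_)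
    (by simpa using (hr.const_mul (K + 1)).const_mul C :
      Tendsto (fun n => C * ((K + 1) * r n)) atTop (𝓝 0))
  obtain ⟨f, hf⟩ := exists_testFunction_eq_graphMollify hη hηc hδΩ hw hwM
    (contDiff_scaleKernel hk) (hasCompactSupport_scaleKernel (hr_pos n) hkc)
    fun q => norm_le_of_scaleKernel_ne_zero hR (hr_pos n) hn
  refine u.abs_integral_apply_blowUpDeriv_le hf (hbound f _ ?_ fun p => ?_) hη hηc hw hwu hk hkc
    hR (hr_pos n) hn
  · exact mul_pos (by positivity) (hr_pos n)
  · rw [hf]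
    exact (hKr _ (hr_pos n) p).trans (mul_le_mul_of_nonneg_right (by linarith) (hr_pos n).le)

end BlowUp

section IdentificationOfTheDeterminant

variable {φ χ : E3 → ℝ}

/-- The test kernel `(z, y) ↦ φ(z) χ(y) y`; where `χ = 1` it is linear in `y` with divergence
`3 φ(z)` in that variable. -/
noncomputable def linearKernel (φ χ : E3 → ℝ) (p : E3 × E3) : E3 := (φ p.1 * χ p.2) • p.2

theorem contDiff_linearKernel (hφ : ContDiff ℝ (⊤ : ℕ∞) φ) (hχ : ContDiff ℝ (⊤ : ℕ∞) χ) :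
    ContDiff ℝ (⊤ : ℕ∞) (linearKernel φ χ) :=
  ((hφ.comp contDiff_fst).mul (hχ.comp contDiff_snd)).smul contDiff_snd

theorem hasCompactSupport_linearKernel (hφ : HasCompactSupport φ) (hχ : HasCompactSupport χ) :
    HasCompactSupport (linearKernel φ χ) :=
  .intro (hφ.isCompact.prod hχ.isCompact) fun p hp => by
    rcases not_and_or.1 hp with h | h <;>
      simp [linearKernel, image_eq_zero_of_notMem_tsupport h]

theorem fderiv_linearKernel_snd (hφ : ContDiff ℝ (⊤ : ℕ∞) φ) (hχ : ContDiff ℝ (⊤ : ℕ∞) χ)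
    {z y : E3} (h : φ z ≠ 0 → χ =ᶠ[𝓝 y] fun _ => 1) (v : E3) :
    fderiv ℝ (linearKernel φ χ) (z, y) (0, v) = φ z • v := by
  have hpartial : HasFDerivAt (fun y' => linearKernel φ χ (z, y'))
      ((fderiv ℝ (linearKernel φ χ) (z, y)).comp (.inr ℝ E3 E3)) y :=
    ((contDiff_linearKernel hφ hχ).differentiable (by simp) _).hasFDerivAt.comp y
      (hasFDerivAt_prodMk_right z y)
  have hlinear : (fun y' => linearKernel φ χ (z, y')) =ᶠ[𝓝 y] fun y' => φ z • y' := by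
    by_cases hz : φ z = 0
    · exact .of_forall fun y' => by simp [linearKernel, hz]
    · filter_upwards [h hz] with y' hy'
      simp [linearKernel, hy']
  have hv := DFunLike.congr_fun (hpartial.unique
    (((hasFDerivAt_id y).const_smul (φ z)).congr_of_eventuallyEq hlinear)) v
  simpa using hv

theorem exists_kernel_integral_divergence_pos (m : ℕ) :
    ∃ k : E3 × E3 → E3, ContDiff ℝ (⊤ : ℕ∞) k ∧ HasCompactSupport k ∧
      ∀ L : E3 →L[ℝ] E3, ‖L‖ ≤ m → 0 < ∫ z, ∑ i, (fderiv ℝ k (z, L z) (0, e i)) i := by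
  let φ : ContDiffBump (0 : E3) :=
    ⟨1 / (m + 1) / 2, 1 / (m + 1), by positivity, half_lt_self (by positivity)⟩
  let χ : ContDiffBump (0 : E3) := ⟨1, 2, one_pos, one_lt_two⟩
  refine ⟨linearKernel φ χ, contDiff_linearKernel φ.contDiff χ.contDiff,
    hasCompactSupport_linearKernel φ.hasCompactSupport χ.hasCompactSupport, fun L hL => ?_⟩
  have hχ : ∀ z, φ z ≠ 0 → χ =ᶠ[𝓝 (L z)] fun _ => 1 := fun z hz => by
    have hz' : ‖z‖ < 1 / (m + 1) := mem_ball_zero_iff.1 (φ.support_eq ▸ hz : z ∈ Metric.ball 0 _)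
    refine χ.eventuallyEq_one_of_mem_ball (mem_ball_zero_iff.2 ?_)
    calc ‖L z‖ ≤ m * (1 / (m + 1)) := L.le_of_opNorm_le_of_le hL hz'.le
      _ < 1 := by rw [mul_one_div, div_lt_one (by positivity)]; linarith
  have hdiv : ∀ z, ∑ i, (fderiv ℝ (linearKernel φ χ) (z, L z) (0, e i)) i = 3 * φ z := fun z => by
    simp [fderiv_linearKernel_snd φ.contDiff χ.contDiff (hχ z), e]
  simp only [hdiv, integral_const_mul]
  exact mul_pos three_pos φ.integral_pos

variable {Ω : Opens E3}

set_option maxSynthPendingDepth 3 in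
theorem W12.ae_integral_apply_fderiv_eq_zero {F : Type*} [NormedAddCommGroup F] [NormedSpace ℝ F]
    [CompleteSpace F] (u : W12 Ω) {M : ℝ}
    (hM : ∀ᵐ x ∂(volume.restrict (Ω : Set E3)), ‖u.val x‖ ≤ M)
    {P : E3 → ((E3 × E3) →L[ℝ] F) →L[ℝ] ℝ} (hP : Integrable P (volume.restrict (Ω : Set E3)))
    {C : ℝ} (hbound : ∀ (f : 𝓓(cyl Ω, F)) (B : ℝ), 0 < B → (∀ p, ‖f p‖ ≤ B) →
      |∫ x in (Ω : Set E3), P x (fderiv ℝ f (x, u.val x))| ≤ C * B)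
    {k : E3 × E3 → F} (hk : ContDiff ℝ (⊤ : ℕ∞) k) (hkc : HasCompactSupport k) :
    ∀ᵐ x ∂(volume.restrict (Ω : Set E3)),
      ∫ z, P x (fderiv ℝ k (z, matCLM (u.grad x) z)) = 0 := by
  obtain ⟨χ, hχ, hχle⟩ := exists_integrable_norm_fderiv_le hk hkc
  have hint : IntegrableOn (fun x => ∫ z, P x (fderiv ℝ k (z, matCLM (u.grad x) z))) Ω :=
    (integrable_apply_prod hP ((hk.continuous_fderiv (by simp)).comp_aestronglyMeasurable
      (continuous_snd.aestronglyMeasurable.prodMk u.aestronglyMeasurable_matCLM_grad)) hχ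
      fun p => hχle p.2 _).integral_prod_left
  rw [ae_restrict_iff' Ω.isOpen.measurableSet]
  refine Ω.isOpen.ae_eq_zero_of_integral_contDiff_smul_eq_zero hint.locallyIntegrableOn
    fun η hη hηc hηΩ => ?_
  have hzero := u.integral_integral_smul_fderiv_eq_zero hM hP hbound hk hkc ⟨η, hη, hηc, hηΩ⟩
  rw [← setIntegral_eq_integral_of_forall_compl_eq_zero (s := (Ω : Set E3)) fun x hx => by
    rw [image_eq_zero_of_notMem_tsupport (mt (@hηΩ x) hx), zero_smul]]
  simp only [map_smul, integral_smul] at hzero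
  exact hzero

theorem W12.ae_eq_det_of_bounded_pairing (u : W12 Ω) {M : ℝ}
    (hM : ∀ᵐ x ∂(volume.restrict (Ω : Set E3)), ‖u.val x‖ ≤ M) {θ : E3 → ℝ}
    (hθ : Integrable θ (volume.restrict (Ω : Set E3))) {C : ℝ}
    (hbound : ∀ (f : 𝓓(cyl Ω, E3)) (B : ℝ), 0 < B → (∀ p, ‖f p‖ ≤ B) →
      |∫ x in (Ω : Set E3), pairing (cof (u.grad x)) (θ x) (fderiv ℝ f (x, u.val x))| ≤ C * B) :
    ∀ᵐ x ∂(volume.restrict (Ω : Set E3)), θ x = (u.grad x).det := by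
  choose k hk hkc hk_pos using exists_kernel_integral_divergence_pos
  filter_upwards [ae_all_iff.2 fun m => u.ae_integral_apply_fderiv_eq_zero hM
    (integrable_pairing u.integrable_cof hθ) hbound (hk m) (hkc m)] with x hx
  obtain ⟨m, hm⟩ := exists_nat_ge ‖matCLM (u.grad x)‖
  have hprod := hx m
  rw [integral_pairing_cof_fderiv_linear_graph ((hk m).of_le (by simp)) (hkc m)] at hprod
  exact sub_eq_zero.1 ((mul_eq_zero.1 hprod).resolve_right (hk_pos m _ hm).ne')

end IdentificationOfTheDeterminant

section GraphLimit

theorem tendsto_integral_sum_mul_comp_graph {X Y ι : Type*} [TopologicalSpace X]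
    [PseudoMetrizableSpace X] [SecondCountableTopology X] [MeasurableSpace X]
    [OpensMeasurableSpace X] [TopologicalSpace Y] [Fintype ι] {μ : Measure X} [IsFiniteMeasure μ]
    {f : ℕ → X → ι → ℝ} {f₀ : X → ι → ℝ} (hf : ∀ n a, Integrable (fun x => f n x a) μ)
    (hf₀ : ∀ a, Integrable (fun x => f₀ x a) μ)
    (hw : ∀ a, TendstoWeakly μ ∞ (fun n x => f n x a) fun x => f₀ x a)
    {v : ℕ → X → Y} {v₀ : X → Y} (hv : ∀ n, AEStronglyMeasurable (v n) μ)
    (hv₀ : AEStronglyMeasurable v₀ μ)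
    (hconv : ∀ᵐ x ∂μ, Tendsto (fun n => v n x) atTop (𝓝 (v₀ x)))
    {b : ι → X × Y → ℝ} (hb : ∀ a, Continuous (b a)) (hbc : ∀ a, HasCompactSupport (b a)) :
    Tendsto (fun n => ∫ x, ∑ a, f n x a * b a (x, v n x) ∂μ) atTop
      (𝓝 (∫ x, ∑ a, f₀ x a * b a (x, v₀ x) ∂μ)) := by
  choose B hB using fun a => (hbc a).exists_bound_of_continuous (hb a)
  have hbm : ∀ {y : X → Y}, AEStronglyMeasurable y μ → ∀ a,
      AEStronglyMeasurable (fun x => b a (x, y x)) μ := fun hy a =>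
    (hb a).comp_aestronglyMeasurable (continuous_id.aestronglyMeasurable.prodMk hy)
  have hint : ∀ {y : X → Y}, AEStronglyMeasurable y μ → ∀ {h : X → ℝ}, Integrable h μ → ∀ a,
      Integrable (fun x => h x * b a (x, y x)) μ := fun hy _ hh a =>
    hh.mul_bdd (hbm hy a) (Eventually.of_forall fun _ => hB a _)
  simp only [fun n => integral_finsetSum (μ := μ) Finset.univ fun a _ => hint (hv n) (hf n a) a,
    integral_finsetSum (μ := μ) Finset.univ fun a _ => hint hv₀ (hf₀ a) a]
  refine tendsto_finsetSum _ fun a _ => ?_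
  refine (hw a).tendsto_integral_mul (fun n => hf n a) (hf₀ a) (fun n => hbm (hv n) a)
    (fun n => Eventually.of_forall fun x => hB a _) ?_
  filter_upwards [hconv] with x hx
  exact ((hb a).tendsto _).comp (tendsto_const_nhds.prodMk_nhds hx)

end GraphLimit

section EnergyBounds

variable {Ω : Opens E3}

theorem W12.eLpNorm_grad_le {H : ℝ → ℝ} (hH : ∀ t, 0 < t → 0 ≤ H t) {w : W12 Ω}
    (hw : ∀ᵐ x ∂(volume.restrict (Ω : Set E3)), 0 < (w.grad x).det) (i j : Fin 3) :
    eLpNorm (fun x => w.grad x i j) 2 (volume.restrict (Ω : Set E3))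
      ≤ energy H w ^ (1 / (2 : ℝ)) := by
  rw [eLpNorm_eq_lintegral_rpow_enorm_toReal two_ne_zero ENNReal.ofNat_ne_top]
  simp only [ENNReal.toReal_ofNat]
  refine ENNReal.rpow_le_rpow (lintegral_mono_ae ?_) (by norm_num)
  filter_upwards [hw] with x hx
  have hentry : (w.grad x i j) ^ 2 ≤ ∑ i, ∑ j, (w.grad x i j) ^ 2 :=
    (Finset.single_le_sum (f := fun j => (w.grad x i j) ^ 2) (fun j _ => sq_nonneg _)
      (Finset.mem_univ j)).trans
      (Finset.single_le_sum (f := fun i => ∑ j, (w.grad x i j) ^ 2)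
        (fun i _ => Finset.sum_nonneg fun j _ => sq_nonneg _) (Finset.mem_univ i))
  rw [ENNReal.rpow_ofNat, Real.enorm_eq_ofReal_abs, ← ENNReal.ofReal_pow (abs_nonneg _), sq_abs]
  exact ENNReal.ofReal_le_ofReal (hentry.trans (le_add_of_nonneg_right (hH _ hx)))

theorem W12.aestronglyMeasurable_det (w : W12 Ω) :
    AEStronglyMeasurable (fun x => (w.grad x).det) (volume.restrict (Ω : Set E3)) := by
  have hgrad : ∀ i j, AEMeasurable (fun x => w.grad x i j) (volume.restrict (Ω : Set E3)) :=
    fun i j => (w.memLp_grad i j).1.aemeasurable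
  simp only [Matrix.det_fin_three]
  exact AEMeasurable.aestronglyMeasurable (by fun_prop)

theorem lintegral_ofReal_abs_det_le_energy (H : ℝ → ℝ) {w : W12 Ω}
    (hw : ∀ᵐ x ∂(volume.restrict (Ω : Set E3)), 0 < (w.grad x).det) :
    ∫⁻ x in (Ω : Set E3), ENNReal.ofReal (H |(w.grad x).det|) ≤ energy H w := by
  refine lintegral_mono_ae ?_
  filter_upwards [hw] with x hx
  rw [abs_of_pos hx]
  exact ENNReal.ofReal_le_ofReal (le_add_of_nonneg_left
    (Finset.sum_nonneg fun i _ => Finset.sum_nonneg fun j _ => sq_nonneg _))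

theorem uniformIntegrable_det [IsFiniteMeasure (volume.restrict (Ω : Set E3))] {ι : Type*}
    {H : ℝ → ℝ} (hH : Tendsto (fun t => H t / t) atTop atTop) {w : ι → W12 Ω}
    (hw : ∀ i, ∀ᵐ x ∂(volume.restrict (Ω : Set E3)), 0 < ((w i).grad x).det) {B : ℝ≥0∞}
    (hB : B ≠ ⊤) (hE : ∀ i, energy H (w i) ≤ B) :
    UniformIntegrable (fun i x => ((w i).grad x).det) 1 (volume.restrict (Ω : Set E3)) :=
  uniformIntegrable_of_superlinear hH (fun i => (w i).aestronglyMeasurable_det) hB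
    fun i => (lintegral_ofReal_abs_det_le_energy H (hw i)).trans (hE i)

end EnergyBounds

section SurfaceEnergy

variable {Ω : Opens E3} {w : W12 Ω} {C : NNReal}

theorem surfacePairing_smul (w : W12 Ω) (c : ℝ) (f : 𝓓(cyl Ω, E3)) :
    surfacePairing w (c • f) = c * surfacePairing w f := by
  have hfderiv : ∀ p, fderiv ℝ (⇑(c • f)) p = c • fderiv ℝ f p := fun p => by
    rw [FunLike.coe_smul]
    exact fderiv_const_smul (f.contDiff.differentiable (by simp) _) c
  simp only [surfacePairing_eq_integral_pairing, hfderiv, map_smul, smul_eq_mul,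
    integral_const_mul]

theorem surfacePairing_le_of_norm_le_one (hw : surfaceEnergy w ≤ C) {f : 𝓓(cyl Ω, E3)}
    (hf : ∀ p, ‖f p‖ ≤ 1) : surfacePairing w f ≤ C := by
  have hle : ENNReal.ofReal (surfacePairing w f) ≤ surfaceEnergy w :=
    le_iSup₂ (f := fun (f : 𝓓(cyl Ω, E3)) (_ : ∀ z, ‖f z‖ ≤ 1) =>
      ENNReal.ofReal (surfacePairing w f)) f hf
  rw [← ENNReal.ofReal_le_ofReal_iff C.coe_nonneg, ENNReal.ofReal_coe_nnreal]
  exact hle.trans hw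

theorem abs_surfacePairing_le (hw : surfaceEnergy w ≤ C) (f : 𝓓(cyl Ω, E3)) {B : ℝ} (hB : 0 < B)
    (hf : ∀ p, ‖f p‖ ≤ B) : |surfacePairing w f| ≤ C * B := by
  have hscale : ∀ c : ℝ, |c| = B⁻¹ → c * surfacePairing w f ≤ C := fun c hc => by
    rw [← surfacePairing_smul]
    refine surfacePairing_le_of_norm_le_one hw fun p => ?_
    rw [FunLike.coe_smul, Pi.smul_apply, norm_smul, Real.norm_eq_abs, hc, inv_mul_le_one₀ hB]
    exact hf p
  have habs : |B⁻¹| = B⁻¹ := abs_of_pos (inv_pos.2 hB)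
  have hupper := hscale B⁻¹ habs
  have hlower := hscale (-B⁻¹) (by rw [abs_neg, habs])
  rw [neg_mul, ← mul_neg] at hlower
  rw [inv_mul_le_iff₀ hB, mul_comm] at hupper hlower
  exact abs_le'.2 ⟨hupper, hlower⟩

end SurfaceEnergy

section AlternatingForms

variable {R V : Type*} [CommRing R] [AddCommGroup V] [Module R V]

theorem alternatingMap_sum_smul_eq_det_mul {ι : Type*} [Fintype ι] [DecidableEq ι]
    (ω : V [⋀^ι]→ₗ[R] R) (A : Matrix ι ι R) (b : ι → V) :
    ω (fun k => ∑ i, A i k • b i) = A.det * ω b := by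
  have hbasis := DFunLike.congr_fun ((ω.compLinearMap
    (Fintype.linearCombination R b)).eq_smul_basis_det (Pi.basisFun R ι)) fun k i => A i k
  rw [AlternatingMap.smul_apply, Pi.basisFun_det_apply, smul_eq_mul, mul_comm] at hbasis
  have hdet : (Matrix.of fun k i => A i k).det = A.det := A.det_transpose
  simpa [Function.comp_def, Fintype.linearCombination_apply, hdet] using hbasis

theorem fin_three_cyclic_add : (1 : Fin 3) + 1 = 2 ∧ (1 : Fin 3) + 2 = 0 ∧ (2 : Fin 3) + 1 = 0 ∧
    (2 : Fin 3) + 2 = 1 :=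
  ⟨rfl, rfl, rfl, rfl⟩

theorem alternatingMap_vec_three_rotate (ω : V [⋀^Fin 3]→ₗ[R] R) (x y z : V) :
    ω ![y, z, x] = ω ![x, y, z] := by
  have hperm := ω.map_perm ![x, y, z] (finRotate 3)
  have hcomp : ![x, y, z] ∘ finRotate 3 = ![y, z, x] := by
    funext k
    fin_cases k <;> rfl
  rwa [hcomp, sign_finRotate, neg_one_sq, one_smul] at hperm

theorem alternatingMap_three_add (ω : V [⋀^Fin 3]→ₗ[R] R) (a c : Fin 3 → V) :
    ω (fun k => a k + c k) = ω a + ∑ j, ω ![c j, a (j + 1), a (j + 2)]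
      + ∑ j, ω ![a j, c (j + 1), c (j + 2)] + ω c := by
  have hvec : ∀ v : Fin 3 → V, ω v = ω ![v 0, v 1, v 2] := fun v =>
    congrArg ω (by funext k; fin_cases k <;> rfl)
  have hsnd : ∀ x y y' z : V, ω ![x, y + y', z] = ω ![x, y, z] + ω ![x, y', z] :=
    fun x y y' z => by
      simp only [← alternatingMap_vec_three_rotate ω x, ω.map_vecCons_add]
  have hthd : ∀ x y z z' : V, ω ![x, y, z + z'] = ω ![x, y, z] + ω ![x, y, z'] :=
    fun x y z z' => by
      simp only [alternatingMap_vec_three_rotate ω _ x y, ω.map_vecCons_add]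
  rw [hvec, hvec a, hvec c]
  simp only [Fin.sum_univ_three, ω.map_vecCons_add, hsnd, hthd, zero_add, fin_three_cyclic_add]
  rw [alternatingMap_vec_three_rotate ω (a 0) (c 1) (a 2),
    ← alternatingMap_vec_three_rotate ω (c 2) (a 0) (a 1),
    alternatingMap_vec_three_rotate ω (c 0) (a 1) (c 2),
    ← alternatingMap_vec_three_rotate ω (a 2) (c 0) (c 1)]
  ring

theorem alternatingMap_vecCons_sum_smul {ι : Type*} [Fintype ι] {n : ℕ}
    (ω : V [⋀^Fin (n + 1)]→ₗ[R] R) (s : ι → R) (b : ι → V) (m : Fin n → V) :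
    ω (Matrix.vecCons (∑ i, s i • b i) m) = ∑ i, s i * ω (Matrix.vecCons (b i) m) := by
  have hsum := ω.map_update_sum Finset.univ 0 (fun i => s i • b i) (Matrix.vecCons 0 m)
  simp only [Matrix.vecCons, Fin.update_cons_zero] at hsum
  exact hsum.trans (Finset.sum_congr rfl fun i _ => ω.map_vecCons_smul m (s i) (b i))

theorem alternatingMap_two_sum_smul (ω : V [⋀^Fin 2]→ₗ[R] R) (s t : Fin 3 → R) (b : Fin 3 → V) :
    ω ![∑ i, s i • b i, ∑ i, t i • b i]
      = ∑ i, (s (i + 1) * t (i + 2) - s (i + 2) * t (i + 1)) * ω ![b (i + 1), b (i + 2)] := by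
  have hself : ∀ x, ω ![x, x] = 0 := fun x =>
    ω.map_eq_zero_of_eq ![x, x] (i := 0) (j := 1) rfl (by decide)
  have hswap : ∀ x y, ω ![y, x] = -ω ![x, y] := fun x y => by
    rw [← ω.map_swap ![x, y] (i := 0) (j := 1) (by decide)]
    exact congrArg ω (by funext k; fin_cases k <;> rfl)
  have hbilin : ω ![∑ i, s i • b i, ∑ i, t i • b i]
      = ∑ i, s i * -∑ j, t j * ω ![b j, b i] := by
    simp only [alternatingMap_vecCons_sum_smul ω s, hswap (∑ i, t i • b i),
      alternatingMap_vecCons_sum_smul ω t]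
  rw [hbilin]
  simp only [Fin.sum_univ_three, hself, hswap (b 0) (b 1), hswap (b 1) (b 2), hswap (b 2) (b 0),
    zero_add, fin_three_cyclic_add]
  ring

end AlternatingForms

section Minors

theorem alternatingMap_graph_eq_sum_minors {V : Type*} [AddCommGroup V] [Module ℝ V]
    (ω : V [⋀^Fin 3]→ₗ[ℝ] ℝ) (A : Matrix (Fin 3) (Fin 3) ℝ) (a b : Fin 3 → V) :
    ω (fun k => a k + ∑ i, A i k • b i)
      = ω a + ∑ i, ∑ j, A i j * ω ![b i, a (j + 1), a (j + 2)]
        + ∑ i, ∑ j, cof A i j * ω ![a j, b (i + 1), b (i + 2)] + A.det * ω b := by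
  have hcof : ∀ j, ω ![a j, ∑ i, A i (j + 1) • b i, ∑ i, A i (j + 2) • b i]
      = ∑ i, cof A i j * ω ![a j, b (i + 1), b (i + 2)] := fun j => by
    refine (alternatingMap_two_sum_smul (ω.curryLeft (a j)) _ _ b).trans
      (Finset.sum_congr rfl fun i _ => ?_)
    rw [cof_apply, mul_comm (A (i + 2) (j + 1))]
    rfl
  simp only [alternatingMap_three_add, alternatingMap_sum_smul_eq_det_mul, hcof,
    alternatingMap_vecCons_sum_smul]
  rw [Finset.sum_comm, Finset.sum_comm (f := fun j i => cof A i j * _)]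

/-- Labels of the minors of a `3 × 3` matrix, by increasing order `0, 1, 2, 3`. -/
abbrev MinorIndex : Type := Unit ⊕ (Fin 3 × Fin 3) ⊕ (Fin 3 × Fin 3) ⊕ Unit

/-- The minors of `A`, with the determinant replaced by `t`: in the limit passage the weak limit
of the determinants is not known to be a determinant from the outset. -/
noncomputable def minors (A : Matrix (Fin 3) (Fin 3) ℝ) (t : ℝ) : MinorIndex → ℝ :=
  Sum.elim (fun _ => 1) (Sum.elim (fun p => A p.1 p.2)
    (Sum.elim (fun p => cof A p.1 p.2) fun _ => t))

/-- The triples of basis vectors of `ℝ³ × ℝ³` whose coefficients in the expansion of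
`(e₁, A e₁) ∧ (e₂, A e₂) ∧ (e₃, A e₃)` are the minors of `A`. The cyclic order of the indices
`j, j + 1, j + 2` avoids signs. -/
noncomputable def minorFrame : MinorIndex → Fin 3 → E3 × E3 :=
  Sum.elim (fun _ k => (e k, 0))
    (Sum.elim (fun p => ![(0, e p.1), (e (p.2 + 1), 0), (e (p.2 + 2), 0)])
      (Sum.elim (fun p => ![(e p.2, 0), (0, e (p.1 + 1)), (0, e (p.1 + 2))])
        fun _ k => (0, e k)))

theorem form_apply_graph_eq_sum_minors (ω : (E3 × E3) [⋀^Fin 3]→L[ℝ] ℝ)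
    (A : Matrix (Fin 3) (Fin 3) ℝ) :
    ω (fun k => (e k, WithLp.toLp 2 (fun i => A i k)))
      = ∑ a, minors A A.det a * ω (minorFrame a) := by
  have hgraph : (fun k => (e k, WithLp.toLp 2 (fun i => A i k)) : Fin 3 → E3 × E3)
      = fun k => (e k, 0) + ∑ i, A i k • (0, e i) := by
    funext k
    refine Prod.ext ?_ ?_
    · simp [Prod.fst_sum]
    · simpa [Prod.snd_sum] using (sum_smul_e (WithLp.toLp 2 fun i => A i k)).symm
  rw [hgraph]
  refine (alternatingMap_graph_eq_sum_minors ω.toAlternatingMap A _ _).trans ?_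
  simp [Fintype.sum_sum_type, Fintype.sum_prod_type, minors, minorFrame, add_assoc]

theorem pairing_single_zero_apply (i j : Fin 3) (L : (E3 × E3) →L[ℝ] E3) :
    pairing (Matrix.single i j 1) 0 L = (L (e j, 0)) i := by
  simp [pairing_apply, Matrix.single_apply, ite_and]

theorem exists_pairing_eq_sum_minors :
    ∃ ℓ : MinorIndex → ((E3 × E3) →L[ℝ] E3) →L[ℝ] ℝ,
      ∀ A t L, pairing (cof A) t L = ∑ a, minors A t a * ℓ a L := by
  refine ⟨Sum.elim 0 (Sum.elim 0 (Sum.elim (fun p => pairing (Matrix.single p.1 p.2 1) 0)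
    fun _ => pairing 0 1)), fun A t L => ?_⟩
  simp [Fintype.sum_sum_type, Fintype.sum_prod_type, minors, pairing_single_zero_apply,
    pairing_apply 0 1, pairing_apply (cof A)]

end Minors

section GraphCurrents

variable {Ω : Opens E3}

theorem W12.integrable_minors [IsFiniteMeasure (volume.restrict (Ω : Set E3))] (w : W12 Ω)
    {θ : E3 → ℝ} (hθ : Integrable θ (volume.restrict (Ω : Set E3))) (a : MinorIndex) :
    Integrable (fun x => minors (w.grad x) (θ x) a) (volume.restrict (Ω : Set E3)) := by
  rcases a with _ | p | p | _
  · exact integrable_const 1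
  · exact (w.memLp_grad p.1 p.2).integrable one_le_two
  · exact w.integrable_cof p.1 p.2
  · exact hθ

variable {u : ℕ → W12 Ω} {u₀ : W12 Ω} {θ : E3 → ℝ}

theorem tendstoWeakly_minors [IsFiniteMeasure (volume.restrict (Ω : Set E3))]
    (hweak : WeakConvW12 u u₀) (hcof : WeakConvCofL1 u u₀)
    (hdet : TendstoWeakly (volume.restrict (Ω : Set E3)) ∞ (fun n x => ((u n).grad x).det) θ)
    (a : MinorIndex) :
    TendstoWeakly (volume.restrict (Ω : Set E3)) ∞
      (fun n x => minors ((u n).grad x) ((u n).grad x).det a)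
      fun x => minors (u₀.grad x) (θ x) a := by
  rcases a with _ | p | p | _
  · exact fun ψ _ => tendsto_const_nhds
  · exact TendstoWeakly.mono_exponent (hweak.2 p.1 p.2) le_top
  · exact hcof p.1 p.2
  · exact hdet

theorem tendsto_integral_sum_minors_mul [IsFiniteMeasure (volume.restrict (Ω : Set E3))]
    (hweak : WeakConvW12 u u₀) (hcof : WeakConvCofL1 u u₀)
    (hint : ∀ n, Integrable (fun x => ((u n).grad x).det) (volume.restrict (Ω : Set E3)))
    (hθ : Integrable θ (volume.restrict (Ω : Set E3)))
    (hdet : TendstoWeakly (volume.restrict (Ω : Set E3)) ∞ (fun n x => ((u n).grad x).det) θ)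
    (hconv : ∀ᵐ x ∂(volume.restrict (Ω : Set E3)),
      Tendsto (fun n => (u n).val x) atTop (𝓝 (u₀.val x)))
    {F : Type*} [TopologicalSpace F] [AddCommGroup F] [Module ℝ F] {T : E3 × E3 → F}
    (hT : Continuous T) (hTc : HasCompactSupport T) (ℓ : MinorIndex → F →L[ℝ] ℝ) :
    Tendsto (fun n => ∫ x in (Ω : Set E3),
        ∑ a, minors ((u n).grad x) ((u n).grad x).det a * ℓ a (T (x, (u n).val x))) atTop
      (𝓝 (∫ x in (Ω : Set E3), ∑ a, minors (u₀.grad x) (θ x) a * ℓ a (T (x, u₀.val x)))) :=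
  tendsto_integral_sum_mul_comp_graph
    (f := fun n x => minors ((u n).grad x) ((u n).grad x).det)
    (f₀ := fun x => minors (u₀.grad x) (θ x)) (b := fun a p => ℓ a (T p))
    (fun n => (u n).integrable_minors (hint n)) (u₀.integrable_minors hθ)
    (tendstoWeakly_minors hweak hcof hdet) (fun n => (u n).memLp_val.1) u₀.memLp_val.1 hconv
    (fun a => (ℓ a).continuous.comp hT) (fun a => hTc.comp_left (map_zero (ℓ a)))

theorem tendsto_surfacePairing [IsFiniteMeasure (volume.restrict (Ω : Set E3))]
    (hweak : WeakConvW12 u u₀) (hcof : WeakConvCofL1 u u₀)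
    (hint : ∀ n, Integrable (fun x => ((u n).grad x).det) (volume.restrict (Ω : Set E3)))
    (hθ : Integrable θ (volume.restrict (Ω : Set E3)))
    (hdet : TendstoWeakly (volume.restrict (Ω : Set E3)) ∞ (fun n x => ((u n).grad x).det) θ)
    (hconv : ∀ᵐ x ∂(volume.restrict (Ω : Set E3)),
      Tendsto (fun n => (u n).val x) atTop (𝓝 (u₀.val x))) (f : 𝓓(cyl Ω, E3)) :
    Tendsto (fun n => surfacePairing (u n) f) atTop
      (𝓝 (∫ x in (Ω : Set E3),
        pairing (cof (u₀.grad x)) (θ x) (fderiv ℝ f (x, u₀.val x)))) := by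
  obtain ⟨ℓ, hℓ⟩ := exists_pairing_eq_sum_minors
  simp only [surfacePairing_eq_integral_pairing, hℓ]
  exact tendsto_integral_sum_minors_mul hweak hcof hint hθ hdet hconv
    (f.contDiff.continuous_fderiv (by simp)) (f.hasCompactSupport.fderiv ℝ) ℓ

theorem tendsto_graphCurrent [IsFiniteMeasure (volume.restrict (Ω : Set E3))]
    (hweak : WeakConvW12 u u₀) (hcof : WeakConvCofL1 u u₀)
    (hint : ∀ n, Integrable (fun x => ((u n).grad x).det) (volume.restrict (Ω : Set E3)))
    (hint₀ : Integrable (fun x => (u₀.grad x).det) (volume.restrict (Ω : Set E3)))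
    (hdet : TendstoWeakly (volume.restrict (Ω : Set E3)) ∞ (fun n x => ((u n).grad x).det)
      fun x => (u₀.grad x).det)
    (hconv : ∀ᵐ x ∂(volume.restrict (Ω : Set E3)),
      Tendsto (fun n => (u n).val x) atTop (𝓝 (u₀.val x))) (ω : TestForm Ω) :
    Tendsto (fun n => graphCurrent (u n) ω) atTop (𝓝 (graphCurrent u₀ ω)) := by
  simp only [graphCurrent, form_apply_graph_eq_sum_minors]
  exact tendsto_integral_sum_minors_mul hweak hcof hint hint₀ hdet hconv
    ω.contDiff.continuous ω.hasCompactSupport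
    fun a => ContinuousAlternatingMap.apply ℝ (E3 × E3) ℝ (minorFrame a)

end GraphCurrents

section Compactness

variable {Ω : Opens E3} {u : ℕ → W12 Ω} {u₀ : W12 Ω}

theorem WeakConvW12.comp_tendsto (h : WeakConvW12 u u₀) {φ : ℕ → ℕ} (hφ : Tendsto φ atTop atTop) :
    WeakConvW12 (fun n => u (φ n)) u₀ :=
  ⟨fun i => TendstoWeakly.comp_tendsto (h.1 i) hφ,
    fun i j => TendstoWeakly.comp_tendsto (h.2 i j) hφ⟩

theorem WeakConvCofL1.comp_tendsto (h : WeakConvCofL1 u u₀) {φ : ℕ → ℕ}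
    (hφ : Tendsto φ atTop atTop) : WeakConvCofL1 (fun n => u (φ n)) u₀ :=
  fun i j => TendstoWeakly.comp_tendsto (h i j) hφ

theorem WeakConvW12.exists_subseq_tendsto_ae (hweak : WeakConvW12 u u₀)
    (hΩ : volume (Ω : Set E3) ≠ ⊤) {M : ℝ}
    (hM : ∀ n, ∀ᵐ x ∂(volume.restrict (Ω : Set E3)), ‖(u n).val x‖ ≤ M) {A : ℝ≥0∞} (hA : A ≠ ⊤)
    (hgrad : ∀ n i j,
      eLpNorm (fun x => (u n).grad x i j) 2 (volume.restrict (Ω : Set E3)) ≤ A) :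
    ∃ φ : ℕ → ℕ, StrictMono φ ∧ ∀ᵐ x ∂(volume.restrict (Ω : Set E3)),
      Tendsto (fun n => (u (φ n)).val x) atTop (𝓝 (u₀.val x)) :=
  exists_subseq_tendsto_ae_of_components le_rfl
    (fun n i => ((u n).memLp_val_apply i).1.sub (u₀.memLp_val_apply i).1)
    fun i => tendsto_eLpNorm_one_sub_of_weakConv (hweak.1 i)
      (fun n => (hM n).mono fun _ hx => (PiLp.norm_apply_le _ i).trans hx) hA
      (fun n j => hgrad n i j) hΩ

theorem ae_eq_det_of_surfaceEnergy_le [IsFiniteMeasure (volume.restrict (Ω : Set E3))]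
    (hweak : WeakConvW12 u u₀) (hcof : WeakConvCofL1 u u₀) {M : ℝ}
    (hM : ∀ n, ∀ᵐ x ∂(volume.restrict (Ω : Set E3)), ‖(u n).val x‖ ≤ M) {C : NNReal}
    (hsurf : ∀ n, surfaceEnergy (u n) ≤ C)
    (hint : ∀ n, Integrable (fun x => ((u n).grad x).det) (volume.restrict (Ω : Set E3)))
    {θ : E3 → ℝ} (hθ : Integrable θ (volume.restrict (Ω : Set E3)))
    (hdet : TendstoWeakly (volume.restrict (Ω : Set E3)) ∞ (fun n x => ((u n).grad x).det) θ)
    (hconv : ∀ᵐ x ∂(volume.restrict (Ω : Set E3)),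
      Tendsto (fun n => (u n).val x) atTop (𝓝 (u₀.val x))) :
    θ =ᵐ[volume.restrict (Ω : Set E3)] fun x => (u₀.grad x).det := by
  have hM₀ : ∀ᵐ x ∂(volume.restrict (Ω : Set E3)), ‖u₀.val x‖ ≤ M := by
    filter_upwards [hconv, ae_all_iff.2 hM] with x hx hMx
    exact le_of_tendsto' hx.norm hMx
  exact u₀.ae_eq_det_of_bounded_pairing hM₀ hθ fun f B hB hf =>
    le_of_tendsto' (tendsto_surfacePairing hweak hcof hint hθ hdet hconv f).abs
      fun n => abs_surfacePairing_le (hsurf n) f hB hf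

theorem exists_subseq_tendsto_graphCurrent (hΩ : volume (Ω : Set E3) ≠ ⊤) {H : ℝ → ℝ}
    (hH₀ : ∀ t, 0 < t → 0 ≤ H t) (hH : Tendsto (fun t => H t / t) atTop atTop)
    (hweak : WeakConvW12 u u₀) (hcof : WeakConvCofL1 u u₀) {M : ℝ}
    (hM : ∀ n, ∀ᵐ x ∂(volume.restrict (Ω : Set E3)), ‖(u n).val x‖ ≤ M)
    (hpos : ∀ n, ∀ᵐ x ∂(volume.restrict (Ω : Set E3)), 0 < ((u n).grad x).det)
    {C : NNReal} (hsurf : ∀ n, surfaceEnergy (u n) ≤ C)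
    {B : NNReal} (hE : ∀ n, energy H (u n) ≤ B) :
    u₀.HasGraphCurrent ∧ ∃ φ : ℕ → ℕ, StrictMono φ ∧ ∀ ω : TestForm Ω,
      Tendsto (fun n => graphCurrent (u (φ n)) ω) atTop (𝓝 (graphCurrent u₀ ω)) := by
  have : IsFiniteMeasure (volume.restrict (Ω : Set E3)) := isFiniteMeasure_restrict.2 hΩ
  have : Fact ((2 : ℝ≥0∞) ≠ ⊤) := ⟨ENNReal.ofNat_ne_top⟩
  have hui := uniformIntegrable_det hH hpos ENNReal.coe_ne_top hE
  have hint : ∀ n, Integrable (fun x => ((u n).grad x).det) (volume.restrict (Ω : Set E3)) :=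
    fun n => memLp_one_iff_integrable.1 (hui.memLp n)
  obtain ⟨φ, hφ, θ, hθ, hdet⟩ := exists_subseq_tendstoWeakly_of_uniformIntegrable hui
  have hgrad : ∀ n i j, eLpNorm (fun x => (u n).grad x i j) 2 (volume.restrict (Ω : Set E3))
      ≤ B ^ (1 / (2 : ℝ)) := fun n i j =>
    (W12.eLpNorm_grad_le hH₀ (hpos n) i j).trans (ENNReal.rpow_le_rpow (hE n) (by norm_num))
  obtain ⟨ψ, hψ, hconv⟩ := (hweak.comp_tendsto hφ.tendsto_atTop).exists_subseq_tendsto_ae hΩ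
    (fun n => hM (φ n)) (ENNReal.rpow_ne_top_of_nonneg (by norm_num) ENNReal.coe_ne_top)
    fun n => hgrad (φ n)
  have hφψ := (hφ.comp hψ).tendsto_atTop
  have hweak' := hweak.comp_tendsto hφψ
  have hcof' := hcof.comp_tendsto hφψ
  have hdet' := hdet.comp_tendsto hψ.tendsto_atTop
  have hθdet := ae_eq_det_of_surfaceEnergy_le hweak' hcof' (fun n => hM _) (fun n => hsurf _)
    (fun n => hint _) hθ hdet' hconv
  have hint₀ := hθ.congr hθdet
  exact ⟨hint₀, φ ∘ ψ, hφ.comp hψ, tendsto_graphCurrent hweak' hcof' (fun n => hint _) hint₀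
    (hdet'.congr_limit hθdet) hconv⟩

end Compactness

section MinimizingSequences

theorem IsMinimizingSeq.exists_nnreal_eventually_le {X : Type*} {F : X → ℝ≥0∞} {S : Set X}
    {u : ℕ → X} (hu : IsMinimizingSeq F S u) : ∃ B : NNReal, ∀ᶠ n in atTop, F (u n) ≤ B := by
  obtain ⟨-, hfinite, hlim⟩ := hu
  obtain ⟨B, hB, -⟩ := ENNReal.lt_iff_exists_nnreal_btwn.1 hfinite
  exact ⟨B, (hlim.eventually_lt_const hB).mono fun _ => le_of_lt⟩

theorem exists_uniform_bounds_of_isMinimizingSeq {Ω : Opens E3} {g : E3 → E3} {M : ℝ}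
    {H : ℝ → ℝ} {u : ℕ → W12 Ω}
    (hmin : IsMinimizingSeq (energy H) (admissibleNC Ω g M) u ∨
      (IsMinimizingSeq (energy H) (admissible Ω g M) u ∧
        ∃ C : ℝ, ∀ n, surfaceEnergy (u n) ≤ ENNReal.ofReal C)) :
    (∀ n, u n ∈ admissible Ω g M) ∧ (∃ C : NNReal, ∀ n, surfaceEnergy (u n) ≤ C) ∧
      ∃ B : NNReal, ∀ᶠ n in atTop, energy H (u n) ≤ B := by
  rcases hmin with hnc | ⟨hbdd, C, hC⟩
  · exact ⟨fun n => (hnc.1 n).1, ⟨0, fun n => (hnc.1 n).2.le⟩, hnc.exists_nnreal_eventually_le⟩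
  · exact ⟨hbdd.1, ⟨C.toNNReal, hC⟩, hbdd.exists_nnreal_eventually_le⟩

end MinimizingSequences

end NeoHookean

open NeoHookean in
theorem mainTheorem8_general (Ω : Opens E3) (hΩ : volume (Ω : Set E3) ≠ ⊤) (M : ℝ) (H : ℝ → ℝ)
    (hH₀ : ∀ t, 0 < t → 0 ≤ H t) (hH : Tendsto (fun t => H t / t) atTop atTop)
    (u : ℕ → W12 Ω) (u₀ : W12 Ω)
    (hM : ∀ n, ∀ᵐ x ∂(volume.restrict (Ω : Set E3)), ‖(u n).val x‖ ≤ M)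
    (hpos : ∀ n, ∀ᵐ x ∂(volume.restrict (Ω : Set E3)), 0 < ((u n).grad x).det)
    {C : NNReal} (hsurf : ∀ n, surfaceEnergy (u n) ≤ C)
    {B : NNReal} (hE : ∀ᶠ n in atTop, energy H (u n) ≤ B)
    (hweak : WeakConvW12 u u₀)
    (hcof : WeakConvCofL1 u u₀) :
    u₀.HasGraphCurrent ∧ (∀ᶠ n in atTop, (u n).HasGraphCurrent) ∧
      ∀ ω : TestForm Ω,
        Tendsto (fun n => graphCurrent (u n) ω) atTop (𝓝 (graphCurrent u₀ ω)) := by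
  have hsubseq : ∀ ns : ℕ → ℕ, Tendsto ns atTop atTop → u₀.HasGraphCurrent ∧
      ∃ ms : ℕ → ℕ, ∀ ω : TestForm Ω,
        Tendsto (fun n => graphCurrent (u (ns (ms n))) ω) atTop (𝓝 (graphCurrent u₀ ω)) := by
    intro ns hns
    obtain ⟨k, hk⟩ := eventually_atTop.1 (hns.eventually hE)
    have hshift : Tendsto (fun n => ns (n + k)) atTop atTop := hns.comp (tendsto_add_atTop_nat k)
    obtain ⟨hdet, φ, -, hφ⟩ := exists_subseq_tendsto_graphCurrent hΩ hH₀ hH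
      (hweak.comp_tendsto hshift) (hcof.comp_tendsto hshift) (fun n => hM _) (fun n => hpos _)
      (fun n => hsurf _) fun n => hk (n + k) (Nat.le_add_left k n)
    exact ⟨hdet, fun n => φ n + k, hφ⟩
  have : IsFiniteMeasure (volume.restrict (Ω : Set E3)) := isFiniteMeasure_restrict.2 hΩ
  refine ⟨(hsubseq id tendsto_id).1, hE.mono fun n hn => ?_, fun ω =>
    tendsto_of_subseq_tendsto fun ns hns => (hsubseq ns hns).2.imp fun ms hms => hms ω⟩
  exact memLp_one_iff_integrable.1 ((uniformIntegrable_det hH (fun _ : Unit => hpos n)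
    ENNReal.coe_ne_top fun _ => hn).memLp ())

open NeoHookean in
theorem mainTheorem8 (Ω Ω' : Opens E3)
    (hΩ : IsSmoothBoundedDomain (Ω : Set E3)) (hΩ' : IsSmoothBoundedDomain (Ω' : Set E3))
    (g : E3 → E3) (hg : IsC1Diffeo g (closure (Ω : Set E3)) (closure (Ω' : Set E3)))
    (M : ℝ) (hM : 0 < M) (H : ℝ → ℝ) (hH : IsVolumetricEnergy H)
    (u : ℕ → W12 Ω) (u₀ : W12 Ω)
    (hmin : IsMinimizingSeq (energy H) (admissibleNC Ω g M) u ∨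
      (IsMinimizingSeq (energy H) (admissible Ω g M) u ∧
        ∃ C : ℝ, ∀ n, surfaceEnergy (u n) ≤ ENNReal.ofReal C))
    (hweak : WeakConvW12 u u₀)
    (hcof : WeakConvCofL1 u u₀) :
    u₀.HasGraphCurrent ∧ (∀ᶠ n in atTop, (u n).HasGraphCurrent) ∧
      ∀ ω : TestForm Ω,
        Tendsto (fun n => graphCurrent (u n) ω) atTop (𝓝 (graphCurrent u₀ ω)) := by
  obtain ⟨hadm, ⟨C, hC⟩, B, hB⟩ := exists_uniform_bounds_of_isMinimizingSeq hmin
  exact mainTheorem8_general Ω hΩ.isBounded.measure_lt_top.ne M H hH.nonneg hH.superlinear u u₀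
    (fun n => (hadm n).2.1) (fun n => (hadm n).2.2.1) hC hB hweak hcof
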